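/- All graphs are finite and simple. A graph is \emph{$P_4$-sparse} if every set of five vertices induces at most one $P_4$; a \emph{wing} of an induced path $P_4$ is one of its two end edges. A \emph{spider} is a graph whose vertex set is partitioned into $S,K,R$ with $S$ independent, $K$ a clique, $|S|=|K|\ge 2$, every vertex of $R$ adjacent to all of $K$ and to none of $S$, and a bijection $f:S\to K$ such that either $N(s)\cap K=\{f(s)\}$ for all $s\in S$ (\emph{thin}) or $|K|\ge 3$ and $N(s)\cap K=K\setminus\{f(s)\}$ for all $s\in S$ (\emph{thick}). A spider \emph{of} a graph $G$ is an induced subgraph that is a spider and whose vertex set is a module (every other vertex of $G$ is adjacent to all or to none of its vertices). The \emph{$P_4$-sparse tree} $T_G$ of a $P_4$-sparse graph $G$ is the rooted tree with the vertices of $G$ as leaves and with internal nodes labelled $0$, $1$ or $2$, each with at least two children, such that no $0$-node ($1$-node) has a $0$-node ($1$-node) as a child, vertices whose least common ancestor is a $0$-node ($1$-node) are non-adjacent (adjacent), and the leaves below a $2$-node induce a spider $(S,K,R)$, the children of this node being the leaves for $S\cup K$ and, if $R\neq\emptyset$, the root of a subtree for $R$. Let $G$ be a $P_4$-sparse graph,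 $u\in V(G)$, and let $G+uw$ be $G$ together with a new vertex $w$ adjacent to $u$ only. A \emph{$P_4$-sparse completion} of $G+uw$ is a $P_4$-sparse graph on $V(G)\cup\{w\}$ that contains $G+uw$; its edges not in $G+uw$ are its \emph{fill edges}, and it is \emph{minimum} if it has the least possible number of them. Let $t_0t_1\cdots t_h u$ be the path of $T_G$ from the root to the leaf for $u$, and let $V_i$ be the set of vertices below the children of $t_i$ other than the child on the path. \emph{Formation 1} replaces the leaf for $u$ by a $1$-node with the children $u,w$. \emph{Formation 2} deletes the leaf for $u$ and replaces a $1$- or $2$-node $t_i$ of the path by a $1$-node with the two children $u$ and a $0$-node, the children of the $0$-node being $w$ and the subgraph $G[Z]$ for $Z=V_i\cup\cdots\cup V_h$. Thus, with $Z=\emptyset$ for Formation 1, the resulting graph is $G+uw$ together with all edges from $u$ to $Z$ and all edges from $w$ to $N_G(u)\setminus Z$. A completion of $G+uw$ \emph{uses Formation 1 or 2} if it arises by applying one of them, in this way, to the tree of some $P_4$-sparse graph $G'\supseteq G$ on $V(G)$ (that is, possibly after other fill edges have been added); it uses it \emph{directly} if $G'=G$. Then: (1) Some minimum $P_4$-sparse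 completion of $G+uw$ has fewer fill edges than every $P_4$-sparse completion of $G+uw$ that uses Formation 1 or 2 if and only if $uw$ is a wing of a $P_4$ in every minimum $P_4$-sparse completion of $G+uw$. If $u$ is not a vertex of a spider of $G$, the same equivalence also holds with the completions that use Formation 1 or 2 directly. (2) If $uw$ is a wing of a $P_4$ in a minimum $P_4$-sparse completion $G_{OPT}$ of $G+uw$, then either (i) $u$ is a vertex (in $S$, $K$ or $R$) of a spider of $G$, or (ii) there are $j$ with $0\le j<h$ and vertices $a\in V_j$, $b\in V_{j+1}$ such that $t_j$ is a $1$-node, $t_{j+1}$ is a $0$-node, $a$ is universal in $G[V_j]$, $b$ is isolated in $G[V_{j+1}]$, and in $G_{OPT}$ the path $w\,u\,a\,b$ is an induced $P_4$ in a thin spider $(S,K,R)$ of $G_{OPT}$ with $S=\{w,b\}$, $K=\{u,a\}$ and $R=(V_{j+1}\setminus\{b\})\cup V_{j+2}\cup\cdots\cup V_h$. -/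

import Mathlib

namespace P4Completion

/-- `a b c d` is an induced path on four vertices of `G`, in this order (the conditions force the
four vertices to be distinct). -/
def IsP4 {V : Type*} (G : SimpleGraph V) (a b c d : V) : Prop :=
  G.Adj a b ∧ G.Adj b c ∧ G.Adj c d ∧ ¬ G.Adj a c ∧ ¬ G.Adj a d ∧ ¬ G.Adj b d

/-- The vertex set `B` induces a `P₄` in `G`. -/
def InducesP4 {V : Type*} (G : SimpleGraph V) (B : Set V) : Prop :=
  ∃ a b c d : V, B = {a, b, c, d} ∧ IsP4 G a b c d

/-- `G` is `P₄`-sparse: every set of five vertices induces at most one `P₄`. -/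
def IsP4Sparse {V : Type*} (G : SimpleGraph V) : Prop :=
  ∀ A : Set V, A.ncard = 5 → ∀ B C : Set V, B ⊆ A → C ⊆ A →
    InducesP4 G B → InducesP4 G C → B = C

/-- The edge `x y` is a wing (an end edge) of some `P₄` of `G`. -/
def IsWing {V : Type*} (G : SimpleGraph V) (x y : V) : Prop :=
  ∃ c d : V, IsP4 G x y c d ∨ IsP4 G y x c d

/-! ### Spiders -/

/-- What thin and thick spiders have in common, for the subgraph of `G` induced by the disjoint
union `S ∪ K ∪ R`; only the adjacencies between `S` and `K` are left open. -/
def IsSpiderBase {V : Type*} (G : SimpleGraph V) (S K R : Set V) : Prop :=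
  Disjoint S K ∧ Disjoint S R ∧ Disjoint K R ∧ G.IsIndepSet S ∧ G.IsClique K ∧
    (∀ r ∈ R, ∀ k ∈ K, G.Adj r k) ∧ (∀ r ∈ R, ∀ s ∈ S, ¬ G.Adj r s)

/-- `(S, K, R)` is a thin spider. -/
def IsThinSpider {V : Type*} (G : SimpleGraph V) (S K R : Set V) : Prop :=
  IsSpiderBase G S K R ∧ 2 ≤ K.ncard ∧
    ∃ f : V → V, Set.BijOn f S K ∧ ∀ s ∈ S, ∀ k ∈ K, (G.Adj s k ↔ k = f s)

/-- `(S, K, R)` is a thick spider (with `|K| ≥ 3`, so that no spider is both thin and thick). -/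
def IsThickSpider {V : Type*} (G : SimpleGraph V) (S K R : Set V) : Prop :=
  IsSpiderBase G S K R ∧ 3 ≤ K.ncard ∧
    ∃ f : V → V, Set.BijOn f S K ∧ ∀ s ∈ S, ∀ k ∈ K, (G.Adj s k ↔ k ≠ f s)

/-- `S ∪ K ∪ R` induces a spider in `G` with this partition. -/
def IsSpider {V : Type*} (G : SimpleGraph V) (S K R : Set V) : Prop :=
  IsThinSpider G S K R ∨ IsThickSpider G S K R

/-- `M` is a module of `G`: a vertex outside `M` is adjacent to all vertices of `M` or to none. -/
def IsModule {V : Type*} (G : SimpleGraph V) (M : Set V) : Prop :=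
  ∀ x, x ∉ M → (∀ y ∈ M, G.Adj x y) ∨ (∀ y ∈ M, ¬ G.Adj x y)

/-- `u` is a vertex (in `S`, `K` or `R`) of a spider of `G`; the spiders of a `P₄`-sparse graph,
which are the vertex sets below the 2-nodes of its `P₄`-sparse tree, are the modules that induce a
spider. -/
def InSpider {V : Type*} (G : SimpleGraph V) (u : V) : Prop :=
  ∃ S K R : Set V, IsSpider G S K R ∧ IsModule G (S ∪ K ∪ R) ∧ u ∈ S ∪ K ∪ R

/-! ### The `P₄`-sparse tree -/

/-- The labels of the internal tree nodes. -/
inductive NodeLabel : Type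
  | zero
  | one
  | two

/-- Rooted trees whose leaves are vertices and whose internal nodes carry a label. -/
inductive LabTree (V : Type*) : Type _
  | leaf (v : V) : LabTree V
  | node (c : NodeLabel) (k : ℕ) (child : Fin k → LabTree V) : LabTree V

/-- The vertices at the leaves of a tree. -/
def LabTree.leaves {V : Type*} : LabTree V → Set V
  | .leaf v => {v}
  | .node _ _ child => ⋃ i, (child i).leaves

/-- The root of the tree is an internal node with label `c`. -/
def LabTree.HasRoot {V : Type*} : LabTree V → NodeLabel → Prop
  | .leaf _, _ => False
  | .node d _ _, c => d = c

/-- What an internal node demands of its children. The children of a 0-node (1-node) are not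
0-nodes (1-nodes), and vertices below different children are non-adjacent (adjacent). The vertices
below a 2-node induce a spider `(S, K, R)`; its children are the leaves for the vertices of
`S ∪ K` and, if `R` is not empty, a subtree for `R`. -/
def NodeOK {V : Type*} (G : SimpleGraph V) (k : ℕ) (child : Fin k → LabTree V) :
    NodeLabel → Prop
  | .zero => (∀ i, ¬ (child i).HasRoot .zero) ∧
      ∀ i j, i ≠ j → ∀ x ∈ (child i).leaves, ∀ y ∈ (child j).leaves, ¬ G.Adj x y
  | .one => (∀ i, ¬ (child i).HasRoot .one) ∧
      ∀ i j, i ≠ j → ∀ x ∈ (child i).leaves, ∀ y ∈ (child j).leaves, G.Adj x y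
  | .two => ∃ S K R : Set V, IsSpider G S K R ∧ (⋃ i, (child i).leaves) = S ∪ K ∪ R ∧
      ∀ i, (∃ v ∈ S ∪ K, child i = .leaf v) ∨ (child i).leaves = R

/-- The tree represents the subgraph of `G` induced by its leaves: every internal node has at least
two children, no vertex is at two leaves, and every internal node satisfies `NodeOK`. -/
def LabTree.Represents {V : Type*} (G : SimpleGraph V) : LabTree V → Prop
  | .leaf _ => True
  | .node c k child => 2 ≤ k ∧ (∀ i, (child i).Represents G) ∧
      (∀ i j, i ≠ j → Disjoint (child i).leaves (child j).leaves) ∧ NodeOK G k child c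

/-- `T` is the `P₄`-sparse tree of `G`. -/
def IsP4SparseTree {V : Type*} (G : SimpleGraph V) (T : LabTree V) : Prop :=
  T.Represents G ∧ T.leaves = Set.univ

/-- `IsPath T u p`: if `t₀ t₁ ⋯ t_h u` is the path of `T` from its root to the leaf for `u`, then
`p` is the list of the pairs (label of `t_i`, `V_i`) for `i = 0, …, h`, where `V_i` is the set of
the vertices below the children of `t_i` other than the child on the path. -/
inductive IsPath {V : Type*} : LabTree V → V → List (NodeLabel × Set V) → Prop
  | leaf (u : V) : IsPath (.leaf u) u []
  | node (c : NodeLabel) (k : ℕ) (child : Fin k → LabTree V) (i : Fin k) (u : V)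
      (p : List (NodeLabel × Set V)) (h : IsPath (child i) u p) :
      IsPath (.node c k child) u ((c, ⋃ j ∈ {j : Fin k | j ≠ i}, (child j).leaves) :: p)

/-- `V_i ∪ V_{i+1} ∪ ⋯ ∪ V_h`. -/
def lower {V : Type*} (p : List (NodeLabel × Set V)) (i : ℕ) : Set V :=
  {x | ∃ e ∈ p.drop i, x ∈ e.2}

/-! ### Adding a tail, and completions -/

/-- The graph `G + uw`; the new vertex `w` is `none : Option V`. -/
def addTail {V : Type*} (G : SimpleGraph V) (u : V) : SimpleGraph (Option V) :=
  G.map Function.Embedding.some ⊔ SimpleGraph.edge (some u) none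

/-- `H` is a `P₄`-sparse completion of `G + uw`. -/
def IsCompletion {V : Type*} (G : SimpleGraph V) (u : V) (H : SimpleGraph (Option V)) : Prop :=
  addTail G u ≤ H ∧ IsP4Sparse H

/-- The number of fill edges of `H` (excluding the tail `uw`). -/
noncomputable def fill {V : Type*} (G : SimpleGraph V) (u : V) (H : SimpleGraph (Option V)) : ℕ :=
  (H.edgeSet \ (addTail G u).edgeSet).ncard

/-- `H` is a minimum `P₄`-sparse completion of `G + uw`. -/
def IsMinCompletion {V : Type*} (G : SimpleGraph V) (u : V) (H : SimpleGraph (Option V)) : Prop :=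
  IsCompletion G u H ∧ ∀ H', IsCompletion G u H' → fill G u H ≤ fill G u H'

/-! ### Formations 1 and 2 -/

/-- The graph obtained from `G` by giving `u`, `w` and `Z` the form of the tree whose root is a
1-node with the children `u` and a 0-node, the 0-node having the children `w` and (the tree of) `Z`:
`u` becomes adjacent to `w` and to all of `Z`, and `w` becomes adjacent to `u` and to the neighbours
of `u` outside `Z`. -/
def formationGraph {V : Type*} (G : SimpleGraph V) (u : V) (Z : Set V) :
    SimpleGraph (Option V) :=
  addTail G u ⊔ SimpleGraph.fromRel (fun x y : Option V =>
    (∃ z ∈ Z, x = some u ∧ y = some z) ∨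
    (∃ v, v ∉ Z ∧ G.Adj u v ∧ x = none ∧ y = some v))

/-- `H` results from `G` (with path `p` to `u` in its tree) by replacing the leaf for `u` by
Formation 1 (`Z = ∅`), or by removing this leaf and replacing a 1- or 2-node `t_i` of the path by
Formation 2 (`Z = V_i ∪ ⋯ ∪ V_h`). -/
def IsFormation {V : Type*} (G : SimpleGraph V) (u : V) (p : List (NodeLabel × Set V))
    (H : SimpleGraph (Option V)) : Prop :=
  H = formationGraph G u ∅ ∨
    ∃ (i : ℕ) (c : NodeLabel) (W : Set V), p[i]? = some (c, W) ∧ (c = .one ∨ c = .two) ∧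
      H = formationGraph G u (lower p i)

/-- `H` results from Formation 1 or 2 after some (possibly no) fill edges between vertices of `G`
have been added: the formation is used in the tree of a `P₄`-sparse graph `G'` with the same
vertices that contains `G`. -/
def UsesFormation {V : Type*} (G : SimpleGraph V) (u : V) (H : SimpleGraph (Option V)) : Prop :=
  ∃ (G' : SimpleGraph V) (T : LabTree V) (p : List (NodeLabel × Set V)),
    G ≤ G' ∧ IsP4Sparse G' ∧ IsP4SparseTree G' T ∧ IsPath T u p ∧ IsFormation G' u p H

/-- Some minimum completion has fewer fill edges than every completion using Formation 1 or 2. -/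
def BeatsFormations {V : Type*} (G : SimpleGraph V) (u : V) : Prop :=
  ∃ H, IsMinCompletion G u H ∧
    ∀ H', IsCompletion G u H' → UsesFormation G u H' → fill G u H < fill G u H'

/-- The same for the completions that use Formation 1 or 2 directly in the tree of `G`. -/
def BeatsDirectFormations {V : Type*} (G : SimpleGraph V) (u : V)
    (p : List (NodeLabel × Set V)) : Prop :=
  ∃ H, IsMinCompletion G u H ∧
    ∀ H', IsCompletion G u H' → IsFormation G u p H' → fill G u H < fill G u H'

end P4Completion

/-!
Let `x` have level `i` if `x ∈ V_i`. For every `i` the vertices of level at least `i` form a module,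
so a formation may be carried out at any level, and its fill edges are counted by comparing levels.

If `uw` is not a wing of a completion `H`, consider the node of the tree of `H` at which `u` and `w`
branch off. It provides a module `M` of `G' = H - w` with `u ∈ M` such that the formation of `G'`
with `Z = M \ {u}` costs no more than `H`. If no `2`-node lies on the path to `u` in the tree of
`G`, then replacing `M` by the set of all vertices from some level on does not raise the cost
either, and the formation applies to `G` itself. Conversely, `uw` is never a wing after a formation.
This gives the first claim.

Otherwise `u` and `w` are a leg and a body vertex, in some order, of a spider of `H` on a module
`N`. If `H` is minimum, it costs no more than Formation 1, nor than the formation at the least level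
of a vertex `a` of `N` adjacent to `u` in `G`, nor than the result of a local change inside `N`.
This forces `u` into the body and excludes thick spiders; for a thin spider it leaves room for at
most one excess fill edge, hence for two legs only, and fixes the levels of all vertices of the
spider. This gives the second claim.
-/

namespace P4Completion

/-! ### Induced paths and modules -/

section Paths

variable {V W : Type*} {G H : SimpleGraph V} {X : Set V} {a b c d e : V}

theorem IsP4.reverse (h : IsP4 G a b c d) : IsP4 G d c b a := by
  obtain ⟨hab, hbc, hcd, hac, had, hbd⟩ := h
  exact ⟨hcd.symm, hbc.symm, hab.symm, mt SimpleGraph.Adj.symm hbd, mt SimpleGraph.Adj.symm had,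
    mt SimpleGraph.Adj.symm hac⟩

theorem IsP4.pairwise_ne (h : IsP4 G a b c d) :
    a ≠ b ∧ a ≠ c ∧ a ≠ d ∧ b ≠ c ∧ b ≠ d ∧ c ≠ d := by
  obtain ⟨hab, hbc, hcd, hac, had, hbd⟩ := h
  refine ⟨hab.ne, ?_, ?_, hbc.ne, ?_, hcd.ne⟩
  · rintro rfl; exact had hcd
  · rintro rfl; exact hac hcd.symm
  · rintro rfl; exact had hab

theorem IsP4.compl (h : IsP4 G a b c d) : IsP4 Gᶜ b d a c := by
  have := h.pairwise_ne
  obtain ⟨hab, hbc, hcd, hac, had, hbd⟩ := h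
  simp only [IsP4, SimpleGraph.compl_adj]
  grind [SimpleGraph.adj_comm]

theorem IsP4.ncard_eq_four (h : IsP4 G a b c d) : ({a, b, c, d} : Set V).ncard = 4 := by
  have := h.pairwise_ne
  classical
  rw [Set.ncard_eq_toFinset_card']
  simp only [Set.toFinset_insert, Set.toFinset_singleton]
  grind

theorem IsP4.exists_adj_of_mem (h : IsP4 G a b c d) (he : e ∈ ({a, b, c, d} : Set V)) :
    ∃ x ∈ ({a, b, c, d} : Set V), G.Adj e x := by
  rcases he with rfl | rfl | rfl | rfl
  exacts [⟨b, by simp, h.1⟩, ⟨a, by simp, h.1.symm⟩, ⟨b, by simp, h.2.1.symm⟩,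
    ⟨c, by simp, h.2.2.1.symm⟩]

theorem IsP4.exists_not_adj_of_mem (h : IsP4 G a b c d) (he : e ∈ ({a, b, c, d} : Set V)) :
    ∃ x ∈ ({a, b, c, d} : Set V), x ≠ e ∧ ¬ G.Adj e x := by
  have hne := h.pairwise_ne
  obtain ⟨-, -, -, hac, had, hbd⟩ := h
  rcases he with rfl | rfl | rfl | rfl
  · exact ⟨d, by simp, hne.2.2.1.symm, had⟩
  · exact ⟨d, by simp, hne.2.2.2.2.1.symm, hbd⟩
  · exact ⟨a, by simp, hne.2.1, mt SimpleGraph.Adj.symm hac⟩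
  · exact ⟨a, by simp, hne.2.2.1, mt SimpleGraph.Adj.symm had⟩

/-- The vertex `e` sees none of the path `a b c d`, only its midpoints, or all of it: exactly then
the five vertices induce no second `P₄`. -/
def SeesEvenly (G : SimpleGraph V) (e a b c d : V) : Prop :=
  (G.Adj e a ↔ G.Adj e d) ∧ (G.Adj e b ↔ G.Adj e c) ∧ (G.Adj e a → G.Adj e b)

/-- The subgraph induced by `X` is `P₄`-sparse, in terms of the vertices outside a path instead of
sets of five vertices. -/
def IsP4SparseOn (G : SimpleGraph V) (X : Set V) : Prop :=
  ∀ ⦃a⦄, a ∈ X → ∀ ⦃b⦄, b ∈ X → ∀ ⦃c⦄, c ∈ X → ∀ ⦃d⦄, d ∈ X → ∀ ⦃e⦄, e ∈ X →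
    IsP4 G a b c d → e ≠ a → e ≠ b → e ≠ c → e ≠ d → SeesEvenly G e a b c d

theorem IsP4SparseOn.mono {Y : Set V} (hX : IsP4SparseOn G X) (hYX : Y ⊆ X) :
    IsP4SparseOn G Y :=
  fun _ ha _ hb _ hc _ hd _ he => hX (hYX ha) (hYX hb) (hYX hc) (hYX hd) (hYX he)

theorem IsP4SparseOn.congr (hG : IsP4SparseOn G X)
    (hGH : ∀ x ∈ X, ∀ y ∈ X, (H.Adj x y ↔ G.Adj x y)) : IsP4SparseOn H X := by
  intro a ha b hb c hc d hd e he
  simp +contextual only [IsP4, SeesEvenly, hGH, ha, hb, hc, hd, he]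
  exact hG ha hb hc hd he

theorem IsP4SparseOn.insert_isolated (hG : IsP4SparseOn G X) {w : V}
    (hw : ∀ x ∈ X, ¬ G.Adj w x) : IsP4SparseOn G (insert w X) := by
  intro a ha b hb c hc d hd e he h hea heb hec hed
  have hne : ∀ x ∈ insert w X, ¬ G.Adj w x := by
    rintro x (rfl | hx)
    exacts [SimpleGraph.irrefl _, hw x hx]
  have mem : ∀ {x y}, x ∈ insert w X → y ∈ insert w X → G.Adj x y → x ∈ X := fun hx hy hxy =>
    hx.resolve_left fun h => hne _ hy (h ▸ hxy)
  rcases he with rfl | he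
  · simp [SeesEvenly, *]
  · exact hG (mem ha hb h.1) (mem hb ha h.1.symm) (mem hc hd h.2.2.1) (mem hd hc h.2.2.1.symm) he
      h hea heb hec hed

theorem IsP4SparseOn.insert_universal (hG : IsP4SparseOn G X) {u : V}
    (hu : ∀ x ∈ X, x ≠ u → G.Adj u x) : IsP4SparseOn G (insert u X) := by
  intro a ha b hb c hc d hd e he h hea heb hec hed
  have hadj : ∀ x ∈ insert u X, x ≠ u → G.Adj u x := by
    rintro x (rfl | hx) hxu
    exacts [absurd rfl hxu, hu x hx hxu]
  have mem : ∀ {x y}, x ∈ insert u X → y ∈ insert u X → x ≠ y → ¬ G.Adj x y → x ∈ X :=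
    fun hx hy hne hxy => hx.resolve_left fun h => hxy (h ▸ hadj _ hy (h ▸ hne.symm))
  have hne := h.pairwise_ne
  obtain ⟨-, -, -, hac, had, hbd⟩ := id h
  rcases he with rfl | he
  · simp [SeesEvenly, hea.symm, heb.symm, hec.symm, hed.symm, *]
  · exact hG (mem ha hc hne.2.1 hac) (mem hb hd hne.2.2.2.2.1 hbd)
      (mem hc ha hne.2.1.symm (mt SimpleGraph.Adj.symm hac))
      (mem hd ha hne.2.2.1.symm (mt SimpleGraph.Adj.symm had)) he h hea heb hec hed

theorem IsP4Sparse.eq_of_subset_insert (hG : IsP4Sparse G) {a' b' c' d' : V}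
    (h : IsP4 G a b c d) (h' : IsP4 G a' b' c' d') (he : e ∉ ({a, b, c, d} : Set V))
    (hsub : ({a', b', c', d'} : Set V) ⊆ insert e {a, b, c, d}) :
    ({a', b', c', d'} : Set V) = {a, b, c, d} :=
  hG (insert e {a, b, c, d}) (by rw [Set.ncard_insert_of_notMem he, h.ncard_eq_four]) _ _ hsub
    (Set.subset_insert _ _) ⟨a', b', c', d', rfl, h'⟩ ⟨a, b, c, d, rfl, h⟩

theorem IsP4Sparse.seesEvenly (hG : IsP4Sparse G) (h : IsP4 G a b c d) (hea : e ≠ a)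
    (heb : e ≠ b) (hec : e ≠ c) (hed : e ≠ d) : SeesEvenly G e a b c d := by
  have he : e ∉ ({a, b, c, d} : Set V) := by simp [hea, heb, hec, hed]
  have not_isP4 : ∀ {a' b' c' d'}, ({a', b', c', d'} : Set V) ⊆ insert e {a, b, c, d} →
      e ∈ ({a', b', c', d'} : Set V) → ¬ IsP4 G a' b' c' d' := fun hsub he' h' =>
    he (hG.eq_of_subset_insert h h' he hsub ▸ he')
  have heabc : ¬ IsP4 G e a b c := not_isP4 (by grind) (by simp)
  have hebcd : ¬ IsP4 G e b c d := not_isP4 (by grind) (by simp)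
  have hecba : ¬ IsP4 G e c b a := not_isP4 (by grind) (by simp)
  have hedcb : ¬ IsP4 G e d c b := not_isP4 (by grind) (by simp)
  have hdcea : ¬ IsP4 G d c e a := not_isP4 (by grind) (by simp)
  have habed : ¬ IsP4 G a b e d := not_isP4 (by grind) (by simp)
  have hcdea : ¬ IsP4 G c d e a := not_isP4 (by grind) (by simp)
  have hbaed : ¬ IsP4 G b a e d := not_isP4 (by grind) (by simp)
  clear not_isP4 he hG
  simp only [IsP4, SeesEvenly] at *
  grind [SimpleGraph.adj_comm]

theorem IsP4Sparse.isP4SparseOn (hG : IsP4Sparse G) (X : Set V) : IsP4SparseOn G X :=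
  fun _ _ _ _ _ _ _ _ _ _ => hG.seesEvenly

theorem IsP4SparseOn.not_isP4_of_mem (hG : IsP4SparseOn G Set.univ) {a' b' c' d' : V}
    (h : IsP4 G a b c d) (he : e ∉ ({a, b, c, d} : Set V)) (he' : e ∈ ({a', b', c', d'} : Set V))
    (hsub : ({a', b', c', d'} : Set V) ⊆ insert e {a, b, c, d}) : ¬ IsP4 G a' b' c' d' := by
  intro h'
  simp only [Set.mem_insert_iff, Set.mem_singleton_iff, not_or, Set.insert_subset_iff,
    Set.singleton_subset_iff] at he he' hsub
  have hsees : SeesEvenly G e a b c d :=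
    hG trivial trivial trivial trivial trivial h he.1 he.2.1 he.2.2.1 he.2.2.2
  have := h.pairwise_ne
  have hne' := h'.pairwise_ne
  have hsymm : ∀ x y, G.Adj x y → G.Adj y x := fun _ _ h => h.symm
  clear hG
  simp only [IsP4, SeesEvenly] at *
  rcases he' with rfl | rfl | rfl | rfl <;> grind

theorem isP4Sparse_iff : IsP4Sparse G ↔ IsP4SparseOn G Set.univ := by
  refine ⟨fun hG => hG.isP4SparseOn _, fun hG => ?_⟩
  rintro A hA B C hBA hCA ⟨a, b, c, d, rfl, h⟩ ⟨a', b', c', d', rfl, h'⟩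
  by_contra hne
  have hfin : A.Finite := Set.finite_of_ncard_ne_zero (by omega)
  obtain ⟨e, he', he⟩ : ∃ e ∈ ({a', b', c', d'} : Set V), e ∉ ({a, b, c, d} : Set V) := by
    by_contra! hsub
    exact hne (Set.eq_of_subset_of_ncard_le hsub
      (by rw [h.ncard_eq_four, h'.ncard_eq_four]) (by simp)).symm
  have hA_eq : insert e {a, b, c, d} = A := by
    refine Set.eq_of_subset_of_ncard_le (Set.insert_subset (hCA he') hBA) ?_ hfin
    rw [Set.ncard_insert_of_notMem he (by simp), h.ncard_eq_four, hA]
  exact hG.not_isP4_of_mem h he he' (hA_eq ▸ hCA) h'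

theorem IsP4Sparse.compl (hG : IsP4Sparse G) : IsP4Sparse Gᶜ := by
  refine isP4Sparse_iff.2 fun a _ b _ c _ d _ e _ h hea heb hec hed => ?_
  have h' := h.compl
  rw [compl_compl] at h'
  obtain ⟨hbc, hda, hbd⟩ := hG.seesEvenly h' heb hed hea hec
  simp only [SeesEvenly, SimpleGraph.compl_adj]
  tauto

theorem IsP4Sparse.isP4SparseOn_of_injOn (hG : IsP4Sparse G) {H : SimpleGraph W} {X : Set W}
    {φ : W → V} (hφ : Set.InjOn φ X)
    (hGH : ∀ x ∈ X, ∀ y ∈ X, (H.Adj x y ↔ G.Adj (φ x) (φ y))) : IsP4SparseOn H X := by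
  intro a ha b hb c hc d hd e he
  simp +contextual only [IsP4, SeesEvenly, hGH, ha, hb, hc, hd, he]
  exact fun h hea heb hec hed => hG.seesEvenly h (hφ.ne he ha hea) (hφ.ne he hb heb)
    (hφ.ne he hc hec) (hφ.ne he hd hed)

theorem IsP4Sparse.comap (hG : IsP4Sparse G) {f : W → V} (hf : Function.Injective f) :
    IsP4Sparse (G.comap f) :=
  isP4Sparse_iff.2 (hG.isP4SparseOn_of_injOn hf.injOn fun _ _ _ _ => Iff.rfl)

end Paths

section Modules

variable {V W : Type*} {G H : SimpleGraph V} {M : Set V} {a b c d x y z : V}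

theorem IsModule.adj_iff (hM : IsModule G M) (hx : x ∉ M) (hy : y ∈ M) (hz : z ∈ M) :
    G.Adj x y ↔ G.Adj x z := by
  rcases hM x hx with h | h <;> simp [h y hy, h z hz]

theorem isModule_iff :
    IsModule G M ↔ ∀ x, x ∉ M → ∀ y ∈ M, ∀ z ∈ M, G.Adj x y → G.Adj x z := by
  refine ⟨fun h x hx y hy z hz => (h.adj_iff hx hy hz).1, fun h x hx => ?_⟩
  by_cases hxM : ∃ y ∈ M, G.Adj x y
  · obtain ⟨y, hy, hxy⟩ := hxM
    exact Or.inl fun z hz => h x hx y hy z hz hxy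
  · push Not at hxM
    exact Or.inr hxM

theorem IsModule.mem_of_adj_of_not_adj (hM : IsModule G M) (hy : y ∈ M) (hz : z ∈ M)
    (hxy : G.Adj x y) (hxz : ¬ G.Adj x z) : x ∈ M := by
  by_contra hx
  exact hxz ((hM.adj_iff hx hy hz).1 hxy)

theorem IsModule.compl (hM : IsModule G M) : IsModule Gᶜ M := by
  refine isModule_iff.2 fun x hx y hy z hz hxy => ?_
  rw [SimpleGraph.compl_adj] at hxy ⊢
  exact ⟨fun hxz => hx (hxz ▸ hz), fun hxz => hxy.2 ((hM.adj_iff hx hz hy).1 hxz)⟩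

theorem IsModule.comap (hM : IsModule G M) (f : W → V) : IsModule (G.comap f) (f ⁻¹' M) :=
  fun x hx => (hM (f x) hx).imp (fun h y hy => h (f y) hy) fun h y hy => h (f y) hy

theorem IsModule.isP4_cases (hM : IsModule G M) (h : IsP4 G a b c d) :
    (a ∈ M ∧ b ∈ M ∧ c ∈ M ∧ d ∈ M) ∨ (a ∉ M ∧ b ∉ M ∧ c ∉ M ∧ d ∉ M) ∨
    (a ∈ M ∧ b ∉ M ∧ c ∉ M ∧ d ∉ M) ∨ (a ∉ M ∧ b ∈ M ∧ c ∉ M ∧ d ∉ M) ∨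
    (a ∉ M ∧ b ∉ M ∧ c ∈ M ∧ d ∉ M) ∨ (a ∉ M ∧ b ∉ M ∧ c ∉ M ∧ d ∈ M) := by
  have ha := hM a; have hb := hM b; have hc := hM c; have hd := hM d
  obtain ⟨hab, hbc, hcd, hac, had, hbd⟩ := h
  grind [SimpleGraph.adj_comm]

theorem IsP4Sparse.isP4_module_all_or_none (hG : IsP4Sparse G) (hM : IsModule G M)
    (hnt : M.Nontrivial) (h : IsP4 G a b c d) :
    (a ∈ M ∧ b ∈ M ∧ c ∈ M ∧ d ∈ M) ∨ (a ∉ M ∧ b ∉ M ∧ c ∉ M ∧ d ∉ M) := by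
  -- A second vertex of the module sees the same vertices of the path as the one on it.
  have not_endpoint : ∀ {a b c d : V}, IsP4 G a b c d → ¬ (a ∈ M ∧ b ∉ M ∧ c ∉ M ∧ d ∉ M) := by
    rintro a b c d h ⟨ha, hb, hc, hd⟩
    obtain ⟨e, he, hea⟩ := hnt.exists_ne a
    have hsees := hG.seesEvenly h hea (by grind) (by grind) (by grind)
    have hbe := hM.adj_iff hb he ha
    have hce := hM.adj_iff hc he ha
    simp only [IsP4, SeesEvenly] at h hsees
    grind [SimpleGraph.adj_comm]
  have not_midpoint : ∀ {a b c d : V}, IsP4 G a b c d → ¬ (a ∉ M ∧ b ∈ M ∧ c ∉ M ∧ d ∉ M) := by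
    rintro a b c d h ⟨ha, hb, hc, hd⟩
    obtain ⟨e, he, heb⟩ := hnt.exists_ne b
    have hsees := hG.seesEvenly h (by grind) heb (by grind) (by grind)
    have hae := hM.adj_iff ha he hb
    have hde := hM.adj_iff hd he hb
    simp only [IsP4, SeesEvenly] at h hsees
    grind [SimpleGraph.adj_comm]
  have hend := not_endpoint h
  have hend' := not_endpoint h.reverse
  have hmid := not_midpoint h
  have hmid' := not_midpoint h.reverse
  have hcases := hM.isP4_cases h
  clear not_endpoint not_midpoint
  grind

theorem isP4Sparse_of_isModule (hM : IsModule H M)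
    (hP4 : ∀ ⦃a b c d⦄, IsP4 H a b c d →
      (a ∈ M ∧ b ∈ M ∧ c ∈ M ∧ d ∈ M) ∨ (a ∉ M ∧ b ∉ M ∧ c ∉ M ∧ d ∉ M))
    (hin : IsP4SparseOn H M) (hout : ∀ m, IsP4SparseOn H (insert m Mᶜ)) : IsP4Sparse H := by
  refine isP4Sparse_iff.2 fun a _ b _ c _ d _ e _ h hea heb hec hed => ?_
  rcases hP4 h with ⟨ha, hb, hc, hd⟩ | ⟨ha, hb, hc, hd⟩
  · by_cases he : e ∈ M
    · exact hin ha hb hc hd he h hea heb hec hed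
    · rcases hM e he with hM' | hM' <;> simp [SeesEvenly, hM', ha, hb, hc, hd]
  · exact hout e (.inr ha) (.inr hb) (.inr hc) (.inr hd) (.inl rfl) h hea heb hec hed

theorem IsP4Sparse.substitute_module (hG : IsP4Sparse G) (hM : IsModule G M)
    (hP4 : ∀ ⦃a b c d⦄, IsP4 G a b c d →
      (a ∈ M ∧ b ∈ M ∧ c ∈ M ∧ d ∈ M) ∨ (a ∉ M ∧ b ∉ M ∧ c ∉ M ∧ d ∉ M))
    {H : SimpleGraph W} {φ : W → V} (hφ : ∀ x y, φ x ∉ M → φ x = φ y → x = y)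
    (hGH : ∀ x y, φ x ∉ M → (H.Adj x y ↔ G.Adj (φ x) (φ y)))
    (hin : IsP4SparseOn H (φ ⁻¹' M)) : IsP4Sparse H := by
  have hGH' : ∀ x y, φ y ∉ M → (H.Adj x y ↔ G.Adj (φ x) (φ y)) := fun x y hy => by
    rw [H.adj_comm, G.adj_comm, hGH y x hy]
  have hMH : IsModule H (φ ⁻¹' M) := fun x hx => by
    simp only [hGH x _ hx]
    exact (hM.comap φ) x hx
  refine isP4Sparse_of_isModule hMH (fun a b c d h => ?_) hin fun m => ?_
  · have hcases := hMH.isP4_cases h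
    have := @hP4 (φ a) (φ b) (φ c) (φ d)
    simp only [IsP4, Set.mem_preimage] at *
    grind
  · refine hG.isP4SparseOn_of_injOn (φ := φ) ?_ fun x hx y hy => ?_
    · rintro x (rfl | hx) y (rfl | hy) hxy
      · rfl
      · exact (hφ y x hy hxy.symm).symm
      · exact hφ x y hx hxy
      · exact hφ x y hx hxy
    · rcases hx with rfl | hx
      · rcases hy with rfl | hy
        · simp
        · exact hGH' _ _ hy
      · exact hGH _ _ hx

theorem IsP4Sparse.replace_module (hG : IsP4Sparse G) (hM : IsModule G M) (hnt : M.Nontrivial)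
    (hGH : ∀ x y, x ∉ M → (H.Adj x y ↔ G.Adj x y)) (hin : IsP4SparseOn H M) : IsP4Sparse H :=
  hG.substitute_module (φ := id) hM (fun _ _ _ _ => hG.isP4_module_all_or_none hM hnt)
    (fun _ _ _ => id) hGH hin

end Modules

/-! ### Spiders with a matching -/

section Disconnected

variable {V : Type*} {G : SimpleGraph V} {P X : Set V} {v y : V}

/-- The subgraph induced by `X` is disconnected, as it is in `G` if `X` is the set of the leaves
below a `0`-node, and in the complement of `G` for a `1`-node. -/
def DisconnectedOn (G : SimpleGraph V) (X : Set V) : Prop :=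
  ∃ A B : Set V, A.Nonempty ∧ B.Nonempty ∧ Disjoint A B ∧ A ∪ B = X ∧
    ∀ a ∈ A, ∀ b ∈ B, ¬ G.Adj a b

theorem exists_adj_of_not_disconnectedOn (hX : ¬ DisconnectedOn G X) (hP : P.Nonempty)
    (hPX : P ⊆ X) (hy : y ∈ X) (hyP : y ∉ P) : ∃ p ∈ P, ∃ q ∈ X, q ∉ P ∧ G.Adj p q := by
  by_contra! hcon
  exact hX ⟨P, X \ P, hP, ⟨y, hy, hyP⟩, Set.disjoint_sdiff_right, Set.union_sdiff_cancel hPX,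
    fun a ha b hb => hcon a ha b hb.1 hb.2⟩

theorem exists_adj_of_not_disconnectedOn_insert (hX : ¬ DisconnectedOn G (insert v X))
    (hv : v ∉ X) (hne : X.Nonempty) : ∃ x ∈ X, G.Adj v x := by
  obtain ⟨x, hx⟩ := hne
  obtain ⟨p, rfl, q, hq, hqv, hpq⟩ := exists_adj_of_not_disconnectedOn hX (P := {v}) ⟨v, rfl⟩
    (by simp) (.inr hx) (by rintro rfl; exact hv hx)
  exact ⟨q, hq.resolve_left hqv, hpq⟩

end Disconnected

section MatchedSpiders

variable {V : Type*} {G : SimpleGraph V} {thick : Prop} {S K R : Set V} {f g : V → V}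
  {k l s x y : V}

theorem IsSpiderBase.compl (h : IsSpiderBase G S K R) : IsSpiderBase Gᶜ K S R := by
  obtain ⟨hSK, hSR, hKR, hS, hK, hRK, hRS⟩ := h
  refine ⟨hSK.symm, hKR, hSR, ?_, ?_, ?_, ?_⟩
  · exact G.isIndepSet_compl.2 hK
  · exact G.isClique_compl.2 hS
  · exact fun r hr s hs => ⟨fun e => Set.disjoint_left.1 hSR hs (e ▸ hr), hRS r hr s hs⟩
  · exact fun r hr k hk hrk => hrk.2 (hRK r hr k hk)

/-- A spider together with the bijection `f : S → K` and its inverse `g`. A thick spider may have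
`|K| = 2` here, which makes the notion closed under complementation. -/
structure IsMatchedSpider (G : SimpleGraph V) (thick : Prop) (S K R : Set V) (f g : V → V) :
    Prop where
  base : IsSpiderBase G S K R
  f_mem : ∀ s ∈ S, f s ∈ K
  g_mem : ∀ k ∈ K, g k ∈ S
  g_f : ∀ s ∈ S, g (f s) = s
  f_g : ∀ k ∈ K, f (g k) = k
  adj_leg_body : ∀ s ∈ S, ∀ k ∈ K, (G.Adj s k ↔ (k = f s ↔ ¬ thick))
  body_nontrivial : K.Nontrivial

theorem IsSpiderBase.exists_isMatchedSpider (h : IsSpiderBase G S K R) (hK : K.Nontrivial)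
    (hSK : ∀ s ∈ S, ∃! k, k ∈ K ∧ G.Adj s k) (hKS : ∀ k ∈ K, ∃! s, s ∈ S ∧ G.Adj s k) :
    ∃ f g, IsMatchedSpider G False S K R f g := by
  have : Nonempty V := ⟨hK.nonempty.some⟩
  choose! f hf hf' using hSK
  choose! g hg hg' using hKS
  refine ⟨f, g, h, fun s hs => (hf s hs).1, fun k hk => (hg k hk).1, fun s hs => ?_, fun k hk => ?_,
    fun s hs k hk => ?_, hK⟩
  · exact (hg' _ (hf s hs).1 s ⟨hs, (hf s hs).2⟩).symm
  · exact (hf' _ (hg k hk).1 k ⟨hk, (hg k hk).2⟩).symm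
  · simp only [not_false_iff, iff_true]
    exact ⟨fun hsk => hf' s hs k ⟨hk, hsk⟩, fun e => e ▸ (hf s hs).2⟩

namespace IsMatchedSpider

theorem leg_notMem_body (h : IsMatchedSpider G thick S K R f g) : ∀ s ∈ S, s ∉ K :=
  fun _ hs => Set.disjoint_left.1 h.base.1 hs

theorem leg_notMem_head (h : IsMatchedSpider G thick S K R f g) : ∀ s ∈ S, s ∉ R :=
  fun _ hs => Set.disjoint_left.1 h.base.2.1 hs

theorem body_notMem_head (h : IsMatchedSpider G thick S K R f g) : ∀ k ∈ K, k ∉ R :=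
  fun _ hk => Set.disjoint_left.1 h.base.2.2.1 hk

theorem indep (h : IsMatchedSpider G thick S K R f g) : ∀ s ∈ S, ∀ t ∈ S, ¬ G.Adj s t :=
  fun _ hs _ ht hst => h.base.2.2.2.1 hs ht hst.ne hst

theorem clique (h : IsMatchedSpider G thick S K R f g) : ∀ k ∈ K, ∀ l ∈ K, k ≠ l → G.Adj k l :=
  fun _ hk _ hl => h.base.2.2.2.2.1 hk hl

theorem adj_head_body (h : IsMatchedSpider G thick S K R f g) : ∀ r ∈ R, ∀ k ∈ K, G.Adj r k :=
  h.base.2.2.2.2.2.1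

theorem not_adj_head_leg (h : IsMatchedSpider G thick S K R f g) :
    ∀ r ∈ R, ∀ s ∈ S, ¬ G.Adj r s :=
  h.base.2.2.2.2.2.2

theorem bijOn (h : IsMatchedSpider G thick S K R f g) : Set.BijOn f S K :=
  Set.BijOn.mk h.f_mem (fun s hs t ht e => by rw [← h.g_f s hs, e, h.g_f t ht])
    fun k hk => ⟨g k, h.g_mem k hk, h.f_g k hk⟩

theorem compl (h : IsMatchedSpider G thick S K R f g) :
    IsMatchedSpider Gᶜ (¬ thick) K S R g f where
  base := h.base.compl
  f_mem := h.g_mem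
  g_mem := h.f_mem
  g_f := h.f_g
  f_g := h.g_f
  adj_leg_body k hk s hs := by
    have hks : k ≠ s := fun e => h.leg_notMem_body s hs (e ▸ hk)
    have hfg : s = g k ↔ k = f s :=
      ⟨fun e => by rw [e, h.f_g k hk], fun e => by rw [e, h.g_f s hs]⟩
    rw [SimpleGraph.compl_adj, G.adj_comm, h.adj_leg_body s hs k hk, hfg]
    tauto
  body_nontrivial := Set.nontrivial_of_image f S (h.bijOn.image_eq.symm ▸ h.body_nontrivial)

theorem adj_thin (h : IsMatchedSpider G False S K R f g) (hs : s ∈ S) (hk : k ∈ K) :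
    G.Adj s k ↔ k = f s := by
  simpa using h.adj_leg_body s hs k hk

theorem adj_thick (h : IsMatchedSpider G True S K R f g) (hs : s ∈ S) (hk : k ∈ K) :
    G.Adj s k ↔ k ≠ f s := by
  simpa using h.adj_leg_body s hs k hk

theorem thin_or_thick (h : IsMatchedSpider G thick S K R f g) :
    IsMatchedSpider G False S K R f g ∨ IsMatchedSpider G True S K R f g := by
  by_cases ht : thick
  · exact .inr (by simpa only [ht] using h)
  · exact .inl (by simpa only [ht] using h)

theorem exists_body_ne (h : IsMatchedSpider G thick S K R f g) (k : V) : ∃ l ∈ K, l ≠ k :=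
  h.body_nontrivial.exists_ne k

theorem exists_adj_body (h : IsMatchedSpider G thick S K R f g) (hs : s ∈ S) :
    ∃ k ∈ K, G.Adj s k := by
  rcases h.thin_or_thick with h | h
  · exact ⟨f s, h.f_mem s hs, (h.adj_thin hs (h.f_mem s hs)).2 rfl⟩
  · obtain ⟨k, hk, hne⟩ := h.exists_body_ne (f s)
    exact ⟨k, hk, (h.adj_thick hs hk).2 hne⟩

theorem exists_adj_leg (h : IsMatchedSpider G thick S K R f g) (hk : k ∈ K) :
    ∃ s ∈ S, G.Adj s k := by
  rcases h.thin_or_thick with h | h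
  · exact ⟨g k, h.g_mem k hk, (h.adj_thin (h.g_mem k hk) hk).2 (h.f_g k hk).symm⟩
  · obtain ⟨l, hl, hne⟩ := h.exists_body_ne k
    refine ⟨g l, h.g_mem l hl, (h.adj_thick (h.g_mem l hl) hk).2 ?_⟩
    rw [h.f_g l hl]
    exact hne.symm

theorem isP4_or_isP4 (h : IsMatchedSpider G thick S K R f g) (hk : k ∈ K) (hl : l ∈ K)
    (hkl : k ≠ l) : IsP4 G (g k) k l (g l) ∨ IsP4 G (g l) k l (g k) := by
  have hgk := h.g_mem k hk
  have hgl := h.g_mem l hl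
  have adj_kk := h.adj_leg_body _ hgk _ hk
  have adj_kl := h.adj_leg_body _ hgk _ hl
  have adj_lk := h.adj_leg_body _ hgl _ hk
  have adj_ll := h.adj_leg_body _ hgl _ hl
  rw [h.f_g k hk] at adj_kk adj_kl
  rw [h.f_g l hl] at adj_lk adj_ll
  have body_adj := h.clique k hk l hl hkl
  have legs_not_adj := h.indep _ hgk _ hgl
  simp only [IsP4, G.adj_comm l, G.adj_comm k (g k), G.adj_comm k (g l), G.adj_comm (g l) (g k)]
  grind [SimpleGraph.adj_comm]

theorem exists_isP4 (h : IsMatchedSpider G thick S K R f g) (hs : s ∈ S) (hk : k ∈ K)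
    (hsk : G.Adj s k) : ∃ l t, IsP4 G s k l t := by
  rcases h.thin_or_thick with h | h
  · obtain ⟨l, hl, hlk⟩ := h.exists_body_ne k
    have hgl := h.g_mem l hl
    have hks := (h.adj_thin hs hk).1 hsk
    refine ⟨l, g l, hsk, h.clique _ hk _ hl hlk.symm, ?_, ?_, h.indep _ hs _ hgl, ?_⟩
    · rw [G.adj_comm, h.adj_thin hgl hl, h.f_g l hl]
    · rwa [h.adj_thin hs hl, ← hks]
    · rw [G.adj_comm, h.adj_thin hgl hk, h.f_g l hl]
      exact hlk.symm
  · have hne := (h.adj_thick hs hk).1 hsk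
    have hf := h.f_mem s hs
    have hg := h.g_mem k hk
    refine ⟨f s, g k, hsk, h.clique _ hk _ hf hne, ?_, ?_, h.indep _ hs _ hg, ?_⟩
    · rw [G.adj_comm, h.adj_thick hg hf, h.f_g k hk]
      exact hne.symm
    · rw [h.adj_thick hs hf]
      exact not_not.2 rfl
    · rw [G.adj_comm, h.adj_thick hg hk, h.f_g k hk]
      exact not_not.2 rfl

theorem isWing (h : IsMatchedSpider G thick S K R f g) (hxy : G.Adj x y)
    (hm : (x ∈ S ∧ y ∈ K) ∨ (x ∈ K ∧ y ∈ S)) : IsWing G x y := by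
  rcases hm with ⟨hx, hy⟩ | ⟨hx, hy⟩
  · obtain ⟨l, t, hp⟩ := h.exists_isP4 hx hy hxy
    exact ⟨l, t, .inl hp⟩
  · obtain ⟨l, t, hp⟩ := h.exists_isP4 hy hx hxy.symm
    exact ⟨l, t, .inr hp⟩

-- A thick spider with two legs is thin for the other matching.
theorem exists_thin_of_body_eq_pair (h : IsMatchedSpider G True S K R f g)
    (hK : K = {k, l}) : ∃ f g, IsMatchedSpider G False S K R f g := by
  have : k ∈ K := by simp [hK]
  have : l ∈ K := by simp [hK]
  have hcases : ∀ m ∈ K, m = k ∨ m = l := by simp [hK]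
  refine h.base.exists_isMatchedSpider h.body_nontrivial (fun s hs => ?_) fun m hm => ?_
  · have hfs := hcases _ (h.f_mem s hs)
    obtain ⟨m, hm, hsm⟩ := h.exists_adj_body hs
    refine ⟨m, ⟨hm, hsm⟩, fun m' ⟨hm', hsm'⟩ => ?_⟩
    rw [h.adj_thick hs hm] at hsm
    rw [h.adj_thick hs hm'] at hsm'
    grind
  · obtain ⟨s, hs, hsm⟩ := h.exists_adj_leg hm
    refine ⟨s, ⟨hs, hsm⟩, fun s' ⟨hs', hsm'⟩ => h.bijOn.injOn hs' hs ?_⟩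
    have := hcases _ (h.f_mem s hs)
    have := hcases _ (h.f_mem s' hs')
    rw [h.adj_thick hs hm] at hsm
    rw [h.adj_thick hs' hm] at hsm'
    grind

theorem isSpider [Finite V] (h : IsMatchedSpider G thick S K R f g) : IsSpider G S K R := by
  have isSpider_of_thin : ∀ {f g}, IsMatchedSpider G False S K R f g → IsSpider G S K R :=
    fun h => .inl ⟨h.base, Set.one_lt_ncard_iff_nontrivial.2 h.body_nontrivial, _, h.bijOn,
      fun s hs k hk => h.adj_thin hs hk⟩
  rcases h.thin_or_thick with h | h
  · exact isSpider_of_thin h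
  · have two_le : 2 ≤ K.ncard := Set.one_lt_ncard_iff_nontrivial.2 h.body_nontrivial
    rcases two_le.eq_or_lt with hK | hK
    · obtain ⟨k, l, -, hK⟩ := Set.ncard_eq_two.1 hK.symm
      obtain ⟨f, g, h⟩ := h.exists_thin_of_body_eq_pair hK
      exact isSpider_of_thin h
    · exact .inr ⟨h.base, hK, f, h.bijOn, fun s hs k hk => h.adj_thick hs hk⟩

end IsMatchedSpider

theorem IsSpiderBase.exists_isMatchedSpider_of_bijOn (h : IsSpiderBase G S K R)
    (hK : K.Nontrivial) (hf : Set.BijOn f S K)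
    (hadj : ∀ s ∈ S, ∀ k ∈ K, (G.Adj s k ↔ (k = f s ↔ ¬ thick))) :
    ∃ g, IsMatchedSpider G thick S K R f g := by
  have : Nonempty V := ⟨hK.nonempty.some⟩
  exact ⟨Function.invFunOn f S, h, hf.mapsTo, hf.surjOn.mapsTo_invFunOn,
    hf.invOn_invFunOn.1, hf.invOn_invFunOn.2, hadj, hK⟩

theorem IsThinSpider.exists_isMatchedSpider (h : IsThinSpider G S K R) :
    ∃ f g, IsMatchedSpider G False S K R f g := by
  obtain ⟨hb, hK, f, hf, hadj⟩ := h
  have hKn : K.Nontrivial := (Set.one_lt_ncard_iff_nontrivial_and_finite.1 hK).1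
  exact ⟨f, hb.exists_isMatchedSpider_of_bijOn hKn hf (by simpa using hadj)⟩

theorem IsThickSpider.exists_isMatchedSpider (h : IsThickSpider G S K R) :
    ∃ f g, IsMatchedSpider G True S K R f g := by
  obtain ⟨hb, hK, f, hf, hadj⟩ := h
  have hKn : K.Nontrivial := (Set.one_lt_ncard_iff_nontrivial_and_finite.1 (by omega)).1
  exact ⟨f, hb.exists_isMatchedSpider_of_bijOn hKn hf (by simpa using hadj)⟩

theorem IsSpider.exists_isMatchedSpider (h : IsSpider G S K R) :
    ∃ thick f g, IsMatchedSpider G thick S K R f g :=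
  h.elim (fun h => ⟨_, h.exists_isMatchedSpider⟩) fun h => ⟨_, h.exists_isMatchedSpider⟩

end MatchedSpiders

/-! ### The structure of `P₄`-sparse graphs -/

section Structure

variable {V : Type*} {G : SimpleGraph V} {thick : Prop} {A B S K R X : Set V} {f g : V → V}
  {a b c d e u v x y : V}

/-- The subgraph induced by `X` is a spider, possibly a thick one with two legs. -/
def InducesSpider (G : SimpleGraph V) (X : Set V) : Prop :=
  ∃ thick S K R f g, IsMatchedSpider G thick S K R f g ∧ S ∪ K ∪ R = X

theorem InducesSpider.compl (h : InducesSpider G X) : InducesSpider Gᶜ X := by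
  obtain ⟨thick, S, K, R, f, g, h, rfl⟩ := h
  exact ⟨_, K, S, R, g, f, h.compl, by rw [Set.union_comm K S]⟩

theorem IsP4Sparse.eq_of_adj_left (hG : IsP4Sparse G) (h : IsP4 G a b c d) (hea : G.Adj e a)
    (hed : ¬ G.Adj e d) : e = b := by
  by_contra heb
  obtain ⟨_, hbc, hcd, hac, had, hbd⟩ := id h
  refine hed ((hG.seesEvenly h hea.ne heb ?_ ?_).1.1 hea)
  · rintro rfl; exact hac hea.symm
  · rintro rfl; exact had hea.symm

namespace IsMatchedSpider

theorem isSpiderBase_insert_of_not_adj (h : IsMatchedSpider G thick S K R f g)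
    (hv : v ∉ S ∪ K ∪ R) (hvS : ∀ s ∈ S, ¬ G.Adj v s) (hx : x ∈ R)
    (hR : ∀ r ∈ R, r ≠ x → G.Adj r x ∧ ¬ G.Adj r v) :
    IsSpiderBase G (insert v S) (insert x K) (R \ {x}) := by
  simp only [Set.mem_union, not_or] at hv
  have hxS : x ∉ S := fun hS => h.leg_notMem_head x hS hx
  refine ⟨?_, ?_, ?_, ?_, ?_, ?_, ?_⟩
  · rw [Set.disjoint_left]
    rintro s (rfl | hs) (rfl | hk)
    exacts [hv.2 hx, hv.1.2 hk, hxS hs, h.leg_notMem_body s hs hk]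
  · rw [Set.disjoint_left]
    rintro s (rfl | hs) hr
    exacts [hv.2 hr.1, h.leg_notMem_head s hs hr.1]
  · rw [Set.disjoint_left]
    rintro k (rfl | hk) hr
    exacts [hr.2 rfl, h.body_notMem_head k hk hr.1]
  · rintro s (rfl | hs) t (rfl | ht) _
    exacts [G.loopless.irrefl _, hvS t ht, fun e => hvS s hs e.symm, h.indep s hs t ht]
  · rintro k (rfl | hk) l (rfl | hl) hkl
    exacts [absurd rfl hkl, h.adj_head_body _ hx l hl, (h.adj_head_body _ hx k hk).symm,
      h.clique k hk l hl hkl]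
  · rintro r ⟨hr, hrx⟩ k (rfl | hk)
    exacts [(hR r hr hrx).1, h.adj_head_body r hr k hk]
  · rintro r ⟨hr, hrx⟩ s (rfl | hs)
    exacts [(hR r hr hrx).2, h.not_adj_head_leg r hr s hs]

theorem exists_isMatchedSpider_insert_of_not_adj (hG : IsP4Sparse G)
    (h : IsMatchedSpider G thick S K R f g) (hv : v ∉ S ∪ K ∪ R) (hvK : ∀ k ∈ K, ¬ G.Adj v k)
    (hvS : ∀ s ∈ S, ¬ G.Adj v s) (hx : x ∈ R) (hvx : G.Adj v x) :
    ∃ f g, IsMatchedSpider G False (insert v S) (insert x K) (R \ {x}) f g := by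
  have hp : ∀ {s k}, s ∈ S → k ∈ K → G.Adj s k → IsP4 G v x k s := fun {s k} hs hk hsk =>
    ⟨hvx, h.adj_head_body x hx k hk, hsk.symm, hvK k hk, hvS s hs, h.not_adj_head_leg x hx s hs⟩
  obtain ⟨k₀, hk₀⟩ := h.body_nontrivial.nonempty
  obtain ⟨s₀, hs₀, hsk₀⟩ := h.exists_adj_leg hk₀
  have hnv : ∀ r ∈ R, r ≠ x → ¬ G.Adj r v := fun r hr hrx hrv =>
    hrx (hG.eq_of_adj_left (hp hs₀ hk₀ hsk₀) hrv (h.not_adj_head_leg r hr s₀ hs₀))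
  have hrx : ∀ r ∈ R, r ≠ x → G.Adj r x := fun r hr hrx => by
    refine (hG.seesEvenly (hp hs₀ hk₀ hsk₀) ?_ hrx ?_ ?_).2.1.2 (h.adj_head_body r hr k₀ hk₀)
    · rintro rfl; exact hv (.inr hr)
    · rintro rfl; exact h.body_notMem_head _ hk₀ hr
    · rintro rfl; exact h.leg_notMem_head _ hs₀ hr
  have hbase :=
    h.isSpiderBase_insert_of_not_adj hv hvS hx fun r hr hne => ⟨hrx r hr hne, hnv r hr hne⟩
  refine hbase.exists_isMatchedSpider (h.body_nontrivial.mono (Set.subset_insert _ _)) ?_ ?_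
  · rintro s (rfl | hs)
    · exact ⟨x, ⟨.inl rfl, hvx⟩, fun k ⟨hk, hsk⟩ => hk.resolve_right fun hk => hvK k hk hsk⟩
    · obtain ⟨k, hk, hsk⟩ := h.exists_adj_body hs
      refine ⟨k, ⟨.inr hk, hsk⟩, ?_⟩
      rintro l ⟨rfl | hl, hsl⟩
      · exact absurd hsl.symm (h.not_adj_head_leg _ hx s hs)
      · exact hG.eq_of_adj_left (hp hs hk hsk).reverse hsl.symm fun e => hvK l hl e.symm
  · rintro k (rfl | hk)
    · exact ⟨v, ⟨.inl rfl, hvx⟩, fun s ⟨hs, hsk⟩ =>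
        hs.resolve_right fun hs => h.not_adj_head_leg _ hx s hs hsk.symm⟩
    · obtain ⟨s, hs, hsk⟩ := h.exists_adj_leg hk
      refine ⟨s, ⟨.inr hs, hsk⟩, ?_⟩
      rintro t ⟨rfl | ht, htk⟩
      · exact absurd htk (hvK k hk)
      · by_contra hts
        refine h.not_adj_head_leg x hx t ht (((hG.seesEvenly (e := t) (hp hs hk hsk)
          ?_ ?_ htk.ne hts).2.1.2 htk).symm)
        · rintro rfl; exact hv (.inl (.inl ht))
        · rintro rfl; exact h.leg_notMem_head _ ht hx

theorem inducesSpider_insert_of_not_adj (hG : IsP4Sparse G)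
    (h : IsMatchedSpider G thick S K R f g) (hv : v ∉ S ∪ K ∪ R) (hvK : ∀ k ∈ K, ¬ G.Adj v k)
    (hvS : ∀ s ∈ S, ¬ G.Adj v s) (hX : ¬ DisconnectedOn G (insert v (S ∪ K ∪ R))) :
    InducesSpider G (insert v (S ∪ K ∪ R)) := by
  obtain ⟨k, hk⟩ := h.body_nontrivial.nonempty
  obtain ⟨x, (hx | hx) | hx, hvx⟩ :=
    exists_adj_of_not_disconnectedOn_insert hX hv ⟨k, .inl (.inr hk)⟩
  · exact absurd hvx (hvS x hx)
  · exact absurd hvx (hvK x hx)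
  · obtain ⟨f, g, h'⟩ := exists_isMatchedSpider_insert_of_not_adj hG h hv hvK hvS hx hvx
    refine ⟨_, _, _, _, f, g, h', ?_⟩
    ext y
    simp only [Set.mem_union, Set.mem_insert_iff, Set.mem_sdiff, Set.mem_singleton_iff]
    by_cases hy : y = x <;> simp [hy, hx]
    tauto

theorem insert_head (h : IsMatchedSpider G thick S K R f g) (hv : v ∉ S ∪ K ∪ R)
    (hvK : ∀ k ∈ K, G.Adj v k) (hvS : ∀ s ∈ S, ¬ G.Adj v s) :
    IsMatchedSpider G thick S K (insert v R) f g := by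
  simp only [Set.mem_union, not_or] at hv
  obtain ⟨hSK, hSR, hKR, hS, hK, hRK, hRS⟩ := h.base
  refine { h with base := ⟨hSK, ?_, ?_, hS, hK, ?_, ?_⟩ }
  · exact Set.disjoint_insert_right.2 ⟨hv.1.1, hSR⟩
  · exact Set.disjoint_insert_right.2 ⟨hv.1.2, hKR⟩
  · rintro r (rfl | hr)
    exacts [hvK, hRK r hr]
  · rintro r (rfl | hr)
    exacts [hvS, hRS r hr]

theorem seesEvenly_of_notMem (hG : IsP4Sparse G) (h : IsMatchedSpider G thick S K R f g)
    (hv : v ∉ S ∪ K ∪ R) (hx : x ∈ K) (hy : y ∈ K) (hxy : x ≠ y) :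
    SeesEvenly G v (g x) x y (g y) := by
  have hne : ∀ z ∈ S ∪ K ∪ R, v ≠ z := fun z hz e => hv (e ▸ hz)
  have hvx := hne x (.inl (.inr hx))
  have hvy := hne y (.inl (.inr hy))
  have hvgx := hne _ (.inl (.inl (h.g_mem x hx)))
  have hvgy := hne _ (.inl (.inl (h.g_mem y hy)))
  rcases h.isP4_or_isP4 hx hy hxy with hp | hp
  · exact hG.seesEvenly hp hvgx hvx hvy hvgy
  · obtain ⟨hends, hmids, himp⟩ := hG.seesEvenly hp hvgy hvx hvy hvgx
    exact ⟨hends.symm, hmids, fun hgx => himp (hends.2 hgx)⟩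

theorem inducesSpider_insert (hG : IsP4Sparse G) (h : IsMatchedSpider G thick S K R f g)
    (hv : v ∉ S ∪ K ∪ R) (hX : ¬ DisconnectedOn G (insert v (S ∪ K ∪ R)))
    (hX' : ¬ DisconnectedOn Gᶜ (insert v (S ∪ K ∪ R))) :
    InducesSpider G (insert v (S ∪ K ∪ R)) := by
  obtain ⟨k, hk, l, hl, hkl⟩ := id h.body_nontrivial
  have hbody : ∀ m ∈ K, G.Adj v m ↔ G.Adj v k := fun m hm => by
    rcases eq_or_ne m k with rfl | hmk
    · rfl
    · exact (seesEvenly_of_notMem hG h hv hm hk hmk).2.1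
  have hlegs : ∀ s ∈ S, G.Adj v s ↔ G.Adj v (g k) := fun s hs => by
    rcases eq_or_ne (f s) k with rfl | hsk
    · rw [h.g_f s hs]
    · have hends := (seesEvenly_of_notMem hG h hv (h.f_mem s hs) hk hsk).1
      rwa [h.g_f s hs] at hends
  have hleg_body : G.Adj v (g k) → G.Adj v k := (seesEvenly_of_notMem hG h hv hk hl hkl).2.2
  by_cases hvk : G.Adj v k
  · by_cases hvgk : G.Adj v (g k)
    · rw [Set.union_comm S K] at hX' hv ⊢
      simpa only [compl_compl] using (h.compl.inducesSpider_insert_of_not_adj hG.compl hv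
        (fun s hs => by simp [(hlegs s hs).2 hvgk]) (fun m hm => by simp [(hbody m hm).2 hvk])
        hX').compl
    · exact ⟨thick, S, K, insert v R, f, g, h.insert_head hv (fun m hm => (hbody m hm).2 hvk)
        fun s hs => mt (hlegs s hs).1 hvgk, by rw [Set.union_insert]⟩
  · exact h.inducesSpider_insert_of_not_adj hG hv (fun m hm => mt (hbody m hm).1 hvk)
      (fun s hs => mt (hlegs s hs).1 (mt hleg_body hvk)) hX

end IsMatchedSpider

theorem exists_adj_adj_of_not_disconnectedOn (hvA : v ∉ A) (hAB : ∀ a ∈ A, ∀ b ∈ B, ¬ G.Adj a b)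
    (hX : ¬ DisconnectedOn G (insert v (A ∪ B))) (hxA : x ∈ A) (hvx : ¬ G.Adj v x) :
    ∃ u ∈ A, ∃ c ∈ A, ¬ G.Adj v u ∧ G.Adj v c ∧ G.Adj u c := by
  obtain ⟨p, hp, q, rfl | hq | hq, hqP, hpq⟩ := exists_adj_of_not_disconnectedOn hX
    (P := {y ∈ A | ¬ G.Adj v y}) ⟨x, hxA, hvx⟩ (fun y hy => .inr (.inl hy.1)) (.inl rfl)
    fun h => hvA h.1
  · exact absurd hpq.symm hp.2
  · exact ⟨p, hp.1, q, hq, hp.2, not_not.1 fun hvq => hqP ⟨hq, hvq⟩, hpq⟩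
  · exact absurd hpq (hAB p hp.1 q hq)

theorem exists_eq_singleton_of_cut (hG : IsP4Sparse G) (hvA : v ∉ A) (hvB : v ∉ B)
    (hdisj : Disjoint A B) (hBne : B.Nonempty) (hAB : ∀ a ∈ A, ∀ b ∈ B, ¬ G.Adj a b) (hxA : x ∈ A)
    (hvx : ¬ G.Adj v x) (hX : ¬ DisconnectedOn G (insert v (A ∪ B))) :
    ∃ d, B = {d} ∧ G.Adj v d := by
  obtain ⟨u, hu, c, hc, hvu, hvc, huc⟩ := exists_adj_adj_of_not_disconnectedOn hvA hAB hX hxA hvx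
  obtain ⟨d, hd, q, rfl | hq | hq, hqB, hdv⟩ := exists_adj_of_not_disconnectedOn hX hBne
    (fun y hy => .inr (.inr hy)) (.inl rfl) hvB
  rotate_left
  · exact absurd hdv.symm (hAB q hq d hd)
  · exact absurd hq hqB
  have hp : IsP4 G u c q d := ⟨huc, hvc.symm, hdv.symm, fun e => hvu e.symm, hAB u hu d hd,
    hAB c hc d hd⟩
  have hsees : ∀ b ∈ B \ {d}, ¬ G.Adj b q ∧ ¬ G.Adj b d := fun b hb => by
    have hbA := Set.disjoint_right.1 hdisj hb.1
    obtain ⟨hends, hmids, -⟩ := hG.seesEvenly (e := b) hp (fun e => hbA (e ▸ hu))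
      (fun e => hbA (e ▸ hc)) (fun e => hvB (e ▸ hb.1)) hb.2
    exact ⟨fun hbq => hAB c hc b hb.1 (hmids.2 hbq).symm,
      fun hbd => hAB u hu b hb.1 (hends.2 hbd).symm⟩
  refine ⟨d, Set.Subsingleton.eq_singleton_of_mem ?_ hd, hdv.symm⟩
  by_contra hnt
  obtain ⟨b, hb, hbd⟩ := (Set.not_subsingleton_iff.1 hnt).exists_ne d
  obtain ⟨b, hb, z, rfl | hz | hz, hzB, hbz⟩ := exists_adj_of_not_disconnectedOn hX
    (P := B \ {d}) ⟨b, hb, hbd⟩ (fun y hy => .inr (.inr hy.1)) (.inl rfl) fun h => hvB h.1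
  · exact (hsees b hb).1 hbz
  · exact hAB z hz b hb.1 hbz.symm
  · obtain rfl : z = d := by_contra fun hzd => hzB ⟨hz, hzd⟩
    exact (hsees b hb).2 hbz

theorem exists_adj_adj_of_pendant (hG : IsP4Sparse G) (hvA : v ∉ A) (hvd : G.Adj v d)
    (hAd : ∀ a ∈ A, ¬ G.Adj a d) (hX : ¬ DisconnectedOn G (insert v (A ∪ {d}))) (hu : u ∈ A)
    (hvu : ¬ G.Adj v u) : ∃ c ∈ A, G.Adj v c ∧ G.Adj u c := by
  by_contra! hcon
  obtain ⟨p, ⟨hpA, hvp, hpn⟩, q, rfl | hq | rfl, hqP, hpq⟩ := exists_adj_of_not_disconnectedOn hX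
    (P := {u ∈ A | ¬ G.Adj v u ∧ ∀ c ∈ A, G.Adj v c → ¬ G.Adj u c}) ⟨u, hu, hvu, hcon⟩
    (fun y hy => .inr (.inl hy.1)) (.inl rfl) fun h => hvA h.1
  · exact hvp hpq.symm
  · have hvq : ¬ G.Adj v q := fun hvq => hpn q hq hvq hpq
    obtain ⟨c, hc, hvc, hqc⟩ : ∃ c ∈ A, G.Adj v c ∧ G.Adj q c := by
      by_contra! hqn
      exact hqP ⟨hq, hvq, hqn⟩
    have hp : IsP4 G q c v d := ⟨hqc, hvc.symm, hvd, fun e => hvq e.symm, hAd q hq, hAd c hc⟩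
    exact hvp (hG.eq_of_adj_left hp hpq (hAd p hpA) ▸ hvc)
  · exact hAd p hpA hpq

theorem seesEvenly_of_pendant (hG : IsP4Sparse G) (hvA : v ∉ A) (hdA : d ∉ A) (hvd : G.Adj v d)
    (hAd : ∀ a ∈ A, ¬ G.Adj a d) (hu : u ∈ A) (hvu : ¬ G.Adj v u) (hc : c ∈ A) (hvc : G.Adj v c)
    (huc : G.Adj u c) (hx : x ∈ A) (hxu : x ≠ u) (hxc : x ≠ c) :
    ¬ G.Adj x u ∧ (G.Adj x c ↔ G.Adj v x) := by
  have hp : IsP4 G u c v d := ⟨huc, hvc.symm, hvd, fun e => hvu e.symm, hAd u hu, hAd c hc⟩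
  have hsees := hG.seesEvenly hp hxu hxc (fun e => hvA (e ▸ hx)) fun e => hdA (e ▸ hx)
  exact ⟨fun hxu => hAd x hx (hsees.1.1 hxu), hsees.2.1.trans (G.adj_comm x v)⟩

theorem isSpiderBase_of_pendant (hG : IsP4Sparse G) (hvA : v ∉ A) (hdA : d ∉ A)
    (hvd : G.Adj v d) (hAd : ∀ a ∈ A, ¬ G.Adj a d)
    (hmatch : ∀ u ∈ A, ¬ G.Adj v u → ∃ c ∈ A, G.Adj v c ∧ G.Adj u c) :
    IsSpiderBase G (insert d {u ∈ A | ¬ G.Adj v u})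
      (insert v {c ∈ A | G.Adj v c ∧ ∃ u ∈ A, ¬ G.Adj v u ∧ G.Adj u c})
      {c ∈ A | G.Adj v c ∧ ∀ u ∈ A, ¬ G.Adj v u → ¬ G.Adj u c} := by
  have hsees := fun {u c x} =>
    seesEvenly_of_pendant (u := u) (c := c) (x := x) hG hvA hdA hvd hAd
  refine ⟨?_, ?_, ?_, ?_, ?_, ?_, ?_⟩
  · rw [Set.disjoint_left]
    rintro s (rfl | hs) (rfl | hk)
    exacts [hvd.ne rfl, hdA hk.1, hvA hs.1, hs.2 hk.2.1]
  · rw [Set.disjoint_left]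
    rintro s (rfl | hs) hr
    exacts [hdA hr.1, hs.2 hr.2.1]
  · rw [Set.disjoint_left]
    rintro k (rfl | ⟨-, -, u, hu, hvu, huk⟩) hr
    exacts [hvA hr.1, hr.2.2 u hu hvu huk]
  · rintro s (rfl | hs) t (rfl | ht) hst
    · exact G.loopless.irrefl _
    · exact fun e => hAd t ht.1 e.symm
    · exact hAd s hs.1
    · obtain ⟨c, hc, hvc, hsc⟩ := hmatch s hs.1 hs.2
      exact fun e => (hsees hs.1 hs.2 hc hvc hsc ht.1 hst.symm
        (by rintro rfl; exact ht.2 hvc)).1 e.symm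
  · rintro k (rfl | hk) l (rfl | ⟨hl, hvl, u, hu, hvu, hul⟩) hkl
    · exact absurd rfl hkl
    · exact hvl
    · exact hk.2.1.symm
    · exact (hsees hu hvu hl hvl hul hk.1 (by rintro rfl; exact hvu hk.2.1)
        hkl).2.2 hk.2.1
  · rintro r ⟨hr, hvr, hrn⟩ k (rfl | ⟨hk, hvk, u, hu, hvu, huk⟩)
    · exact hvr.symm
    · exact (hsees hu hvu hk hvk huk hr (by rintro rfl; exact hvu hvr)
        (by rintro rfl; exact hrn u hu hvu huk)).2.2 hvr
  · rintro r ⟨hr, _, hrn⟩ s (rfl | hs)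
    exacts [hAd r hr, fun e => hrn s hs.1 hs.2 e.symm]

theorem inducesSpider_of_pendant (hG : IsP4Sparse G) (hvA : v ∉ A) (hdA : d ∉ A)
    (hvd : G.Adj v d) (hAd : ∀ a ∈ A, ¬ G.Adj a d) (hxA : x ∈ A) (hvx : ¬ G.Adj v x)
    (hmatch : ∀ u ∈ A, ¬ G.Adj v u → ∃ c ∈ A, G.Adj v c ∧ G.Adj u c) :
    InducesSpider G (insert v (A ∪ {d})) := by
  have hsees := fun {u c x} =>
    seesEvenly_of_pendant (u := u) (c := c) (x := x) hG hvA hdA hvd hAd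
  have hbase := isSpiderBase_of_pendant hG hvA hdA hvd hAd hmatch
  obtain ⟨y, hy, hvy, hxy⟩ := hmatch x hxA hvx
  have hK : Set.Nontrivial (insert v {c ∈ A | G.Adj v c ∧ ∃ u ∈ A, ¬ G.Adj v u ∧ G.Adj u c}) :=
    ⟨v, .inl rfl, y, .inr ⟨hy, hvy, x, hxA, hvx, hxy⟩, hvy.ne⟩
  obtain ⟨f, g, h⟩ : ∃ f g, IsMatchedSpider G False _ _ _ f g := by
    refine hbase.exists_isMatchedSpider hK ?_ ?_
    · rintro s (rfl | ⟨hs, hvs⟩)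
      · exact ⟨v, ⟨.inl rfl, hvd.symm⟩, fun k ⟨hk, hsk⟩ =>
          hk.resolve_right fun hk => hAd k hk.1 hsk.symm⟩
      · obtain ⟨c, hc, hvc, hsc⟩ := hmatch s hs hvs
        refine ⟨c, ⟨.inr ⟨hc, hvc, s, hs, hvs, hsc⟩, hsc⟩, ?_⟩
        rintro l ⟨rfl | hl, hsl⟩
        · exact absurd hsl.symm hvs
        · by_contra hlc
          exact (hsees hs hvs hc hvc hsc hl.1 hsl.ne.symm hlc).1 hsl.symm
    · rintro k (rfl | ⟨hk, hvk, u, hu, hvu, huk⟩)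
      · exact ⟨d, ⟨.inl rfl, hvd.symm⟩, fun s ⟨hs, hsk⟩ =>
          hs.resolve_right fun hs => hs.2 hsk.symm⟩
      · refine ⟨u, ⟨.inr ⟨hu, hvu⟩, huk⟩, ?_⟩
        rintro s ⟨rfl | hs, hsk⟩
        · exact absurd hsk.symm (hAd k hk)
        · by_contra hsu
          exact hs.2 ((hsees hu hvu hk hvk huk hs.1 hsu hsk.ne).2.1 hsk)
  refine ⟨_, _, _, _, f, g, h, ?_⟩
  ext z
  have hz : (∀ u ∈ A, ¬ G.Adj v u → ¬ G.Adj u z) ↔ ¬ ∃ u ∈ A, ¬ G.Adj v u ∧ G.Adj u z := by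
    simp only [not_exists, not_and]
  simp only [Set.mem_union, Set.mem_insert_iff, Set.mem_ofPred_eq, Set.mem_singleton_iff, hz]
  by_cases z ∈ A <;> by_cases G.Adj v z <;> grind

theorem inducesSpider_of_cut (hG : IsP4Sparse G) (hvA : v ∉ A) (hvB : v ∉ B)
    (hdisj : Disjoint A B) (hBne : B.Nonempty) (hAB : ∀ a ∈ A, ∀ b ∈ B, ¬ G.Adj a b) (hxA : x ∈ A)
    (hvx : ¬ G.Adj v x) (hX : ¬ DisconnectedOn G (insert v (A ∪ B))) :
    InducesSpider G (insert v (A ∪ B)) := by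
  obtain ⟨d, rfl, hvd⟩ := exists_eq_singleton_of_cut hG hvA hvB hdisj hBne hAB hxA hvx hX
  have hAd : ∀ a ∈ A, ¬ G.Adj a d := fun a ha => hAB a ha d rfl
  exact inducesSpider_of_pendant hG hvA (Set.disjoint_singleton_right.1 hdisj) hvd hAd hxA hvx
    fun u => exists_adj_adj_of_pendant hG hvA hvd hAd hX

theorem inducesSpider_of_disconnectedOn_sdiff (hG : IsP4Sparse G) (hv : v ∈ X)
    (h : DisconnectedOn G (X \ {v})) (hX : ¬ DisconnectedOn G X) (hX' : ¬ DisconnectedOn Gᶜ X) :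
    InducesSpider G X := by
  obtain ⟨A, B, ⟨a, ha⟩, ⟨b, hb⟩, hdisj, hABX, hAB⟩ := h
  have hXv : insert v (A ∪ B) = X := by
    rw [hABX, Set.insert_sdiff_singleton, Set.insert_eq_of_mem hv]
  have hvAB : v ∉ A ∪ B := by simp [hABX]
  obtain ⟨x, hx, hvx⟩ := exists_adj_of_not_disconnectedOn_insert (hXv ▸ hX') hvAB ⟨a, .inl ha⟩
  rw [SimpleGraph.compl_adj] at hvx
  simp only [Set.mem_union, not_or] at hvAB
  subst hXv
  rcases hx with hx | hx
  · exact inducesSpider_of_cut hG hvAB.1 hvAB.2 hdisj ⟨b, hb⟩ hAB hx hvx.2 hX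
  · rw [Set.union_comm] at hX ⊢
    exact inducesSpider_of_cut hG hvAB.2 hvAB.1 hdisj.symm ⟨a, ha⟩
      (fun b hb a ha e => hAB a ha b hb e.symm) hx hvx.2 hX

theorem disconnectedOn_or_compl_of_pair (hxy : x ≠ y) :
    DisconnectedOn G {x, y} ∨ DisconnectedOn Gᶜ {x, y} := by
  by_cases hadj : G.Adj x y
  · exact .inr ⟨{x}, {y}, ⟨x, rfl⟩, ⟨y, rfl⟩, by simpa using hxy, rfl, by simp [hadj]⟩
  · exact .inl ⟨{x}, {y}, ⟨x, rfl⟩, ⟨y, rfl⟩, by simpa using hxy, rfl, by simp [hadj]⟩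

theorem IsP4Sparse.disconnectedOn_or_compl_or_inducesSpider [Finite V] (hG : IsP4Sparse G)
    (hX : X.Nontrivial) : DisconnectedOn G X ∨ DisconnectedOn Gᶜ X ∨ InducesSpider G X := by
  induction hn : X.ncard using Nat.strong_induction_on generalizing X with
  | _ n ih =>
  subst hn
  by_contra! ⟨hdisc, hdisc', hspider⟩
  obtain ⟨v, hv, y, hy, hvy⟩ := hX
  have hXv : insert v (X \ {v}) = X := by rw [Set.insert_sdiff_singleton, Set.insert_eq_of_mem hv]
  by_cases hnt : (X \ {v}).Nontrivial
  · rcases ih _ (Set.ncard_sdiff_singleton_lt_of_mem hv) hnt rfl with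
      h | h | ⟨thick, S, K, R, f, g, h, hSKR⟩
    · exact hspider (inducesSpider_of_disconnectedOn_sdiff hG hv h hdisc hdisc')
    · have := inducesSpider_of_disconnectedOn_sdiff hG.compl hv h hdisc' (by rwa [compl_compl])
      exact hspider (by simpa only [compl_compl] using this.compl)
    · rw [← hXv, ← hSKR] at hdisc hdisc' hspider
      exact hspider (h.inducesSpider_insert hG (by simp [hSKR]) hdisc hdisc')
  · have hsing : X \ {v} = {y} :=
      (Set.not_nontrivial_iff.1 hnt).eq_singleton_of_mem ⟨hy, hvy.symm⟩
    rw [← hXv, hsing] at hdisc hdisc'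
    exact (disconnectedOn_or_compl_of_pair hvy).elim hdisc hdisc'

namespace IsMatchedSpider

variable {M : Set V} {k s : V}

theorem subset_module_of_leg_of_body (h : IsMatchedSpider G False S K R f g) (hM : IsModule G M)
    (hs : s ∈ S) (hsM : s ∈ M) (hk : k ∈ K) (hkM : k ∈ M) : S ∪ K ∪ R ⊆ M := by
  have body_mem_of_ne : ∀ l ∈ K, l ≠ f s → l ∈ M := fun l hl hls => by
    rcases eq_or_ne l k with rfl | hlk
    · exact hkM
    · refine hM.mem_of_adj_of_not_adj hkM hsM (h.clique l hl k hk hlk) ?_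
      rwa [G.adj_comm, h.adj_thin hs hl]
  have leg_mem : ∀ t ∈ S, t ∈ M := fun t ht => by
    rcases eq_or_ne t s with rfl | hts
    · exact hsM
    · have hft : f t ≠ f s := fun e => hts (h.bijOn.injOn ht hs e)
      exact hM.mem_of_adj_of_not_adj (body_mem_of_ne _ (h.f_mem t ht) hft) hsM
        ((h.adj_thin ht (h.f_mem t ht)).2 rfl) (h.indep t ht s hs)
  rintro z ((hz | hz) | hz)
  · exact leg_mem z hz
  · rcases eq_or_ne z (f s) with hzs | hzs
    · obtain ⟨l, hl, hlz⟩ := h.exists_body_ne z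
      refine hM.mem_of_adj_of_not_adj hsM (leg_mem _ (h.g_mem l hl))
        ((h.adj_thin hs hz).2 hzs).symm ?_
      rw [G.adj_comm, h.adj_thin (h.g_mem l hl) hz, h.f_g l hl]
      exact hlz.symm
    · exact body_mem_of_ne z hz hzs
  · exact hM.mem_of_adj_of_not_adj hkM hsM (h.adj_head_body z hz k hk)
      (h.not_adj_head_leg z hz s hs)

theorem subset_module_of_thin (h : IsMatchedSpider G False S K R f g) (hM : IsModule G M)
    (hx : x ∈ S ∪ K) (hxM : x ∈ M) (hy : y ∈ S ∪ K ∪ R) (hyM : y ∈ M) (hxy : x ≠ y) :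
    S ∪ K ∪ R ⊆ M := by
  have mem := @IsModule.mem_of_adj_of_not_adj V G M
  rcases hx with hx | hx
  · have hfx := h.f_mem x hx
    rcases hy with (hy | hy) | hy
    · refine h.subset_module_of_leg_of_body hM hx hxM hfx
        (mem hM hxM hyM ((h.adj_thin hx hfx).2 rfl).symm ?_)
      rw [G.adj_comm, h.adj_thin hy hfx]
      exact fun e => hxy (h.bijOn.injOn hx hy e)
    · exact h.subset_module_of_leg_of_body hM hx hxM hy hyM
    · obtain ⟨l, hl, hlx⟩ := h.exists_body_ne (f x)
      refine h.subset_module_of_leg_of_body hM hx hxM hl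
        (mem hM hyM hxM (h.adj_head_body y hy l hl).symm ?_)
      rwa [G.adj_comm, h.adj_thin hx hl]
  · have hgx := h.g_mem x hx
    have hadj : G.Adj (g x) x := (h.adj_thin hgx hx).2 (h.f_g x hx).symm
    rcases hy with (hy | hy) | hy
    · exact h.subset_module_of_leg_of_body hM hy hyM hx hxM
    · refine h.subset_module_of_leg_of_body hM hgx (mem hM hxM hyM hadj ?_) hx hxM
      rw [h.adj_thin hgx hy, h.f_g x hx]
      exact hxy.symm
    · exact h.subset_module_of_leg_of_body hM hgx
        (mem hM hxM hyM hadj fun e => h.not_adj_head_leg y hy _ hgx e.symm) hx hxM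

theorem subset_module (h : IsMatchedSpider G thick S K R f g) (hM : IsModule G M)
    (hx : x ∈ S ∪ K) (hxM : x ∈ M) (hy : y ∈ S ∪ K ∪ R) (hyM : y ∈ M) (hxy : x ≠ y) :
    S ∪ K ∪ R ⊆ M := by
  rcases h.thin_or_thick with h | h
  · exact h.subset_module_of_thin hM hx hxM hy hyM hxy
  · have h' : IsMatchedSpider Gᶜ False K S R g f := by simpa only [not_true] using h.compl
    rw [Set.union_comm S K] at hx hy ⊢
    exact h'.subset_module_of_thin hM.compl hx hxM hy hyM hxy

end IsMatchedSpider

end Structure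

/-! ### Existence of the tree -/

section Trees

variable {V : Type*} {G : SimpleGraph V} {S K R X Y : Set V} {c : NodeLabel} {T : LabTree V}

theorem nodeOK_iff {k : ℕ} {child : Fin k → LabTree V} (hc : c ≠ .two) :
    NodeOK G k child c ↔ (∀ i, ¬ (child i).HasRoot c) ∧ ∀ i j, i ≠ j →
      ∀ x ∈ (child i).leaves, ∀ y ∈ (child j).leaves, (G.Adj x y ↔ c = .one) := by
  cases c <;> simp_all [NodeOK]

theorem LabTree.Represents.leaves_nonempty (hT : T.Represents G) : T.leaves.Nonempty := by
  induction T with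
  | leaf v => exact ⟨v, rfl⟩
  | node c k child ih =>
    obtain ⟨hk, hrep, -⟩ := hT
    obtain ⟨x, hx⟩ := ih ⟨0, by omega⟩ (hrep _)
    exact ⟨x, Set.mem_iUnion.2 ⟨_, hx⟩⟩

theorem exists_represents_of_family {ι : Type*} [Finite ι] [Nontrivial ι] {child : ι → LabTree V}
    (hrep : ∀ i, (child i).Represents G)
    (hdisj : Pairwise fun i j => Disjoint (child i).leaves (child j).leaves)
    (hok : ∀ (k : ℕ) (e : Fin k ≃ ι), NodeOK G k (child ∘ e) c) :
    ∃ T : LabTree V, T.Represents G ∧ T.leaves = ⋃ i, (child i).leaves := by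
  obtain ⟨k, ⟨e⟩⟩ := Finite.exists_equiv_fin ι
  have hk : 1 < k := by simpa [Nat.card_congr e] using Finite.one_lt_card (α := ι)
  exact ⟨.node c k (child ∘ e.symm),
    ⟨hk, fun i => hrep _, fun i j hij => hdisj (e.symm.injective.ne hij), hok k e.symm⟩,
    e.symm.surjective.iUnion_comp fun i => (child i).leaves⟩

/-- `X` is the set of the leaves below the children of a possible `c`-node. A single child is
allowed, so that every tree qualifies, whether or not its root is a `c`-node. -/
def HasChildren (G : SimpleGraph V) (c : NodeLabel) (X : Set V) : Prop :=
  ∃ (k : ℕ) (child : Fin k → LabTree V), 0 < k ∧ (∀ i, (child i).Represents G) ∧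
    (∀ i j, i ≠ j → Disjoint (child i).leaves (child j).leaves) ∧ NodeOK G k child c ∧
    (⋃ i, (child i).leaves) = X

theorem LabTree.Represents.hasChildren (hT : T.Represents G) (hc : c ≠ .two) :
    HasChildren G c T.leaves := by
  by_cases h : T.HasRoot c
  · cases T with
    | leaf v => exact h.elim
    | node d k child =>
      obtain rfl : d = c := h
      obtain ⟨hk, hrep, hdisj, hok⟩ := hT
      exact ⟨k, child, by omega, hrep, hdisj, hok, rfl⟩
  · have hne : ∀ i j : Fin 1, ¬ i ≠ j := fun i j hij => hij (Subsingleton.elim i j)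
    exact ⟨1, fun _ => T, one_pos, fun _ => hT, fun i j hij => (hne i j hij).elim,
      (nodeOK_iff hc).2 ⟨fun _ => h, fun i j hij => (hne i j hij).elim⟩, Set.iUnion_const _⟩

theorem HasChildren.exists_represents_union (hX : HasChildren G c X) (hY : HasChildren G c Y)
    (hXY : Disjoint X Y) (hc : c ≠ .two) (hadj : ∀ x ∈ X, ∀ y ∈ Y, (G.Adj x y ↔ c = .one)) :
    ∃ T : LabTree V, T.Represents G ∧ T.leaves = X ∪ Y := by
  obtain ⟨m, a, hm, hrepa, hdisja, hoka, rfl⟩ := hX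
  obtain ⟨n, b, hn, hrepb, hdisjb, hokb, rfl⟩ := hY
  rw [nodeOK_iff hc] at hoka hokb
  have hdisj : ∀ i j, Disjoint (a i).leaves (b j).leaves := fun i j =>
    hXY.mono (Set.subset_iUnion (fun i => (a i).leaves) i)
      (Set.subset_iUnion (fun j => (b j).leaves) j)
  have hab : ∀ i j, ∀ x ∈ (a i).leaves, ∀ y ∈ (b j).leaves, (G.Adj x y ↔ c = .one) :=
    fun i j x hx y hy => hadj x (Set.mem_iUnion.2 ⟨i, hx⟩) y (Set.mem_iUnion.2 ⟨j, hy⟩)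
  have : Nontrivial (Fin m ⊕ Fin n) := ⟨.inl ⟨0, hm⟩, .inr ⟨0, hn⟩, Sum.inl_ne_inr⟩
  have hroot : ∀ i, ¬ (Sum.elim a b i).HasRoot c := by
    rintro (i | i)
    exacts [hoka.1 i, hokb.1 i]
  have hcross : ∀ i j, i ≠ j → ∀ x ∈ (Sum.elim a b i).leaves, ∀ y ∈ (Sum.elim a b j).leaves,
      (G.Adj x y ↔ c = .one) := by
    rintro (i | i) (j | j) hij x hx y hy
    exacts [hoka.2 i j (by simpa using hij) x hx y hy, hab i j x hx y hy,
      (G.adj_comm x y).trans (hab j i y hy x hx), hokb.2 i j (by simpa using hij) x hx y hy]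
  obtain ⟨T, hT, hleaves⟩ := exists_represents_of_family (G := G) (c := c) (child := Sum.elim a b)
    (by rintro (i | i); exacts [hrepa i, hrepb i])
    (by
      rintro (i | i) (j | j) hij
      exacts [hdisja i j (by simpa using hij), hdisj i j, (hdisj j i).symm,
        hdisjb i j (by simpa using hij)])
    fun k e => (nodeOK_iff hc).2
      ⟨fun i => hroot _, fun i j hij => hcross _ _ (e.injective.ne hij)⟩
  exact ⟨T, hT, by simp [hleaves, Set.iUnion_sum]⟩

theorem IsMatchedSpider.exists_represents [Finite V] {thick : Prop} {f g : V → V}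
    (h : IsMatchedSpider G thick S K R f g)
    (hR : R.Nonempty → ∃ T : LabTree V, T.Represents G ∧ T.leaves = R) :
    ∃ T : LabTree V, T.Represents G ∧ T.leaves = S ∪ K ∪ R := by
  have hdisj : ∀ v ∈ S ∪ K, v ∉ R := fun v hv =>
    hv.elim (h.leg_notMem_head v) (h.body_notMem_head v)
  obtain ⟨k, hk, l, hl, hkl⟩ := h.body_nontrivial
  have : Nontrivial (↥(S ∪ K) ⊕ PLift R.Nonempty) := ⟨.inl ⟨k, .inr hk⟩, .inl ⟨l, .inr hl⟩,
    fun e => hkl (congrArg Subtype.val (Sum.inl_injective e))⟩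
  choose tree htree hleaves using hR
  set child : ↥(S ∪ K) ⊕ PLift R.Nonempty → LabTree V :=
    Sum.elim (fun v => .leaf v) (fun hR => tree hR.down) with hchild
  have hunion : (⋃ i, (child i).leaves) = S ∪ K ∪ R := by
    ext x
    simp only [Set.mem_iUnion, Sum.exists, hchild, Sum.elim_inl, Sum.elim_inr, hleaves,
      LabTree.leaves, Set.mem_singleton_iff, Subtype.exists, exists_prop, exists_eq_right']
    exact or_congr_right ⟨fun ⟨_, hx⟩ => hx, fun hx => ⟨⟨x, hx⟩, hx⟩⟩
  rw [← hunion]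
  refine exists_represents_of_family (c := .two) ?_ ?_ ?_
  · rintro (_ | hR)
    exacts [trivial, htree hR.down]
  · rintro (v | hR) (w | hR') hij
    · exact Set.disjoint_singleton.2 fun hvw => hij (congrArg Sum.inl (Subtype.ext hvw))
    · exact Set.disjoint_singleton_left.2 fun hv => hdisj v v.2 (hleaves _ ▸ hv)
    · exact Set.disjoint_singleton_right.2 fun hw => hdisj w w.2 (hleaves _ ▸ hw)
    · exact absurd (congrArg Sum.inr (Subsingleton.elim hR hR')) hij
  · refine fun k e => ⟨S, K, R, h.isSpider, ?_, fun i => ?_⟩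
    · exact (e.surjective.iUnion_comp fun i => (child i).leaves).trans hunion
    · simp only [Function.comp_apply]
      rcases e i with v | hR
      exacts [.inl ⟨v, v.2, rfl⟩, .inr (hleaves _)]

theorem IsP4Sparse.exists_represents [Finite V] (hG : IsP4Sparse G) {X : Set V}
    (hX : X.Nonempty) : ∃ T : LabTree V, T.Represents G ∧ T.leaves = X := by
  induction hn : X.ncard using Nat.strong_induction_on generalizing X with
  | _ n ih =>
  subst hn
  have hlt : ∀ A ⊂ X, A.Nonempty → ∃ T : LabTree V, T.Represents G ∧ T.leaves = A :=
    fun A hA hne => ih _ (Set.ncard_lt_ncard hA) hne rfl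
  have hsplit : ∀ c ≠ NodeLabel.two, ∀ A B : Set V, A.Nonempty → B.Nonempty → Disjoint A B →
      A ∪ B = X → (∀ x ∈ A, ∀ y ∈ B, (G.Adj x y ↔ c = .one)) →
      ∃ T : LabTree V, T.Represents G ∧ T.leaves = X := by
    rintro c hc A B ⟨a, ha⟩ ⟨b, hb⟩ hAB rfl hadj
    obtain ⟨T, hT, rfl⟩ := hlt A ⟨Set.subset_union_left, fun h =>
      Set.disjoint_left.1 hAB (h (.inr hb)) hb⟩ ⟨a, ha⟩
    obtain ⟨T', hT', rfl⟩ := hlt B ⟨Set.subset_union_right, fun h =>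
      Set.disjoint_left.1 hAB ha (h (.inl ha))⟩ ⟨b, hb⟩
    exact (hT.hasChildren hc).exists_represents_union (hT'.hasChildren hc) hAB hc hadj
  by_cases hnt : X.Nontrivial
  swap
  · obtain ⟨x, hx⟩ := hX
    exact ⟨.leaf x, trivial,
      ((Set.not_nontrivial_iff.1 hnt).eq_singleton_of_mem hx).symm⟩
  rcases hG.disconnectedOn_or_compl_or_inducesSpider hnt with
    ⟨A, B, hA, hB, hAB, hABX, hadj⟩ | ⟨A, B, hA, hB, hAB, hABX, hadj⟩ | ⟨_, S, K, R, f, g, h, rfl⟩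
  · exact hsplit .zero (by simp) A B hA hB hAB hABX fun x hx y hy => by simp [hadj x hx y hy]
  · refine hsplit .one (by simp) A B hA hB hAB hABX fun x hx y hy => ?_
    simpa [(hAB.ne_of_mem hx hy)] using hadj x hx y hy
  · obtain ⟨k, hk⟩ := h.body_nontrivial.nonempty
    exact h.exists_represents fun hR => hlt R
      ⟨Set.subset_union_right, fun hs => h.body_notMem_head k hk (hs (.inl (.inr hk)))⟩ hR

theorem IsP4Sparse.exists_isP4SparseTree [Finite V] [Nonempty V] (hG : IsP4Sparse G) :
    ∃ T : LabTree V, IsP4SparseTree G T :=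
  hG.exists_represents Set.univ_nonempty

theorem exists_isPath (T : LabTree V) {u : V} (hu : u ∈ T.leaves) : ∃ p, IsPath T u p := by
  induction T with
  | leaf v =>
    obtain rfl : u = v := hu
    exact ⟨[], .leaf u⟩
  | node c k child ih =>
    obtain ⟨i, hi⟩ := Set.mem_iUnion.1 hu
    obtain ⟨p, hp⟩ := ih i hi
    exact ⟨_, .node c k child i u p hp⟩

theorem IsPath.hasRoot {u : V} {p : List (NodeLabel × Set V)} {A : Set V}
    (h : IsPath T u p) (h0 : p[0]? = some (c, A)) : T.HasRoot c := by
  cases h with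
  | leaf => simp at h0
  | node => exact congrArg Prod.fst (Option.some.inj h0)

end Trees

/-! ### Tree paths and levels -/

section TreePaths

variable {V : Type*} {G : SimpleGraph V} {L A : Set V} {u x y : V} {c : NodeLabel}
  {p : List (NodeLabel × Set V)} {T : LabTree V} {i : ℕ}

open Classical in
/-- The index of the node `t_i` of the path `p` at which the leaf `x` branches off, that is, with
`x ∈ V_i`; for the end vertex `u` of the path this is the length of `p`. -/
noncomputable def level : List (NodeLabel × Set V) → V → ℕ
  | [], _ => 0
  | e :: p, x => if x ∈ e.2 then 0 else level p x + 1

/-- The label of the node `t_i` of the path `p`, with the junk value `0` beyond the end of `p`. -/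
def label : List (NodeLabel × Set V) → ℕ → NodeLabel
  | [], _ => .zero
  | e :: _, 0 => e.1
  | _ :: p, i + 1 => label p i

/-- `p` is the path to `u` in a `P₄`-sparse tree of `G[L]`, described without reference to the tree
by the levels of the vertices. -/
structure IsTreePath (G : SimpleGraph V) (L : Set V) (u : V) (p : List (NodeLabel × Set V)) :
    Prop where
  self_mem : u ∈ L
  level_self : level p u = p.length
  level_lt_of_mem : ∀ x ∈ L, x ≠ u → level p x < p.length
  exists_level_eq : ∀ i < p.length, ∃ x ∈ L, level p x = i
  getElem?_eq : ∀ i < p.length, p[i]? = some (label p i, {x ∈ L | level p x = i})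
  adj_iff : ∀ x ∈ L, ∀ y ∈ L, level p x < level p y → label p (level p x) ≠ .two →
    (G.Adj x y ↔ label p (level p x) = .one)
  exists_isSpider : ∀ i < p.length, label p i = .two → ∃ S K R, IsSpider G S K R ∧
    S ∪ K ∪ R = {x ∈ L | i ≤ level p x} ∧
    ((i + 1 = p.length ∧ u ∈ S ∪ K) ∨ R = {x ∈ L | i < level p x})
  label_succ_ne : ∀ i, i + 1 < p.length → label p i ≠ .two → label p (i + 1) ≠ label p i

theorem label_eq_zero_of_length_le {i : ℕ} (h : p.length ≤ i) : label p i = .zero := by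
  induction p generalizing i with
  | nil => rfl
  | cons e p ih =>
    obtain _ | i := i
    · simp at h
    · exact ih (by simpa using h)

theorem level_cons_of_mem (hx : x ∈ A) : level ((c, A) :: p) x = 0 :=
  if_pos hx

theorem level_cons_of_notMem (hx : x ∉ A) : level ((c, A) :: p) x = level p x + 1 :=
  if_neg hx

theorem notMem_of_level_cons_pos (h : 0 < level ((c, A) :: p) x) : x ∉ A :=
  fun hx => h.ne' (level_cons_of_mem hx)

theorem setOf_level_cons (hAL : Disjoint A L) {P : ℕ → Prop} (hP : ¬ P 0) :
    {x ∈ A ∪ L | P (level ((c, A) :: p) x)} = {x ∈ L | P (level p x + 1)} := by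
  ext x
  by_cases hx : x ∈ A
  · simp [level_cons_of_mem hx, hP, Set.disjoint_left.1 hAL hx]
  · simp [level_cons_of_notMem hx, hx]

theorem isTreePath_singleton (G : SimpleGraph V) (u : V) : IsTreePath G {u} u [] where
  self_mem := rfl
  level_self := rfl
  level_lt_of_mem _ hx hxu := absurd hx hxu
  exists_level_eq _ hi := absurd hi (Nat.not_lt_zero _)
  getElem?_eq _ hi := absurd hi (Nat.not_lt_zero _)
  adj_iff _ _ _ _ h := absurd h (Nat.not_lt_zero _)
  exists_isSpider _ hi := absurd hi (Nat.not_lt_zero _)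
  label_succ_ne _ hi := absurd hi (Nat.not_lt_zero _)

theorem IsTreePath.exists_isSpider_cons (D : IsTreePath G L u p) (hAL : Disjoint A L)
    (hspider : c = .two → ∃ S K R, IsSpider G S K R ∧ S ∪ K ∪ R = A ∪ L ∧
      ((p = [] ∧ u ∈ S ∪ K) ∨ R = L)) :
    ∀ i < ((c, A) :: p).length, label ((c, A) :: p) i = .two → ∃ S K R, IsSpider G S K R ∧
      S ∪ K ∪ R = {x ∈ A ∪ L | i ≤ level ((c, A) :: p) x} ∧
      ((i + 1 = ((c, A) :: p).length ∧ u ∈ S ∪ K) ∨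
        R = {x ∈ A ∪ L | i < level ((c, A) :: p) x}) := by
  rintro (_ | i) hi hl
  · obtain ⟨S, K, R, hs, hSKR, h⟩ := hspider hl
    refine ⟨S, K, R, hs, hSKR.trans (by ext; simp), h.imp (And.imp_left fun h => by simp [h]) ?_⟩
    rw [setOf_level_cons hAL (P := (0 < ·)) (by simp)]
    simp
  · obtain ⟨S, K, R, hs, hSKR, h⟩ := D.exists_isSpider i (by simpa using hi) hl
    refine ⟨S, K, R, hs, ?_, h.imp (And.imp_left fun h => by simpa using h) ?_⟩
    · rw [setOf_level_cons hAL (P := (i + 1 ≤ ·)) (by simp)]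
      simpa using hSKR
    · rw [setOf_level_cons hAL (P := (i + 1 < ·)) (by simp)]
      simp

theorem IsTreePath.cons (D : IsTreePath G L u p) (hA : A.Nonempty) (hAL : Disjoint A L)
    (hadj : c ≠ .two → ∀ x ∈ A, ∀ y ∈ L, (G.Adj x y ↔ c = .one))
    (hspider : c = .two → ∃ S K R, IsSpider G S K R ∧ S ∪ K ∪ R = A ∪ L ∧
      ((p = [] ∧ u ∈ S ∪ K) ∨ R = L))
    (hlabel : c ≠ .two → 0 < p.length → label p 0 ≠ c) :
    IsTreePath G (A ∪ L) u ((c, A) :: p) := by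
  have hL : ∀ x ∈ L, level ((c, A) :: p) x = level p x + 1 := fun x hx =>
    level_cons_of_notMem (Set.disjoint_right.1 hAL hx)
  refine ⟨.inr D.self_mem, by rw [hL u D.self_mem, D.level_self, List.length_cons],
    ?_, ?_, ?_, ?_, ?_, ?_⟩
  · rintro x (hx | hx) hxu
    · simp [level_cons_of_mem hx]
    · simpa [hL x hx] using D.level_lt_of_mem x hx hxu
  · rintro (_ | i) hi
    · obtain ⟨x, hx⟩ := hA
      exact ⟨x, .inl hx, level_cons_of_mem hx⟩
    · obtain ⟨x, hx, hxi⟩ := D.exists_level_eq i (by simpa using hi)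
      exact ⟨x, .inr hx, by rw [hL x hx, hxi]⟩
  · rintro (_ | i) hi
    · have hset : {x ∈ A ∪ L | level ((c, A) :: p) x = 0} = A := by
        ext x
        by_cases hx : x ∈ A <;> simp [level_cons_of_mem, level_cons_of_notMem, hx]
      simp only [List.getElem?_cons_zero, label, hset]
    · rw [setOf_level_cons hAL (P := (· = i + 1)) (by simp)]
      simpa [label] using D.getElem?_eq i (by simpa using hi)
  · intro x hx y hy hxy hl
    have hyL : y ∈ L := hy.resolve_left (notMem_of_level_cons_pos (pos_of_gt hxy))
    obtain hx | hx := hx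
    · rw [level_cons_of_mem hx] at hl ⊢
      exact hadj hl x hx y hyL
    · rw [hL x hx] at hxy hl ⊢
      rw [hL y hyL] at hxy
      exact D.adj_iff x hx y hyL (by omega) hl
  · exact D.exists_isSpider_cons hAL hspider
  · rintro (_ | i) hi hl
    · exact hlabel hl (by simpa using hi)
    · exact D.label_succ_ne i (by simpa using hi) hl

theorem IsPath.isTreePath (h : IsPath T u p) (hT : T.Represents G) :
    IsTreePath G T.leaves u p := by
  induction h with
  | leaf u => exact isTreePath_singleton G u
  | node c k child i u p h ih =>
    obtain ⟨hk, hrep, hdisj, hok⟩ := hT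
    have D := ih (hrep i)
    have hleaves : (LabTree.node c k child).leaves =
        (⋃ j ∈ {j | j ≠ i}, (child j).leaves) ∪ (child i).leaves := by
      ext x
      simp only [LabTree.leaves, Set.mem_union, Set.mem_iUnion, Set.mem_ofPred_eq, exists_prop]
      grind
    rw [hleaves]
    refine D.cons ?_ ?_ ?_ ?_ ?_
    · have : Nontrivial (Fin k) := Fin.nontrivial_iff_two_le.2 hk
      obtain ⟨j, hj⟩ := exists_ne i
      obtain ⟨x, hx⟩ := (hrep j).leaves_nonempty
      exact ⟨x, Set.mem_biUnion hj hx⟩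
    · exact Set.disjoint_iUnion₂_left.2 fun j hj => hdisj j i hj
    · intro hc x hx y hy
      obtain ⟨j, hj, hx⟩ := Set.mem_iUnion₂.1 hx
      exact ((nodeOK_iff hc).1 hok).2 j i hj x hx y hy
    · rintro rfl
      obtain ⟨S, K, R, hs, hSKR, hchild⟩ := hok
      refine ⟨S, K, R, hs, hSKR ▸ hleaves, (hchild i).imp ?_ Eq.symm⟩
      rintro ⟨v, hv, hiv⟩
      rw [hiv] at h
      cases h
      exact ⟨rfl, hv⟩
    · rintro hc hp rfl
      exact ((nodeOK_iff hc).1 hok).1 i (h.hasRoot (D.getElem?_eq 0 hp))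

theorem IsP4SparseTree.isTreePath (hT : IsP4SparseTree G T) (hp : IsPath T u p) :
    IsTreePath G Set.univ u p :=
  hT.2 ▸ hp.isTreePath hT.1

namespace IsTreePath

theorem level_lt (D : IsTreePath G Set.univ u p) (hx : x ≠ u) : level p x < p.length :=
  D.level_lt_of_mem x trivial hx

theorem level_le (D : IsTreePath G Set.univ u p) (x : V) : level p x ≤ p.length := by
  by_cases hx : x = u
  · rw [hx, D.level_self]
  · exact (D.level_lt hx).le

theorem eq_self (D : IsTreePath G Set.univ u p) (h : p.length ≤ level p x) : x = u :=
  by_contra fun hx => (D.level_lt hx).not_ge h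

theorem not_adj (D : IsTreePath G Set.univ u p) (h : level p x < level p y)
    (hl : label p (level p x) = .zero) : ¬ G.Adj x y := by
  simp [D.adj_iff x trivial y trivial h, hl]

theorem adj (D : IsTreePath G Set.univ u p) (h : level p x < level p y)
    (hl : label p (level p x) = .one) : G.Adj x y := by
  simp [D.adj_iff x trivial y trivial h, hl]

theorem isModule (D : IsTreePath G Set.univ u p) (i : ℕ) : IsModule G {x | i ≤ level p x} := by
  intro x hx
  have hlt : ∀ y, i ≤ level p y → level p x < level p y := fun y hy => lt_of_not_ge fun h =>
    hx (hy.trans h)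
  rcases hl : label p (level p x) with _ | _ | _
  · exact .inr fun y hy => D.not_adj (hlt y hy) hl
  · exact .inl fun y hy => D.adj (hlt y hy) hl
  by_cases hxu : x = u
  · exact .inr fun y hy => absurd (hlt y hy) (by
      rw [hxu, D.level_self]
      exact (D.level_le y).not_gt)
  obtain ⟨S, K, R, hs, hSKR, ⟨hn, -⟩ | rfl⟩ := D.exists_isSpider _ (D.level_lt hxu) hl
  · have hu : ∀ y, i ≤ level p y → y = u := fun y hy => D.eq_self (hn ▸ hlt y hy)
    by_cases hadj : G.Adj x u
    · exact .inl fun y hy => hu y hy ▸ hadj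
    · exact .inr fun y hy => hu y hy ▸ hadj
  · obtain ⟨_, f, g, h⟩ := hs.exists_isMatchedSpider
    have hx' := hSKR.ge (show x ∈ {y ∈ Set.univ | level p x ≤ level p y} from ⟨trivial, le_rfl⟩)
    rcases hx' with (hx' | hx') | hx'
    · exact .inr fun y hy hxy => h.not_adj_head_leg y ⟨trivial, hlt y hy⟩ x hx' hxy.symm
    · exact .inl fun y hy => (h.adj_head_body y ⟨trivial, hlt y hy⟩ x hx').symm
    · exact absurd hx'.2 (lt_irrefl _)

theorem lower_eq (D : IsTreePath G Set.univ u p) (i : ℕ) :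
    lower p i = {x | i ≤ level p x ∧ x ≠ u} := by
  ext x
  constructor
  · rintro ⟨e, he, hx⟩
    obtain ⟨m, hm⟩ := List.mem_iff_getElem?.1 he
    rw [List.getElem?_drop] at hm
    have hlt : i + m < p.length := (List.getElem?_eq_some_iff.1 hm).1
    rw [D.getElem?_eq _ hlt] at hm
    obtain rfl := Option.some.inj hm
    have hxm : level p x = i + m := hx.2
    refine ⟨by omega, ?_⟩
    rintro rfl
    exact hlt.ne (hxm ▸ D.level_self)
  · rintro ⟨hix, hxu⟩
    refine ⟨(label p (level p x), {y ∈ Set.univ | level p y = level p x}), ?_, trivial, rfl⟩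
    rw [List.mem_iff_getElem?]
    refine ⟨level p x - i, ?_⟩
    rw [List.getElem?_drop, Nat.add_sub_cancel' hix, D.getElem?_eq _ (D.level_lt hxu)]

theorem insert_lower (D : IsTreePath G Set.univ u p) (hi : i ≤ p.length) :
    insert u (lower p i) = {x | i ≤ level p x} := by
  rw [D.lower_eq]
  ext x
  by_cases h : x = u
  · simp [h, D.level_self, hi]
  · simp [h]

end IsTreePath

end TreePaths

/-! ### The cost of the formations -/

section Formations

variable {V : Type*} {G G' : SimpleGraph V} {H : SimpleGraph (Option V)} {M Z : Set V} {u x y : V}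

theorem addTail_some_some : (addTail G u).Adj (some x) (some y) ↔ G.Adj x y := by
  rw [addTail, SimpleGraph.sup_adj, SimpleGraph.map_adj]
  simp [SimpleGraph.edge_adj]

theorem addTail_none_some : (addTail G u).Adj none (some y) ↔ y = u := by
  rw [addTail, SimpleGraph.sup_adj, SimpleGraph.map_adj]
  simp [SimpleGraph.edge_adj, eq_comm]

theorem addTail_some_none : (addTail G u).Adj (some y) none ↔ y = u := by
  rw [SimpleGraph.adj_comm, addTail_none_some]

theorem addTail_le_iff : addTail G u ≤ H ↔ G ≤ H.comap some ∧ H.Adj none (some u) := by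
  refine ⟨fun h => ⟨fun x y hxy => h (addTail_some_some.2 hxy), h (addTail_none_some.2 rfl)⟩, ?_⟩
  rintro ⟨hGH, hu⟩ (_ | x) (_ | y) hxy
  · exact absurd hxy (SimpleGraph.irrefl _)
  · rwa [addTail_none_some.1 hxy]
  · rw [addTail_some_none.1 hxy]
    exact hu.symm
  · exact hGH (addTail_some_some.1 hxy)

/-- The neighbours of the new vertex `w` other than `u`: all fill edges at `w` lead to them. -/
def tailNbrs (H : SimpleGraph (Option V)) (u : V) : Set V :=
  {y | y ≠ u ∧ H.Adj none (some y)}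

theorem edgeSet_sdiff_addTail :
    H.edgeSet \ (addTail G u).edgeSet =
      (fun y : V => s((none : Option V), some y)) '' tailNbrs H u ∪
        Sym2.map some '' ((H.comap some).edgeSet \ G.edgeSet) := by
  refine Set.Subset.antisymm ?_ (Set.union_subset ?_ ?_)
  · rintro ⟨x, y⟩ ⟨hH, hG⟩
    change H.Adj x y at hH
    change ¬ (addTail G u).Adj x y at hG
    rcases x with _ | x <;> rcases y with _ | y
    · exact absurd hH (SimpleGraph.irrefl _)
    · exact .inl ⟨y, ⟨mt addTail_none_some.2 hG, hH⟩, rfl⟩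
    · exact .inl ⟨x, ⟨mt addTail_some_none.2 hG, hH.symm⟩, Sym2.eq_swap⟩
    · exact .inr ⟨s(x, y), ⟨hH, mt addTail_some_some.2 hG⟩, rfl⟩
  · rintro _ ⟨y, hy, rfl⟩
    exact ⟨hy.2, mt addTail_none_some.1 hy.1⟩
  · rintro _ ⟨⟨x, y⟩, hxy, rfl⟩
    exact ⟨hxy.1, mt addTail_some_some.1 hxy.2⟩

theorem fill_eq [Finite V] :
    fill G u H = (tailNbrs H u).ncard + ((H.comap some).edgeSet \ G.edgeSet).ncard := by
  have hinj : Function.Injective (fun y : V => s((none : Option V), some y)) := fun x y hxy => by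
    simpa using hxy
  rw [fill, edgeSet_sdiff_addTail, Set.ncard_union_eq ?_ (Set.toFinite _) (Set.toFinite _),
    Set.ncard_image_of_injective _ hinj,
    Set.ncard_image_of_injective _ (Sym2.map.injective (Option.some_injective V))]
  rw [Set.disjoint_left]
  rintro _ ⟨y, -, rfl⟩ ⟨⟨a, b⟩, -, he⟩
  change s(some a, some b) = _ at he
  simp at he

theorem fill_eq_add [Finite V] (hG : G ≤ G') (hH : addTail G' u ≤ H) :
    fill G u H = fill G' u H + (G'.edgeSet \ G.edgeSet).ncard := by
  have hGE := SimpleGraph.edgeSet_mono hG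
  have hHE := SimpleGraph.edgeSet_mono (addTail_le_iff.1 hH).1
  rw [fill_eq, fill_eq, add_assoc, ← Set.ncard_union_eq ?_ (Set.toFinite _) (Set.toFinite _),
    Set.sdiff_union_sdiff_cancel hHE hGE]
  exact Set.disjoint_left.2 fun e he he' => he.2 he'.1

theorem formation_some_some : (formationGraph G u Z).Adj (some x) (some y) ↔
    G.Adj x y ∨ (x ≠ y ∧ ((x = u ∧ y ∈ Z) ∨ (y = u ∧ x ∈ Z))) := by
  simp only [formationGraph, SimpleGraph.sup_adj, addTail_some_some, SimpleGraph.fromRel_adj]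
  simp
  grind

theorem formation_none_some : (formationGraph G u Z).Adj none (some y) ↔
    y = u ∨ (y ∉ Z ∧ G.Adj u y) := by
  simp only [formationGraph, SimpleGraph.sup_adj, addTail_none_some, SimpleGraph.fromRel_adj]
  simp

theorem addTail_le_formation : addTail G u ≤ formationGraph G u Z := le_sup_left

theorem edgeSet_formation_sdiff (hZ : u ∉ Z) :
    ((formationGraph G u Z).comap some).edgeSet \ G.edgeSet =
      (fun z => s(u, z)) '' {z | z ∈ Z ∧ ¬ G.Adj u z} := by
  refine Set.Subset.antisymm ?_ ?_
  · rintro ⟨x, y⟩ ⟨hF, hG⟩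
    change ¬ G.Adj x y at hG
    rcases formation_some_some.1 hF with h | ⟨-, ⟨rfl, hy⟩ | ⟨rfl, hx⟩⟩
    · exact absurd h hG
    · exact ⟨y, ⟨hy, hG⟩, rfl⟩
    · exact ⟨x, ⟨hx, fun h => hG h.symm⟩, Sym2.eq_swap⟩
  · rintro _ ⟨z, ⟨hz, huz⟩, rfl⟩
    exact ⟨formation_some_some.2 (.inr ⟨(ne_of_mem_of_not_mem hz hZ).symm, .inl ⟨rfl, hz⟩⟩), huz⟩

/-- The fill edges of the formation with `Z = M \ {u}`, by their end other than `u` and `w`. -/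
def formationFill (G : SimpleGraph V) (u : V) (M : Set V) : Set V :=
  {y | y ≠ u ∧ (y ∈ M ↔ ¬ G.Adj u y)}

theorem fill_formation [Finite V] (hZ : u ∉ Z) :
    fill G u (formationGraph G u Z) = (formationFill G u Z).ncard := by
  have hinj : Function.Injective (fun z => s(u, z)) := fun x y hxy =>
    Sym2.congr_right.1 hxy
  rw [fill_eq, edgeSet_formation_sdiff hZ, Set.ncard_image_of_injective _ hinj,
    ← Set.ncard_union_eq ?_ (Set.toFinite _) (Set.toFinite _)]
  · congr 1
    ext y
    simp only [tailNbrs, formationFill, Set.mem_union, Set.mem_ofPred_eq, formation_none_some]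
    grind
  · rw [Set.disjoint_left]
    rintro y ⟨hyu, hwy⟩ ⟨hyZ, -⟩
    exact ((formation_none_some.1 hwy).resolve_left hyu).1 hyZ

/-- `u` lies in no `P₄` of `G`: the case in which Formation 1 keeps the graph `P₄`-sparse. -/
def InNoP4 (G : SimpleGraph V) (u : V) : Prop :=
  ∀ ⦃a b c d⦄, IsP4 G a b c d → u ∉ ({a, b, c, d} : Set V)

theorem IsP4Sparse.isP4_all_or_none (hG : IsP4Sparse G) (hM : IsModule G M) (hu : u ∈ M)
    (hMu : M = {u} → InNoP4 G u) {a b c d : V} (h : IsP4 G a b c d) :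
    (a ∈ M ∧ b ∈ M ∧ c ∈ M ∧ d ∈ M) ∨ (a ∉ M ∧ b ∉ M ∧ c ∉ M ∧ d ∉ M) := by
  rcases M.eq_singleton_or_nontrivial hu with rfl | hnt
  · have := hMu rfl h
    simp only [Set.mem_insert_iff, Set.mem_singleton_iff, not_or] at this ⊢
    grind
  · exact hG.isP4_module_all_or_none hM hnt h

theorem formation_adj_of_notMem {x y : Option V}
    (hx : x.getD u ∉ insert u Z) :
    (formationGraph G u Z).Adj x y ↔ G.Adj (x.getD u) (y.getD u) := by
  rcases x with _ | x
  · exact absurd (Set.mem_insert u Z) hx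
  have hx' : x ≠ u ∧ x ∉ Z := by simpa using hx
  rcases y with _ | y
  · rw [SimpleGraph.adj_comm, formation_none_some]
    simp [hx', G.adj_comm]
  · rw [formation_some_some]
    simp [hx']

-- On this set the formation is the join of `u` and the disjoint union of `w` and `G[Z]`.
theorem isP4SparseOn_formation (hG : IsP4Sparse G) :
    IsP4SparseOn (formationGraph G u Z) ((·.getD u) ⁻¹' insert u Z) := by
  have hset : (·.getD u) ⁻¹' insert u Z = insert (some u) (insert none (some '' (Z \ {u}))) := by
    ext (_ | x)
    · simp
    · by_cases hx : x = u <;> simp [hx]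
  have hZ : IsP4SparseOn (formationGraph G u Z) (some '' (Z \ {u})) := by
    refine hG.isP4SparseOn_of_injOn (φ := (·.getD u)) ?_ ?_
    · rintro _ ⟨x, -, rfl⟩ _ ⟨y, -, rfl⟩ hxy
      exact congrArg some hxy
    · rintro _ ⟨x, hx, rfl⟩ _ ⟨y, hy, rfl⟩
      simp [formation_some_some, show x ≠ u from hx.2, show y ≠ u from hy.2]
  rw [hset]
  refine (hZ.insert_isolated ?_).insert_universal ?_
  · rintro _ ⟨x, hx, rfl⟩ h
    exact ((formation_none_some.1 h).resolve_left hx.2).1 hx.1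
  · rintro _ (rfl | ⟨x, hx, rfl⟩) -
    · exact (formation_none_some.2 (.inl rfl)).symm
    · exact formation_some_some.2 (.inr ⟨Ne.symm hx.2, .inl ⟨rfl, hx.1⟩⟩)

theorem isP4Sparse_formationGraph (hG : IsP4Sparse G) (hM : IsModule G (insert u Z))
    (hMu : insert u Z = {u} → InNoP4 G u) : IsP4Sparse (formationGraph G u Z) := by
  refine hG.substitute_module (φ := (·.getD u)) hM
    (fun _ _ _ _ => hG.isP4_all_or_none hM (Set.mem_insert u Z) hMu) ?_
    (fun x y hx => formation_adj_of_notMem hx) (isP4SparseOn_formation hG)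
  rintro (_ | x) (_ | y) hx hxy
  · rfl
  · exact absurd (Set.mem_insert u Z) hx
  · exact absurd (hxy ▸ Set.mem_insert u Z) hx
  · exact congrArg some hxy

theorem not_isWing_formationGraph (hM : IsModule G (insert u Z)) :
    ¬ IsWing (formationGraph G u Z) (some u) none := by
  rintro ⟨c, d, h | h⟩
  · obtain ⟨-, hc, -, huc, -, -⟩ := id h
    rcases c with _ | c
    · exact SimpleGraph.irrefl _ hc
    · rcases formation_none_some.1 hc with rfl | hc
      · exact h.pairwise_ne.2.1 rfl
      · exact huc (formation_some_some.2 (.inl hc.2))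
  · obtain ⟨-, hne_c, hne_d, huc_ne, hud_ne, -⟩ := h.pairwise_ne
    obtain ⟨-, huc, hcd, hwc, -, hud⟩ := h
    rcases c with _ | c
    · exact hne_c rfl
    rcases d with _ | d
    · exact hne_d rfl
    -- Now `c ∈ Z`, while `d` sees `c` and not `u`.
    rw [formation_none_some] at hwc
    rw [formation_some_some] at huc hcd hud
    have hc : c ∈ insert u Z := by grind
    have hd : d ∉ insert u Z := by grind
    have := hM.adj_iff hd hc (Set.mem_insert u Z)
    grind [G.adj_comm d c, G.adj_comm d u]

end Formations

namespace IsTreePath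

variable {V : Type*} {G : SimpleGraph V} {M P : Set V} {u x y : V}
  {p : List (NodeLabel × Set V)} {i : ℕ}

theorem setOf_length_le_level (D : IsTreePath G Set.univ u p) :
    {x | p.length ≤ level p x} = {u} :=
  Set.Subset.antisymm (fun _ => D.eq_self) (Set.singleton_subset_iff.2 D.level_self.ge)

theorem level_lt_level_self (D : IsTreePath G Set.univ u p) (hx : x ≠ u) :
    level p x < level p u :=
  D.level_self ▸ D.level_lt hx

theorem isFormation (D : IsTreePath G Set.univ u p) (hi : i ≤ p.length)
    (hl : i < p.length → label p i ≠ .zero) :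
    IsFormation G u p (formationGraph G u (lower p i)) := by
  rcases hi.lt_or_eq with h | rfl
  · refine .inr ⟨i, label p i, _, D.getElem?_eq i h, ?_, rfl⟩
    rcases hl' : label p i with _ | _ | _
    exacts [absurd hl' (hl h), .inl rfl, .inr rfl]
  · refine .inl (congrArg _ ?_)
    rw [D.lower_eq]
    exact Set.eq_empty_of_forall_notMem fun x hx => hx.2 (D.eq_self hx.1)

theorem exists_formation_of_level [Finite V] (D : IsTreePath G Set.univ u p) (hG : IsP4Sparse G)
    (hi : i ≤ p.length) (hl : i < p.length → label p i ≠ .zero)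
    (hu : i = p.length → InNoP4 G u) (hP : formationFill G u {x | i ≤ level p x} ⊆ P) :
    ∃ H, IsFormation G u p H ∧ IsCompletion G u H ∧ fill G u H ≤ P.ncard := by
  refine ⟨_, D.isFormation hi hl, ⟨addTail_le_formation, ?_⟩, ?_⟩
  · refine isP4Sparse_formationGraph hG (D.insert_lower hi ▸ D.isModule i) ?_
    rw [D.insert_lower hi]
    refine fun hiu => hu (hi.antisymm (not_lt.1 fun hlt => ?_))
    obtain ⟨x, -, hx⟩ := D.exists_level_eq i hlt
    obtain rfl : x = u := hiu.le hx.ge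
    exact hlt.ne (hx ▸ D.level_self)
  · rw [fill_formation (by simp [D.lower_eq]), D.lower_eq]
    refine Set.ncard_le_ncard (subset_trans ?_ hP)
    rintro y ⟨hyu, hy⟩
    exact ⟨hyu, by simpa [hyu] using hy⟩

theorem isModule_of_label_zero (D : IsTreePath G Set.univ u p) (hM : IsModule G M)
    (hmin : ∀ y ∈ M, level p x ≤ level p y) (hl : label p (level p x) = .zero) :
    IsModule G {y ∈ M | level p x < level p y} := by
  refine isModule_iff.2 fun y hy a ha b hb hya => ?_
  by_cases hyM : y ∈ M
  · have hxy : level p y = level p x :=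
      (not_lt.1 fun h => hy ⟨hyM, h⟩).antisymm (hmin y hyM)
    exact absurd hya (D.not_adj (hxy ▸ ha.2) (hxy ▸ hl))
  · exact (hM.adj_iff hyM ha.1 hb.1).1 hya

theorem formationFill_subset_of_label_zero (D : IsTreePath G Set.univ u p)
    (hmin : ∀ y ∈ M, level p x ≤ level p y) (hl : label p (level p x) = .zero) :
    formationFill G u {y ∈ M | level p x < level p y} ⊆ formationFill G u M := by
  rintro y ⟨hyu, hy⟩
  refine ⟨hyu, fun hyM hadj => ?_, fun hadj => (hy.2 hadj).1⟩
  have hxy : level p y = level p x :=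
    (not_lt.1 fun h => hy.1 ⟨hyM, h⟩ hadj).antisymm (hmin y hyM)
  exact D.not_adj (D.level_lt_level_self hyu) (hxy ▸ hl) hadj.symm

theorem inNoP4_of_label_zero (D : IsTreePath G Set.univ u p) (hG : IsP4Sparse G)
    (hM : IsModule G M) (hu : u ∈ M) (hxM : x ∈ M) (hxu : x ≠ u)
    (hmin : ∀ y ∈ M, level p x ≤ level p y) (hl : label p (level p x) = .zero)
    (hMu : {y ∈ M | level p x < level p y} = {u}) : InNoP4 G u := by
  have not_adj : ∀ y ∈ M, ¬ G.Adj u y := fun y hyM hadj => by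
    have hyu := hadj.ne'
    have hxy : level p y = level p x :=
      (not_lt.1 fun h => hyu (hMu.le ⟨hyM, h⟩)).antisymm (hmin y hyM)
    exact D.not_adj (D.level_lt_level_self hyu) (hxy ▸ hl) hadj.symm
  intro a b c d h huP
  have hall := hG.isP4_module_all_or_none hM ⟨x, hxM, u, hu, hxu⟩ h
  obtain ⟨y, hy, huy⟩ := h.exists_adj_of_mem huP
  have : y ∈ M := by
    simp only [Set.mem_insert_iff, Set.mem_singleton_iff] at huP hy
    grind
  exact not_adj y this huy

theorem formationFill_subset_of_label_one (D : IsTreePath G Set.univ u p)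
    (hM : IsModule G M) (hu : u ∈ M) (hxM : x ∈ M)
    (hmin : ∀ y ∈ M, level p x ≤ level p y) (hl : label p (level p x) = .one) :
    formationFill G u {y | level p x ≤ level p y} ⊆ formationFill G u M := by
  rintro y ⟨hyu, hy⟩
  refine ⟨hyu, fun hyM => hy.1 (hmin y hyM), fun hadj => ?_⟩
  by_contra hyM
  rcases (show level p x ≤ level p y from hy.2 hadj).lt_or_eq with hlt | heq
  · exact hadj ((hM.adj_iff hyM hxM hu).1 (D.adj hlt hl).symm).symm
  · exact hadj (D.adj (D.level_lt_level_self hyu) (heq ▸ hl)).symm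

theorem setOf_level_le_of_label_two (D : IsTreePath G Set.univ u p) (hM : IsModule G M)
    (hu : u ∈ M) (hxM : x ∈ M) (hxu : x ≠ u) (hmin : ∀ y ∈ M, level p x ≤ level p y)
    (hl : label p (level p x) = .two) :
    {y | level p x ≤ level p y} = M := by
  refine Set.Subset.antisymm ?_ hmin
  obtain ⟨S, K, R, hs, hSKR, hR⟩ := D.exists_isSpider _ (D.level_lt hxu) hl
  obtain ⟨_, f, g, h⟩ := hs.exists_isMatchedSpider
  have hx : x ∈ S ∪ K ∪ R := hSKR.ge ⟨trivial, le_rfl⟩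
  have hu' : u ∈ S ∪ K ∪ R := hSKR.ge ⟨trivial, (D.level_lt_level_self hxu).le⟩
  have hsub : S ∪ K ∪ R ⊆ M := by
    rcases hR with ⟨-, huSK⟩ | rfl
    · exact h.subset_module hM huSK hu hx hxM hxu.symm
    · exact h.subset_module hM (hx.resolve_right fun h => h.2.false) hxM hu' hu hxu
  exact fun y hy => hsub (hSKR.ge ⟨trivial, hy⟩)

theorem exists_formation [Finite V] (D : IsTreePath G Set.univ u p) (hG : IsP4Sparse G)
    (hM : IsModule G M) (hu : u ∈ M) (hMu : M = {u} → InNoP4 G u) :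
    ∃ H, IsFormation G u p H ∧ IsCompletion G u H ∧
      fill G u H ≤ (formationFill G u M).ncard := by
  induction hm : M.ncard using Nat.strong_induction_on generalizing M with
  | _ m ih =>
  subst hm
  obtain ⟨x, hxM, hmin⟩ := Set.exists_min_image M (level p) (Set.toFinite M) ⟨u, hu⟩
  by_cases hxu : x = u
  · have hM_eq : {x | p.length ≤ level p x} = M := by
      refine Set.Subset.antisymm (D.setOf_length_le_level ▸ Set.singleton_subset_iff.2 hu) ?_
      exact fun y hy => D.level_self.ge.trans (hxu ▸ hmin y hy)
    exact D.exists_formation_of_level hG le_rfl (fun h => absurd h (lt_irrefl _))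
      (fun _ => hMu (hM_eq ▸ D.setOf_length_le_level)) (by rw [hM_eq])
  have hlt := D.level_lt hxu
  rcases hl : label p (level p x) with _ | _ | _
  · have hssub : {y ∈ M | level p x < level p y} ⊂ M :=
      ⟨fun y hy => hy.1, fun h => (h hxM).2.false⟩
    obtain ⟨H, hform, hcompl, hfill⟩ := ih _ (Set.ncard_lt_ncard hssub)
      (D.isModule_of_label_zero hM hmin hl) ⟨hu, D.level_lt_level_self hxu⟩
      (D.inNoP4_of_label_zero hG hM hu hxM hxu hmin hl) rfl
    exact ⟨H, hform, hcompl,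
      hfill.trans (Set.ncard_le_ncard (D.formationFill_subset_of_label_zero hmin hl))⟩
  · exact D.exists_formation_of_level hG hlt.le (fun _ => by simp [hl])
      (fun h => absurd h hlt.ne) (D.formationFill_subset_of_label_one hM hu hxM hmin hl)
  · exact D.exists_formation_of_level hG hlt.le (fun _ => by simp [hl])
      (fun h => absurd h hlt.ne) (by rw [D.setOf_level_le_of_label_two hM hu hxM hxu hmin hl])

section NoTwo

variable (D : IsTreePath G Set.univ u p) (h2 : ∀ i, label p i ≠ .two)
include D h2

theorem self_adj_iff (hy : y ≠ u) : G.Adj u y ↔ label p (level p y) = .one := by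
  rw [G.adj_comm, D.adj_iff y trivial u trivial (D.level_lt_level_self hy) (h2 _)]

theorem adj_of_self_adj (hx : G.Adj u x) (hxy : level p x < level p y) : G.Adj x y :=
  D.adj hxy ((D.self_adj_iff h2 hx.ne').1 hx)

theorem not_adj_of_not_self_adj (hx : ¬ G.Adj u x) (hxy : level p x < level p y) :
    ¬ G.Adj x y := by
  have hxu : x ≠ u := by
    rintro rfl
    exact (D.level_le y).not_gt (D.level_self ▸ hxy)
  rwa [D.adj_iff x trivial y trivial hxy (h2 _), ← D.self_adj_iff h2 hxu]

theorem self_adj_congr (hxy : level p x = level p y) : G.Adj u x ↔ G.Adj u y := by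
  by_cases hx : x = u
  · rw [hx, D.eq_self (x := y) (by rw [← hxy, hx, D.level_self])]
  by_cases hy : y = u
  · exact absurd (D.eq_self (by rw [hxy, hy, D.level_self])) hx
  rw [D.self_adj_iff h2 hx, D.self_adj_iff h2 hy, hxy]

theorem inNoP4 : InNoP4 G u := by
  intro a b c d h hu
  obtain ⟨z, hz, hzu, hnadj⟩ := h.exists_not_adj_of_mem hu
  obtain ⟨y, hy, hadj⟩ := h.exists_adj_of_mem hu
  obtain ⟨x, ⟨hx, hxu⟩, hmin⟩ := Set.exists_min_image {x ∈ ({a, b, c, d} : Set V) | x ≠ u}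
    (level p) (Set.toFinite _) ⟨z, hz, hzu⟩
  -- The vertices of the path other than `u` are on the level of `x`.
  have hcases := (D.isModule (level p x + 1)).isP4_cases h
  have hxlt := D.level_lt_level_self hxu
  have hlevel : ∀ v ∈ ({a, b, c, d} : Set V), v ≠ u → level p v = level p x := fun v hv hvu => by
    have := hmin v ⟨hv, hvu⟩
    simp only [Set.mem_ofPred_eq, Set.mem_insert_iff, Set.mem_singleton_iff] at *
    grind
  rw [D.self_adj_iff h2 hzu, hlevel z hz hzu, ← hlevel y hy hadj.ne',
    ← D.self_adj_iff h2 hadj.ne'] at hnadj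
  exact hnadj hadj

theorem exists_level_succ (hx : level p x + 1 < p.length) :
    ∃ y, y ≠ u ∧ level p y = level p x + 1 ∧ (G.Adj u y ↔ ¬ G.Adj u x) := by
  have ne_self : ∀ {y}, level p y < p.length → y ≠ u := fun h e => h.ne (e ▸ D.level_self)
  obtain ⟨y, -, hy⟩ := D.exists_level_eq _ hx
  have hyu : y ≠ u := ne_self (hy ▸ hx)
  refine ⟨y, hyu, hy, ?_⟩
  have hne := D.label_succ_ne _ hx (h2 _)
  have hlx := h2 (level p x)
  have hly := h2 (level p x + 1)
  rw [D.self_adj_iff h2 hyu, D.self_adj_iff h2 (ne_self (Nat.lt_of_succ_lt hx)), hy]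
  cases h : label p (level p x) <;> cases h' : label p (level p x + 1) <;> simp_all

end NoTwo

theorem inSpider (D : IsTreePath G Set.univ u p) (hi : i < p.length) (hl : label p i = .two) :
    InSpider G u := by
  obtain ⟨S, K, R, hs, hSKR, -⟩ := D.exists_isSpider i hi hl
  have hSKR' : S ∪ K ∪ R = {x | i ≤ level p x} := by simpa using hSKR
  refine ⟨S, K, R, hs, hSKR' ▸ D.isModule i, hSKR'.ge ?_⟩
  exact hi.le.trans D.level_self.ge

theorem label_ne_two (D : IsTreePath G Set.univ u p) (hu : ¬ InSpider G u) (i : ℕ) :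
    label p i ≠ .two := fun hl => by
  rcases lt_or_ge i p.length with hi | hi
  · exact hu (D.inSpider hi hl)
  · simp [label_eq_zero_of_length_le hi] at hl

end IsTreePath

section DirectFormations

variable {V : Type*} [Finite V] {G G' : SimpleGraph V} {M P : Set V} {u : V}
  {p : List (NodeLabel × Set V)}

theorem ncard_le_ncard_edgeSet_sdiff (hP : ∀ y ∈ P, ¬ G.Adj u y ∧ G'.Adj u y) :
    P.ncard ≤ (G'.edgeSet \ G.edgeSet).ncard :=
  Set.ncard_le_ncard_of_injOn (fun y => s(u, y)) (fun y hy => ⟨(hP y hy).2, (hP y hy).1⟩)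
    (fun _ _ _ _ => Sym2.congr_right.1) (Set.toFinite _)

theorem IsTreePath.exists_direct_formation (D : IsTreePath G Set.univ u p) (hG : IsP4Sparse G)
    (h2 : ∀ i, label p i ≠ .two) (hGG : G ≤ G') (hM : IsModule G' M) (hu : u ∈ M) :
    ∃ H, IsFormation G u p H ∧ IsCompletion G u H ∧
      fill G u H ≤ (formationFill G' u M).ncard + (G'.edgeSet \ G.edgeSet).ncard := by
  -- Apply the formation at the least level on which `M` contains a `G`-neighbour of `u`.
  suffices hlevel : ∃ i ≤ p.length, (i < p.length → label p i ≠ .zero) ∧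
      formationFill G u {x | i ≤ level p x} ⊆
        formationFill G' u M ∪ {y ∈ M | ¬ G.Adj u y ∧ G'.Adj u y} by
    obtain ⟨i, hi, hl, hsub⟩ := hlevel
    obtain ⟨H, hform, hcompl, hfill⟩ :=
      D.exists_formation_of_level hG hi hl (fun _ => D.inNoP4 h2) hsub
    refine ⟨H, hform, hcompl, hfill.trans ((Set.ncard_union_le _ _).trans ?_)⟩
    exact Nat.add_le_add_left (ncard_le_ncard_edgeSet_sdiff fun y hy => hy.2) _
  by_cases hO : ∃ x ∈ M, G.Adj u x
  · obtain ⟨x, ⟨hxM, hux⟩, hmin⟩ :=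
      Set.exists_min_image {x ∈ M | G.Adj u x} (level p) (Set.toFinite _) hO
    have hxl := (D.self_adj_iff h2 hux.ne').1 hux
    refine ⟨level p x, D.level_le x, fun _ => by simp [hxl], ?_⟩
    rintro y ⟨hyu, hy⟩
    simp only [Set.mem_ofPred_eq] at hy
    have hadj_iff : y ∉ M → (G'.Adj u y ↔ G'.Adj x y) := fun hyM => by
      rw [G'.adj_comm, hM.adj_iff hyM hu hxM, G'.adj_comm]
    have hGG_u : G.Adj u y → G'.Adj u y := fun h => hGG h
    have hGG_x : G.Adj x y → G'.Adj x y := fun h => hGG h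
    have hmin_y : y ∈ M → G.Adj u y → level p x ≤ level p y := fun h h' => hmin y ⟨h, h'⟩
    have hadj : level p x < level p y → G.Adj x y := fun h => D.adj h hxl
    have hlevel : level p x = level p y → G.Adj u y := fun h => (D.self_adj_congr h2 h).1 hux
    simp only [formationFill, Set.mem_union, Set.mem_ofPred_eq]
    grind
  · push Not at hO
    refine ⟨p.length, le_rfl, fun h => absurd h (lt_irrefl _), ?_⟩
    rintro y ⟨hyu, hy⟩
    rw [D.setOf_length_le_level, Set.mem_singleton_iff] at hy
    have huy : G.Adj u y := by tauto
    exact .inl ⟨hyu, fun hyM => absurd huy (hO y hyM), fun h => absurd (hGG huy) h⟩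

end DirectFormations

/-! ### Completions in which `uw` is not a wing -/

section Wings

variable {V : Type*} {G : SimpleGraph V} {M S K R : Set V} {x y : V}
  {p : List (NodeLabel × Set V)}

theorem IsWing.symm (h : IsWing G x y) : IsWing G y x :=
  h.imp fun _ => Exists.imp fun _ => Or.symm

theorem IsP4Sparse.not_isWing_of_forall_adj (hG : IsP4Sparse G) (hM : IsModule G M)
    (hx : x ∈ M) (hy : y ∈ M) (h : ∀ z ∈ M, z ≠ x → z ≠ y → G.Adj x z ∨ G.Adj y z) :
    ¬ IsWing G x y := by
  rintro ⟨c, d, hp | hp⟩ <;>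
  · have hne := hp.pairwise_ne
    have hd := (hG.isP4_module_all_or_none hM ⟨x, hx, y, hy, by tauto⟩ hp).elim
      (fun hin => hin.2.2.2) (fun hout => by tauto)
    have := h d hd
    simp only [IsP4] at hp
    tauto

theorem IsTreePath.adj_or_adj_of_label_one (D : IsTreePath G Set.univ x p)
    (hl : label p (level p y) = .one) :
    ∀ z ∈ {z | level p y ≤ level p z}, z ≠ x → G.Adj x z ∨ G.Adj y z := by
  intro z hz hzx
  rcases (show level p y ≤ level p z from hz).lt_or_eq with hlt | heq
  · exact .inr (D.adj hlt hl)
  · exact .inl (D.adj (D.level_lt_level_self hzx) (heq ▸ hl)).symm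

namespace IsMatchedSpider

variable {thick : Prop} {f g : V → V} {k s z : V}

theorem adj_body (h : IsMatchedSpider G thick S K R f g) (hk : k ∈ K) (hz : z ∈ K ∪ R)
    (hzk : z ≠ k) : G.Adj z k :=
  hz.elim (fun hz => h.clique z hz k hk hzk) (fun hz => h.adj_head_body z hz k hk)

theorem mem_body_of_adj_leg (h : IsMatchedSpider G thick S K R f g) (hs : s ∈ S)
    (hz : z ∈ S ∪ K ∪ R) (hzs : G.Adj z s) : z ∈ K := by
  rcases hz with (hz | hz) | hz
  · exact absurd hzs (h.indep z hz s hs)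
  · exact hz
  · exact absurd hzs (h.not_adj_head_leg z hz s hs)

theorem mem_leg_of_not_adj_body (h : IsMatchedSpider G thick S K R f g) (hk : k ∈ K)
    (hz : z ∈ S ∪ K ∪ R) (hzk : z ≠ k) (hadj : ¬ G.Adj z k) : z ∈ S := by
  rw [Set.union_assoc] at hz
  exact hz.resolve_right fun hz => hadj (h.adj_body hk hz hzk)

theorem not_isWing_of_body (h : IsMatchedSpider G thick S K R f g) (hG : IsP4Sparse G)
    (hM : IsModule G (S ∪ K ∪ R)) (hx : x ∈ K) (hy : y ∈ K ∪ R) : ¬ IsWing G x y := by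
  have hxM : x ∈ S ∪ K ∪ R := .inl (.inr hx)
  have hyM : y ∈ S ∪ K ∪ R := Set.union_assoc S K R ▸ .inr hy
  rintro ⟨c, d, hp | hp⟩ <;>
  · have hne := hp.pairwise_ne
    have hin := (hG.isP4_module_all_or_none hM ⟨x, hxM, y, hyM, by tauto⟩ hp).resolve_right
      (by tauto)
    obtain ⟨hab, hbc, hcd, hac, had, hbd⟩ := hp
    have hd : d ∈ S := h.mem_leg_of_not_adj_body hx hin.2.2.2 (by tauto)
      (by rw [G.adj_comm]; assumption)
    have hc : c ∈ K := h.mem_body_of_adj_leg hd hin.2.2.1 hcd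
    have hcy : G.Adj y c := h.adj_body hc hy (by tauto)
    have hcx : G.Adj x c := h.adj_body hc (.inl hx) (by tauto)
    tauto

end IsMatchedSpider

theorem IsTreePath.exists_spider_of_label_two (D : IsTreePath G Set.univ x p) (hxy : G.Adj x y)
    (hl : label p (level p y) = .two) :
    ∃ S K R, IsSpider G S K R ∧ S ∪ K ∪ R = {z | level p y ≤ level p z} ∧
      ((x ∈ S ∧ y ∈ K) ∨ (x ∈ K ∧ y ∈ S) ∨
        (x ∈ K ∪ R ∧ y ∈ K ∪ R ∧ (x ∈ K ∨ y ∈ K))) := by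
  have hlt := D.level_lt hxy.ne'
  obtain ⟨S, K, R, hs, hSKR, hR⟩ := D.exists_isSpider _ hlt hl
  obtain ⟨thick, f, g, h⟩ := hs.exists_isMatchedSpider
  have hx : x ∈ S ∪ K ∪ R := hSKR.ge ⟨trivial, by rw [D.level_self]; exact hlt.le⟩
  have hy : y ∈ S ∪ K ∪ R := hSKR.ge ⟨trivial, le_rfl⟩
  refine ⟨S, K, R, hs, by simpa using hSKR, ?_⟩
  have hxyR : x ∈ R → y ∉ R := by
    intro hxR hyR
    rcases hR with ⟨-, hxS | hxK⟩ | rfl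
    · exact h.leg_notMem_head x hxS hxR
    · exact h.body_notMem_head x hxK hxR
    · exact lt_irrefl _ hyR.2
  rw [Set.union_assoc] at hx hy
  rcases hx with hxS | hx
  · exact .inl ⟨hxS, h.mem_body_of_adj_leg hxS (Set.union_assoc S K R ▸ hy) hxy.symm⟩
  rcases hy with hyS | hy
  · exact .inr (.inl ⟨h.mem_body_of_adj_leg hyS (Set.union_assoc S K R ▸ .inr hx) hxy, hyS⟩)
  · exact .inr (.inr ⟨hx, hy, hx.imp_right fun hxR => hy.resolve_right (hxyR hxR)⟩)

theorem IsSpider.ncard_nonNbr_legs_le [Finite V] (h : IsSpider G S K R) (hx : x ∈ K) :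
    {s ∈ S | ¬ G.Adj s x ∧ ¬ G.Adj s y}.ncard ≤ (K \ {x, y}).ncard := by
  rcases h with ⟨-, -, f, hf, hadj⟩ | ⟨-, hK, f, hf, hadj⟩
  · refine Set.ncard_le_ncard_of_injOn f ?_ (hf.injOn.mono fun s hs => hs.1)
    rintro s ⟨hs, hsx, hsy⟩
    have hfs : G.Adj s (f s) := (hadj s hs _ (hf.mapsTo hs)).2 rfl
    refine ⟨hf.mapsTo hs, ?_⟩
    rintro (e | e)
    exacts [hsx (e ▸ hfs), hsy (e ▸ hfs)]
  · have hle : {s ∈ S | ¬ G.Adj s x ∧ ¬ G.Adj s y}.ncard ≤ 1 := by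
      refine (Set.ncard_le_one (Set.toFinite _)).2 fun s hs t ht => hf.injOn hs.1 ht.1 ?_
      have hfx : ∀ s ∈ S, ¬ G.Adj s x → f s = x := fun s hs hsx =>
        (not_not.1 (mt (hadj s hs x hx).2 hsx)).symm
      rw [hfx s hs.1 hs.2.1, hfx t ht.1 ht.2.1]
    have := Set.le_ncard_sdiff {x, y} K
    have : ({x, y} : Set V).ncard ≤ 2 := (Set.ncard_insert_le _ _).trans (by simp)
    omega

end Wings

section TailModules

variable {V : Type*} {H : SimpleGraph (Option V)} {u : V} {M S K R : Set (Option V)}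
  {thick : Prop} {f g : Option V → Option V}

theorem inNoP4_of_preimage_eq_singleton (hH : IsP4Sparse H) (hM : IsModule H M) (hu : some u ∈ M)
    (hw : none ∈ M) (hMu : some ⁻¹' M = {u}) : InNoP4 (H.comap some) u := by
  intro a b c d hp hmem
  have hin := (hH.isP4_module_all_or_none hM ⟨_, hu, _, hw, Option.some_ne_none u⟩
    (show IsP4 H (some a) (some b) (some c) (some d) from hp)).resolve_right (by grind)
  have heq : ∀ {z}, some z ∈ M → z = u := fun hz => hMu.le hz
  exact hp.pairwise_ne.1 ((heq hin.1).trans (heq hin.2.1).symm)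

theorem mem_of_mem_formationFill (hM : IsModule H M) (hu : some u ∈ M) (hw : none ∈ M) {y : V}
    (hy : y ∈ formationFill (H.comap some) u (some ⁻¹' M)) (hwy : ¬ H.Adj none (some y)) :
    some y ∈ M ∧ ¬ H.Adj (some u) (some y) := by
  have hyM : some y ∈ M := by
    by_contra hyM
    have huy : H.Adj (some u) (some y) := not_not.1 fun h => hyM (hy.2.2 h)
    exact hwy ((hM.adj_iff hyM hu hw).1 huy.symm).symm
  exact ⟨hyM, hy.2.1 hyM⟩

theorem formationFill_subset_tailNbrs (hM : IsModule H M) (hu : some u ∈ M) (hw : none ∈ M)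
    (h : ∀ z ∈ M, z ≠ some u → z ≠ none → H.Adj (some u) z ∨ H.Adj none z) :
    formationFill (H.comap some) u (some ⁻¹' M) ⊆ tailNbrs H u := by
  refine fun y hy => ⟨hy.1, ?_⟩
  by_contra hwy
  obtain ⟨hyM, huy⟩ := mem_of_mem_formationFill hM hu hw hy hwy
  exact (h _ hyM (by simpa using hy.1) (by simp)).elim huy hwy

theorem IsMatchedSpider.formationFill_subset (h : IsMatchedSpider H thick S K R f g)
    (hM : IsModule H (S ∪ K ∪ R)) (hu : some u ∈ K ∪ R) (hw : none ∈ K ∪ R)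
    (huw : some u ∈ K ∨ none ∈ K) :
    formationFill (H.comap some) u (some ⁻¹' (S ∪ K ∪ R)) ⊆
      tailNbrs H u \ some ⁻¹' (K \ {some u, none}) ∪
        some ⁻¹' {s ∈ S | ¬ H.Adj s (some u) ∧ ¬ H.Adj s none} := by
  intro y hy
  have hyu : some y ≠ some u := by simpa using hy.1
  by_cases hwy : H.Adj none (some y)
  · refine .inl ⟨⟨hy.1, hwy⟩, fun hyB => ?_⟩
    exact hy.2.1 (.inl (.inr hyB.1)) (h.adj_body hyB.1 hu hyu.symm)
  · have huM : some u ∈ S ∪ K ∪ R := Set.union_assoc S K R ▸ .inr hu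
    have hwM : none ∈ S ∪ K ∪ R := Set.union_assoc S K R ▸ .inr hw
    obtain ⟨hyM, huy⟩ := mem_of_mem_formationFill hM huM hwM hy hwy
    rw [H.adj_comm] at huy hwy
    refine .inr ⟨?_, huy, hwy⟩
    exact huw.elim (fun hK => h.mem_leg_of_not_adj_body hK hyM hyu huy)
      (fun hK => h.mem_leg_of_not_adj_body hK hyM (by simp) hwy)

theorem IsSpider.ncard_formationFill_le [Finite V] (h : IsSpider H S K R)
    (hM : IsModule H (S ∪ K ∪ R)) (hu : some u ∈ K ∪ R) (hw : none ∈ K ∪ R)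
    (huw : some u ∈ K ∨ none ∈ K) :
    (formationFill (H.comap some) u (some ⁻¹' (S ∪ K ∪ R))).ncard ≤ (tailNbrs H u).ncard := by
  obtain ⟨thick, f, g, hsp⟩ := h.exists_isMatchedSpider
  set L := {s ∈ S | ¬ H.Adj s (some u) ∧ ¬ H.Adj s none} with hL
  set B := K \ {some u, none} with hB
  have hLB : (some ⁻¹' L : Set V).ncard ≤ (some ⁻¹' B : Set V).ncard := by
    have hsome : ∀ {X : Set (Option V)}, none ∉ X → (some ⁻¹' X : Set V).ncard = X.ncard :=
      fun hX => Set.ncard_preimage_of_injective_subset_range (Option.some_injective V) fun x hx =>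
        Option.ne_none_iff_exists.1 fun e => hX (e ▸ hx)
    have hwL : none ∉ L := fun hwL =>
      hw.elim (hsp.leg_notMem_body _ hwL.1) (hsp.leg_notMem_head _ hwL.1)
    rw [hsome hwL, hsome (by simp [hB])]
    rcases huw with hK | hK
    · exact h.ncard_nonNbr_legs_le hK
    · rw [hL, hB, Set.pair_comm]
      simpa only [and_comm] using h.ncard_nonNbr_legs_le (y := some u) hK
  have hBtail : some ⁻¹' B ⊆ tailNbrs H u := fun y hy =>
    ⟨fun e => hy.2 (.inl (congrArg some e)), hsp.adj_body hy.1 hw (by simp)⟩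
  have hle : _ ≤ (tailNbrs H u \ some ⁻¹' B ∪ some ⁻¹' L).ncard :=
    Set.ncard_le_ncard (hsp.formationFill_subset hM hu hw huw)
  have := Set.ncard_sdiff_add_ncard_of_subset hBtail
  have := Set.ncard_union_le (tailNbrs H u \ some ⁻¹' B) (some ⁻¹' L)
  omega

end TailModules

section Completions

variable {V : Type*} {G : SimpleGraph V} {H : SimpleGraph (Option V)} {u : V}
  {p : List (NodeLabel × Set V)}

theorem IsP4Sparse.exists_isTreePath [Finite V] (hG : IsP4Sparse G) (u : V) :
    ∃ T p, IsP4SparseTree G T ∧ IsPath T u p ∧ IsTreePath G Set.univ u p := by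
  have : Nonempty V := ⟨u⟩
  obtain ⟨T, hT⟩ := hG.exists_isP4SparseTree
  obtain ⟨p, hp⟩ := exists_isPath T (hT.2 ▸ Set.mem_univ u)
  exact ⟨T, p, hT, hp, hT.isTreePath hp⟩

theorem IsP4Sparse.exists_module_or_spider [Finite V] (hH : IsP4Sparse H)
    (huw : H.Adj (some u) none) :
    (¬ IsWing H (some u) none ∧
      ∃ M, IsModule (H.comap some) M ∧ u ∈ M ∧ (M = {u} → InNoP4 (H.comap some) u) ∧
        (formationFill (H.comap some) u M).ncard ≤ (tailNbrs H u).ncard) ∨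
    ∃ S K R, IsSpider H S K R ∧ IsModule H (S ∪ K ∪ R) ∧
      ((some u ∈ S ∧ none ∈ K) ∨ (some u ∈ K ∧ none ∈ S)) := by
  obtain ⟨-, p, -, -, D⟩ := hH.exists_isTreePath (some u)
  have hlt := D.level_lt_level_self huw.ne'
  have hM := D.isModule (level p none)
  have hu : some u ∈ {x | level p none ≤ level p x} := hlt.le
  have hw : none ∈ {x | level p none ≤ level p x} := le_refl (level p none)
  rcases hl : label p (level p none) with _ | _ | _
  · exact absurd huw.symm (D.not_adj hlt hl)
  · have hadj := fun z hz hzx (_ : z ≠ none) => D.adj_or_adj_of_label_one hl z hz hzx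
    exact .inl ⟨hH.not_isWing_of_forall_adj hM hu hw hadj, _, hM.comap some, hu,
      inNoP4_of_preimage_eq_singleton hH hM hu hw,
      Set.ncard_le_ncard (formationFill_subset_tailNbrs hM hu hw hadj)⟩
  · obtain ⟨S, K, R, hs, hSKR, hcase⟩ := D.exists_spider_of_label_two huw hl
    rw [← hSKR] at hM hu hw
    rcases hcase with h | h | ⟨huKR, hwKR, hK⟩
    · exact .inr ⟨S, K, R, hs, hM, .inl h⟩
    · exact .inr ⟨S, K, R, hs, hM, .inr h⟩
    · obtain ⟨_, f, g, h⟩ := hs.exists_isMatchedSpider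
      refine .inl ⟨?_, _, hM.comap some, hu, inNoP4_of_preimage_eq_singleton hH hM hu hw,
        hs.ncard_formationFill_le hM huKR hwKR hK⟩
      exact hK.elim (fun huK => h.not_isWing_of_body hH hM huK hwKR)
        fun hwK hwing => h.not_isWing_of_body hH hM hwK huKR hwing.symm

theorem IsCompletion.le_comap (hH : IsCompletion G u H) : G ≤ H.comap some :=
  (addTail_le_iff.1 hH.1).1

theorem IsCompletion.adj_tail (hH : IsCompletion G u H) : H.Adj none (some u) :=
  (addTail_le_iff.1 hH.1).2

theorem IsCompletion.exists_spider_of_isWing [Finite V] (hH : IsCompletion G u H)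
    (hw : IsWing H (some u) none) :
    ∃ S K R, IsSpider H S K R ∧ IsModule H (S ∪ K ∪ R) ∧
      ((some u ∈ S ∧ none ∈ K) ∨ (some u ∈ K ∧ none ∈ S)) :=
  (hH.2.exists_module_or_spider hH.adj_tail.symm).resolve_left fun h => h.1 hw

theorem IsCompletion.exists_module_of_not_isWing [Finite V] (hH : IsCompletion G u H)
    (hw : ¬ IsWing H (some u) none) :
    ∃ M, IsModule (H.comap some) M ∧ u ∈ M ∧ (M = {u} → InNoP4 (H.comap some) u) ∧
      (formationFill (H.comap some) u M).ncard ≤ (tailNbrs H u).ncard := by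
  rcases hH.2.exists_module_or_spider hH.adj_tail.symm with h | ⟨S, K, R, hs, -, hmem⟩
  · exact h.2
  · obtain ⟨_, f, g, h⟩ := hs.exists_isMatchedSpider
    exact absurd (h.isWing hH.adj_tail.symm hmem) hw

theorem IsCompletion.exists_usesFormation [Finite V] (hH : IsCompletion G u H)
    (hw : ¬ IsWing H (some u) none) :
    ∃ H', IsCompletion G u H' ∧ UsesFormation G u H' ∧ fill G u H' ≤ fill G u H := by
  obtain ⟨M, hM, hu, hMu, hle⟩ := hH.exists_module_of_not_isWing hw
  have hG' : IsP4Sparse (H.comap some) := hH.2.comap (Option.some_injective V)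
  obtain ⟨T, p, hT, hp, D⟩ := hG'.exists_isTreePath u
  obtain ⟨H', hform, hH', hfill⟩ := D.exists_formation hG' hM hu hMu
  refine ⟨H', ⟨addTail_le_iff.2 ⟨hH.le_comap.trans hH'.le_comap, hH'.adj_tail⟩, hH'.2⟩,
    ⟨_, T, p, hH.le_comap, hG', hT, hp, hform⟩, ?_⟩
  rw [fill_eq_add hH.le_comap hH'.1, fill_eq (H := H)]
  omega

theorem IsCompletion.exists_isFormation [Finite V] (hH : IsCompletion G u H)
    (hG : IsP4Sparse G) (D : IsTreePath G Set.univ u p) (h2 : ∀ i, label p i ≠ .two)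
    (hw : ¬ IsWing H (some u) none) :
    ∃ H', IsCompletion G u H' ∧ IsFormation G u p H' ∧ fill G u H' ≤ fill G u H := by
  obtain ⟨M, hM, hu, -, hle⟩ := hH.exists_module_of_not_isWing hw
  obtain ⟨H', hform, hH', hfill⟩ := D.exists_direct_formation hG h2 hH.le_comap hM hu
  refine ⟨H', hH', hform, hfill.trans ?_⟩
  rw [fill_eq]
  omega

theorem IsFormation.not_isWing (D : IsTreePath G Set.univ u p) (h : IsFormation G u p H) :
    ¬ IsWing H (some u) none := by
  rcases h with rfl | ⟨i, c, W, hi, -, rfl⟩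
  · refine not_isWing_formationGraph ?_
    rw [insert_empty_eq, ← D.setOf_length_le_level]
    exact D.isModule p.length
  · refine not_isWing_formationGraph ?_
    rw [D.insert_lower (List.getElem?_eq_some_iff.1 hi).1.le]
    exact D.isModule i

theorem UsesFormation.not_isWing (h : UsesFormation G u H) : ¬ IsWing H (some u) none := by
  obtain ⟨G', T, p, -, -, hT, hp, h⟩ := h
  exact h.not_isWing (hT.isTreePath hp)

theorem isCompletion_top : IsCompletion G u ⊤ :=
  ⟨le_top, isP4Sparse_iff.2 fun _ _ _ _ _ _ _ _ _ _ h => absurd h.pairwise_ne.2.1 h.2.2.2.1⟩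

theorem exists_isMinCompletion (G : SimpleGraph V) (u : V) : ∃ H, IsMinCompletion G u H := by
  obtain ⟨H, hH, hmin⟩ := exists_minimalFor_of_wellFoundedLT (IsCompletion G u) (fill G u)
    ⟨⊤, isCompletion_top⟩
  exact ⟨H, hH, fun H' hH' => (le_total _ _).elim id fun h => hmin hH' h⟩

end Completions

/-! ### Completions in which `uw` is a wing -/

section TailModule

variable {V : Type*} (G : SimpleGraph V) (u : V) (p : List (NodeLabel × Set V))
  (H : SimpleGraph (Option V)) (N : Set (Option V))

/-- A module `N` of a minimum completion `H` of `G + uw` with `u, w ∈ N`, where `p` is a tree path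
to `u` in `G` without 2-nodes. The comparison of `H` with the formations takes place on such
modules. -/
structure IsTailModule : Prop where
  isP4Sparse : IsP4Sparse G
  path : IsTreePath G Set.univ u p
  label_ne_two : ∀ i, label p i ≠ .two
  isMin : IsMinCompletion G u H
  isModule : IsModule H N
  self_mem : some u ∈ N
  tail_mem : none ∈ N

/-- The neighbours of `u` in `H` outside the module `N`; the tail sees them too. -/
def outerNbrs : Set V := {y | some y ∉ N ∧ H.Adj (some u) (some y)}

/-- The neighbours of the tail in `H` inside the module `N`, without `u`: the ends of the fill edges
at the tail that a change inside `N` can save. -/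
def innerTailNbrs : Set V := {y ∈ tailNbrs H u | some y ∈ N}

/-- The fill edges of `H` within `V` that do not join `u` to a vertex of `N` below level `k`: those
that the formation at level `k` has no counterpart for. -/
def otherFill (k : ℕ) : Set (Sym2 V) :=
  {e ∈ (H.comap some).edgeSet \ G.edgeSet | ∀ y, some y ∈ N → k < level p y → e ≠ s(u, y)}

end TailModule

theorem IsTreePath.adj_of_mem_formationFill {V : Type*} {G : SimpleGraph V} {u x y : V}
    {p : List (NodeLabel × Set V)} (D : IsTreePath G Set.univ u p) (h2 : ∀ i, label p i ≠ .two)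
    (hx : G.Adj u x) (hy : y ∈ formationFill G u {y | level p x ≤ level p y}) : G.Adj x y := by
  by_cases huy : G.Adj u y
  · exact (D.adj_of_self_adj h2 huy (not_le.1 fun hle => hy.2.1 hle huy)).symm
  · exact D.adj_of_self_adj h2 hx (lt_of_le_of_ne (hy.2.2 huy) fun e =>
      huy ((D.self_adj_congr h2 e).1 hx))

section OtherFill

variable {V : Type*} {G : SimpleGraph V} {u a b : V} {p : List (NodeLabel × Set V)}
  {H : SimpleGraph (Option V)} {N : Set (Option V)} {k : ℕ}

theorem mem_otherFill (hH : H.Adj (some a) (some b)) (hG : ¬ G.Adj a b) (hb : b ≠ u)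
    (ha : a ≠ u ∨ some b ∉ N ∨ level p b ≤ k) : s(a, b) ∈ otherFill G u p H N k := by
  refine ⟨⟨hH, hG⟩, fun y hy hk he => ?_⟩
  rcases Sym2.eq_iff.1 he with ⟨rfl, rfl⟩ | ⟨-, rfl⟩
  · exact ha.elim (· rfl) (·.elim (· hy) hk.not_ge)
  · exact hb rfl

theorem adj_of_otherFill_eq_empty (h : otherFill G u p H N k = ∅)
    (hH : H.Adj (some a) (some b)) (hb : b ≠ u) (ha : a ≠ u ∨ some b ∉ N ∨ level p b ≤ k) :
    G.Adj a b :=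
  by_contra fun hG => Set.notMem_empty _ (h ▸ mem_otherFill hH hG hb ha)

end OtherFill

namespace IsTailModule

variable {V : Type*} {G : SimpleGraph V} {u x y : V} {p : List (NodeLabel × Set V)}
  {H : SimpleGraph (Option V)} {N : Set (Option V)} {P : Set V}

theorem adj (h : IsTailModule G u p H N) (hxy : G.Adj x y) : H.Adj (some x) (some y) :=
  h.isMin.1.le_comap hxy

theorem fill_eq [Finite V] (h : IsTailModule G u p H N) :
    fill G u H = (outerNbrs u H N).ncard + (innerTailNbrs u H N).ncard +
      ((H.comap some).edgeSet \ G.edgeSet).ncard := by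
  have hT : tailNbrs H u = outerNbrs u H N ∪ innerTailNbrs u H N := by
    ext y
    by_cases hy : some y ∈ N
    · simp [outerNbrs, innerTailNbrs, hy]
    · have hyu : y ≠ u := fun e => hy (e ▸ h.self_mem)
      have := h.isModule.adj_iff hy h.self_mem h.tail_mem
      simp [outerNbrs, innerTailNbrs, tailNbrs, hy, hyu, H.adj_comm _ (some y), this]
  rw [P4Completion.fill_eq, hT, Set.ncard_union_eq]
  exact Set.disjoint_left.2 fun y hy hy' => hy.1 hy'.2

theorem fill_le_of_adj [Finite V] (h : IsTailModule G u p H N) (hx : G.Adj u x) :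
    fill G u H ≤ (formationFill G u {y | level p x ≤ level p y}).ncard := by
  have hl := (h.path.self_adj_iff h.label_ne_two hx.ne').1 hx
  have hlt := h.path.level_lt hx.ne'
  obtain ⟨H', -, hH', hle⟩ := h.path.exists_formation_of_level h.isP4Sparse (h.path.level_le x)
    (by simp [hl]) (fun e => absurd e hlt.ne) subset_rfl
  exact (h.isMin.2 H' hH').trans hle

theorem fill_le_degree [Finite V] (h : IsTailModule G u p H N) :
    fill G u H ≤ (G.neighborSet u).ncard := by
  obtain ⟨H', -, hH', hle⟩ := h.path.exists_formation_of_level (P := G.neighborSet u) h.isP4Sparse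
    le_rfl (fun e => absurd e (lt_irrefl _)) (fun _ => h.path.inNoP4 h.label_ne_two) <| by
      rintro y ⟨hyu, hy⟩
      exact by_contra fun huy => hyu (h.path.eq_self (hy.2 huy))
  exact (h.isMin.2 H' hH').trans hle

theorem excess_le [Finite V] (h : IsTailModule G u p H N) (hfill : fill G u H ≤ P.ncard)
    (hP : ∀ y ∈ P, some y ∉ N → H.Adj (some u) (some y)) :
    (innerTailNbrs u H N).ncard + ((H.comap some).edgeSet \ G.edgeSet).ncard +
      (outerNbrs u H N \ P).ncard ≤ {y ∈ P | some y ∈ N}.ncard := by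
  have hsub : P ⊆ outerNbrs u H N ∩ P ∪ {y ∈ P | some y ∈ N} := fun y hy =>
    (em (some y ∈ N)).elim (fun hyN => .inr ⟨hy, hyN⟩) fun hyN => .inl ⟨⟨hyN, hP y hy hyN⟩, hy⟩
  have := (Set.ncard_le_ncard hsub).trans (Set.ncard_union_le _ _)
  have := Set.ncard_inter_add_ncard_sdiff_eq_ncard (outerNbrs u H N) P
  have := h.fill_eq
  omega

theorem excess_le_of_adj [Finite V] (h : IsTailModule G u p H N) (hx : G.Adj u x)
    (hxN : some x ∈ N) :
    (innerTailNbrs u H N).ncard + ((H.comap some).edgeSet \ G.edgeSet).ncard +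
      (outerNbrs u H N \ formationFill G u {y | level p x ≤ level p y}).ncard ≤
        {y ∈ formationFill G u {y | level p x ≤ level p y} | some y ∈ N}.ncard :=
  h.excess_le (h.fill_le_of_adj hx) fun _ hy hyN => ((h.isModule.adj_iff hyN hxN h.self_mem).1
    (h.adj (h.path.adj_of_mem_formationFill h.label_ne_two hx hy)).symm).symm

theorem excess_le_degree [Finite V] (h : IsTailModule G u p H N) :
    (innerTailNbrs u H N).ncard + ((H.comap some).edgeSet \ G.edgeSet).ncard +
      (outerNbrs u H N \ G.neighborSet u).ncard ≤ {y ∈ G.neighborSet u | some y ∈ N}.ncard :=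
  h.excess_le h.fill_le_degree fun _ hy _ => h.adj hy

theorem otherFill_excess_le [Finite V] (h : IsTailModule G u p H N) (hx : G.Adj u x)
    (hxN : some x ∈ N) (hmin : ∀ y, some y ∈ N → G.Adj u y → level p x ≤ level p y) :
    (innerTailNbrs u H N).ncard + (otherFill G u p H N (level p x)).ncard +
      (outerNbrs u H N \ formationFill G u {y | level p x ≤ level p y}).ncard ≤
        {y | some y ∈ N ∧ y ≠ u ∧ level p x < level p y ∧ ¬ H.Adj (some u) (some y)}.ncard := by
  set low := {y | some y ∈ N ∧ y ≠ u ∧ level p x < level p y ∧ ¬ H.Adj (some u) (some y)}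
  set lowFill := {y | some y ∈ N ∧ level p x < level p y ∧ ¬ G.Adj u y ∧ H.Adj (some u) (some y)}
  have hfill : lowFill.ncard + (otherFill G u p H N (level p x)).ncard ≤
      ((H.comap some).edgeSet \ G.edgeSet).ncard := by
    rw [← Set.ncard_image_of_injective lowFill fun _ _ => Sym2.congr_right.1,
      ← Set.ncard_union_eq]
    · refine Set.ncard_le_ncard (Set.union_subset ?_ fun e he => he.1)
      rintro _ ⟨y, hy, rfl⟩
      exact ⟨hy.2.2.2, hy.2.2.1⟩
    · rw [Set.disjoint_left]
      rintro _ ⟨y, hy, rfl⟩ he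
      exact he.2 y hy.1 hy.2.1 rfl
  have hsub : {y ∈ formationFill G u {y | level p x ≤ level p y} | some y ∈ N} ⊆
      low ∪ lowFill := by
    rintro y ⟨⟨hyu, hy⟩, hyN⟩
    have huy : ¬ G.Adj u y := fun huy => hy.1 (hmin y hyN huy) huy
    have hxy : level p x < level p y := lt_of_le_of_ne (hy.2 huy) fun e =>
      huy ((h.path.self_adj_congr h.label_ne_two e).1 hx)
    by_cases hHy : H.Adj (some u) (some y)
    · exact .inr ⟨hyN, hxy, huy, hHy⟩
    · exact .inl ⟨hyN, hyu, hxy, hHy⟩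
  have := (Set.ncard_le_ncard hsub).trans (Set.ncard_union_le _ _)
  have := h.excess_le_of_adj hx hxN
  omega

theorem exists_adj_mem [Finite V] (h : IsTailModule G u p H N)
    (hN : (innerTailNbrs u H N).Nonempty ∨ ∃ y, some y ∈ N ∧ H.Adj (some u) (some y)) :
    ∃ x, some x ∈ N ∧ G.Adj u x ∧
      ∀ y, some y ∈ N → G.Adj u y → level p x ≤ level p y := by
  obtain ⟨x, ⟨hx, hxN⟩, hmin⟩ :=
      Set.exists_min_image {x ∈ G.neighborSet u | some x ∈ N} (level p) (Set.toFinite _) <| by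
    by_contra hne
    have hle := h.excess_le_degree
    rw [Set.not_nonempty_iff_eq_empty.1 hne, Set.ncard_empty] at hle
    obtain hT | ⟨y, hyN, huy⟩ := hN
    · have := (Set.ncard_pos (Set.toFinite _)).2 hT
      omega
    · have : s(u, y) ∈ (H.comap some).edgeSet \ G.edgeSet := ⟨huy, fun e => hne ⟨y, e, hyN⟩⟩
      have := (Set.ncard_pos (Set.toFinite _)).2 ⟨_, this⟩
      omega
  exact ⟨x, hxN, hx, fun y hyN hy => hmin y ⟨hy, hyN⟩⟩

end IsTailModule

section SpiderOfWing

variable {V : Type*} [Finite V] {G : SimpleGraph V} {u : V} {p : List (NodeLabel × Set V)}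
  {H : SimpleGraph (Option V)} {S K R : Set (Option V)} {f g : Option V → Option V} {thick : Prop}

theorem IsTailModule.not_thick_of_tail_mem_body (h : IsTailModule G u p H (S ∪ K ∪ R))
    (hs : IsMatchedSpider H True S K R f g) (hu : some u ∈ S) (hw : none ∈ K) {x : V}
    (hx : G.Adj u x) (hxK : some x ∈ K) : False := by
  have hux := (hs.adj_thick hu hxK).1 (h.adj hx)
  obtain ⟨x', hx'⟩ : ∃ x', g (some x) = some x' := Option.ne_none_iff_exists'.1 fun e =>
    hs.leg_notMem_body _ (e ▸ hs.g_mem _ hxK) hw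
  obtain ⟨z, hz⟩ : ∃ z, g none = some z := Option.ne_none_iff_exists'.1 fun e =>
    hs.leg_notMem_body _ (e ▸ hs.g_mem _ hw) hw
  have hx'S : some x' ∈ S := hx' ▸ hs.g_mem _ hxK
  have hfx' : f (some x') = some x := hx' ▸ hs.f_g _ hxK
  have hle := h.excess_le_of_adj hx (.inl (.inr hxK))
  set T := innerTailNbrs u H (S ∪ K ∪ R)
  set F := {y ∈ formationFill G u {y | level p x ≤ level p y} | some y ∈ S ∪ K ∪ R}
  have hsub : ({x, x'} : Set V) ⊆ T := by
    rintro y (rfl | rfl)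
    · exact ⟨⟨hx.ne', hs.clique _ hw _ hxK (Option.some_ne_none _).symm⟩, .inl (.inr hxK)⟩
    · refine ⟨⟨fun e => hux (e ▸ hfx').symm, ((hs.adj_thick hx'S hw).2 ?_).symm⟩,
        .inl (.inl hx'S)⟩
      simp [hfx']
  have hF : F ⊆ insert z (T \ {x, x'}) := by
    rintro y ⟨hy, hyN⟩
    have hxy := h.adj (h.path.adj_of_mem_formationFill h.label_ne_two hx hy)
    refine or_iff_not_imp_left.2 fun hyz => ⟨⟨⟨hy.1, ?_⟩, hyN⟩, ?_⟩
    · refine by_contra fun hwy => hyz ?_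
      have hyS := hs.mem_leg_of_not_adj_body hw hyN (Option.some_ne_none y) (hwy ·.symm)
      have hfy := not_not.1 (mt (hs.adj_thick hyS hw).2 (hwy ·.symm))
      exact Option.some_injective _ (by rw [← hz, hfy, hs.g_f _ hyS])
    · rintro (rfl | rfl)
      · exact hxy.ne rfl
      · exact (hs.adj_thick hx'S hxK).1 hxy.symm hfx'.symm
  have := (Set.ncard_le_ncard hF).trans (Set.ncard_insert_le _ _)
  have := Set.ncard_sdiff_add_ncard_of_subset hsub
  have hne : x ≠ x' := fun e => hs.leg_notMem_body _ hx'S (e ▸ hxK)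
  rw [Set.ncard_pair hne] at this
  omega

theorem IsTailModule.tail_notMem_body (h : IsTailModule G u p H (S ∪ K ∪ R))
    (hs : IsMatchedSpider H thick S K R f g) (hu : some u ∈ S) : none ∉ K := by
  intro hw
  obtain ⟨k, hk, hkw⟩ := hs.exists_body_ne none
  obtain ⟨y, rfl⟩ := Option.ne_none_iff_exists'.1 hkw
  have hy : y ∈ innerTailNbrs u H (S ∪ K ∪ R) := ⟨⟨fun e => hs.leg_notMem_body _ hu (e ▸ hk),
    hs.clique _ hw _ hk hkw.symm⟩, .inl (.inr hk)⟩
  obtain ⟨x, hxN, hx, -⟩ := h.exists_adj_mem (.inl ⟨y, hy⟩)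
  have hxK : some x ∈ K := hs.mem_body_of_adj_leg hu hxN (h.adj hx).symm
  rcases hs.thin_or_thick with hs | hs
  · have hxf := (hs.adj_thin hu hxK).1 (h.adj hx)
    have hwf := (hs.adj_thin hu hw).1 h.isMin.1.adj_tail.symm
    simp [← hwf] at hxf
  · exact h.not_thick_of_tail_mem_body hs hu hw hx hxK

end SpiderOfWing

section Rewiring

variable {V : Type*} {H : SimpleGraph V} {R X : Set V} {a b k s t u v w x y : V} {f g : V → V}

theorem IsP4SparseOn.of_two_legs (hX : IsP4SparseOn H (X \ {w, u, a, b})) (hua : u ≠ a)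
    (hw : ∀ x ∈ X, (H.Adj x w ↔ x = u)) (hb : ∀ x ∈ X, (H.Adj x b ↔ x = a))
    (hu : ∀ x ∈ X, x ≠ u → (H.Adj x u ↔ x ≠ b)) (ha : ∀ x ∈ X, x ≠ a → (H.Adj x a ↔ x ≠ w)) :
    IsP4SparseOn H X := by
  have mid : ∀ x ∈ X, ∀ y ∈ X, ∀ z ∈ X, ∀ t ∈ X, IsP4 H x y z t → x ≠ u ∧ x ≠ a ∧
      (y = u ∨ y = a → (x = w ∧ y = u ∧ z = a ∧ t = b) ∨ (x = b ∧ y = a ∧ z = u ∧ t = w)) := by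
    intro x hx y hy z hz t ht h
    have := h.pairwise_ne
    simp only [IsP4] at h
    grind [SimpleGraph.adj_comm]
  intro x hx y hy z hz t ht e he hP hex hey hez het
  obtain ⟨hxu, hxa, hy'⟩ := mid x hx y hy z hz t ht hP
  obtain ⟨htu, hta, hz'⟩ := mid t ht z hz y hy x hx hP.reverse
  by_cases hyu : y = u ∨ y = a
  · simp only [SeesEvenly]
    grind [SimpleGraph.adj_comm]
  · have mem : ∀ {y x}, y ∈ X → H.Adj y x → x ∈ X → y ≠ u → y ≠ a → x ≠ u → x ≠ a →
        x ∈ X \ {w, u, a, b} := by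
      simp only [Set.mem_sdiff, Set.mem_insert_iff, Set.mem_singleton_iff]
      grind [SimpleGraph.adj_comm]
    have hzu : ¬ (z = u ∨ z = a) := by clear hu ha hw hb mid mem hX; grind
    rw [not_or] at hyu hzu
    have hxX := mem hy hP.1.symm hx hyu.1 hyu.2 hxu hxa
    have hyX := mem hx hP.1 hy hxu hxa hyu.1 hyu.2
    have hzX := mem ht hP.2.2.1.symm hz htu hta hzu.1 hzu.2
    have htX := mem hz hP.2.2.1 ht hzu.1 hzu.2 htu hta
    by_cases heX : e ∈ X \ {w, u, a, b}
    · exact hX hxX hyX hzX htX heX hP hex hey hez het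
    · have const : ∀ v ∈ X \ {w, u, a, b}, ∀ v' ∈ X \ {w, u, a, b}, H.Adj e v → H.Adj e v' := by
        clear mid mem hX
        simp only [Set.mem_sdiff, Set.mem_insert_iff, Set.mem_singleton_iff] at heX ⊢
        grind [SimpleGraph.adj_comm]
      exact ⟨⟨const _ hxX _ htX, const _ htX _ hxX⟩, ⟨const _ hyX _ hzX, const _ hzX _ hyX⟩,
        const _ hxX _ hyX⟩

theorem deleteEdges_sup_edge_adj :
    (H.deleteEdges {s(w, k), s(u, t)} ⊔ SimpleGraph.edge u s).Adj x y ↔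
    H.Adj x y ∧ ¬ (x = w ∧ y = k ∨ x = k ∧ y = w) ∧ ¬ (x = u ∧ y = t ∨ x = t ∧ y = u) ∨
      (x = u ∧ y = s ∨ x = s ∧ y = u) ∧ x ≠ y := by
  simp [SimpleGraph.edge_adj]

-- The new graph is a thin spider with the legs `w`, `t` and the body `u`, `v` over the head
-- `R ∪ {s, k}`, in which `s` is isolated in `R ∪ {s}` and `k` is universal.
theorem IsMatchedSpider.isP4SparseOn_rewire (h : IsMatchedSpider H True {w, s, t} {u, v, k} R f g)
    (hw : f w = v) (hs : f s = u) (ht : f t = k) (huv : u ≠ v) (huk : u ≠ k) (hvk : v ≠ k)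
    (hR : IsP4SparseOn H R) :
    IsP4SparseOn (H.deleteEdges {s(w, k), s(u, t)} ⊔ SimpleGraph.edge u s)
      ({w, s, t} ∪ {u, v, k} ∪ R) := by
  have hSK := h.leg_notMem_body
  have hSR := h.leg_notMem_head
  have hKR := h.body_notMem_head
  have hSS := h.indep
  have hKK := h.clique
  have hRK := h.adj_head_body
  have hRS := h.not_adj_head_leg
  have hadj : ∀ x ∈ ({w, s, t} : Set V), ∀ y ∈ ({u, v, k} : Set V), (H.Adj x y ↔ y ≠ f x) :=
    fun x hx y hy => h.adj_thick hx hy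
  simp only [Set.mem_insert_iff, Set.mem_singleton_iff, forall_eq_or_imp, forall_eq] at *
  have hH' := fun x y : V => deleteEdges_sup_edge_adj (H := H) (k := k) (s := s) (t := t) (u := u)
    (w := w) (x := x) (y := y)
  generalize H.deleteEdges {s(w, k), s(u, t)} ⊔ SimpleGraph.edge u s = H' at hH' ⊢
  have hrest : IsP4SparseOn H' (insert k (insert s R)) := by
    have hR' : IsP4SparseOn H' R := hR.congr (by grind)
    refine (hR'.insert_isolated ?_).insert_universal ?_
    all_goals grind [SimpleGraph.adj_comm]
  refine IsP4SparseOn.of_two_legs (w := w) (u := u) (a := v) (b := t) (hrest.mono ?_) huv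
    ?_ ?_ ?_ ?_
  all_goals
    simp only [Set.subset_def, Set.mem_sdiff, Set.mem_union, Set.mem_insert_iff,
      Set.mem_singleton_iff]
    grind [SimpleGraph.adj_comm]

end Rewiring

section Improvement

variable {V : Type*} [Finite V] {G : SimpleGraph V} {u : V} {p : List (NodeLabel × Set V)}
  {H H' : SimpleGraph (Option V)} {M R : Set (Option V)} {f g : Option V → Option V}

theorem fill_lt_of_ncard_sdiff_lt (hH : addTail G u ≤ H) (hH' : addTail G u ≤ H')
    (h : (H'.edgeSet \ H.edgeSet).ncard < (H.edgeSet \ H'.edgeSet).ncard) :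
    fill G u H' < fill G u H := by
  have := Set.ncard_inter_add_ncard_sdiff_eq_ncard H.edgeSet H'.edgeSet
  have := Set.inter_comm H.edgeSet H'.edgeSet ▸
    Set.ncard_inter_add_ncard_sdiff_eq_ncard H'.edgeSet H.edgeSet
  have := Set.ncard_sdiff_add_ncard_of_subset (SimpleGraph.edgeSet_mono hH)
  have := Set.ncard_sdiff_add_ncard_of_subset (SimpleGraph.edgeSet_mono hH')
  unfold fill
  omega

theorem IsMinCompletion.not_isP4SparseOn (h : IsMinCompletion G u H) (hM : IsModule H M)
    (hnt : M.Nontrivial) (hH' : addTail G u ≤ H')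
    (hHH' : ∀ x y, x ∉ M → (H'.Adj x y ↔ H.Adj x y))
    (hlt : (H'.edgeSet \ H.edgeSet).ncard < (H.edgeSet \ H'.edgeSet).ncard) :
    ¬ IsP4SparseOn H' M := fun hin =>
  (fill_lt_of_ncard_sdiff_lt h.1.1 hH' hlt).not_ge
    (h.2 H' ⟨hH', h.1.2.replace_module hM hnt hHH' hin⟩)

theorem IsTailModule.not_isP4SparseOn {N : Set (Option V)} (h : IsTailModule G u p H N)
    (hH' : addTail G u ≤ H') (hHH' : ∀ x y, x ∉ N → (H'.Adj x y ↔ H.Adj x y))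
    (hlt : (H'.edgeSet \ H.edgeSet).ncard < (H.edgeSet \ H'.edgeSet).ncard) :
    ¬ IsP4SparseOn H' N := fun hin =>
  h.isMin.not_isP4SparseOn h.isModule ⟨_, h.self_mem, _, h.tail_mem, Option.some_ne_none u⟩ hH'
    hHH' hlt hin

theorem IsTailModule.adj_of_thick {s t v k : V}
    (h : IsTailModule G u p H ({none, some s, some t} ∪ {some u, some v, some k} ∪ R))
    (hs : IsMatchedSpider H True {none, some s, some t} {some u, some v, some k} R f g)
    (hfw : f none = some v) (hfs : f (some s) = some u) (hft : f (some t) = some k)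
    (huv : u ≠ v) (huk : u ≠ k) (hvk : v ≠ k) : G.Adj u t := by
  by_contra hut
  have hR := h.isMin.1.2.isP4SparseOn R
  have hrewire := hs.isP4SparseOn_rewire hfw hfs hft (by simpa) (by simpa) (by simpa) hR
  have hus := hs.adj_thick (s := some s) (k := some u) (by simp) (by simp)
  have hwu := hs.adj_thick (s := none) (k := some u) (by simp) (by simp)
  have hwk := hs.adj_thick (s := none) (k := some k) (by simp) (by simp)
  have htu := hs.adj_thick (s := some t) (k := some u) (by simp) (by simp)
  simp only [hfw, hfs, hft, ne_eq, Option.some.injEq, not_true_eq_false, iff_false]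
    at hus hwu hwk htu
  refine h.not_isP4SparseOn (addTail_le_iff.2 ⟨fun x y hxy => ?_, ?_⟩) (fun x y hx => ?_) ?_
    hrewire
  · have := h.adj hxy
    rw [SimpleGraph.comap_adj, deleteEdges_sup_edge_adj]
    grind [SimpleGraph.adj_comm]
  · rw [deleteEdges_sup_edge_adj]
    grind
  · simp only [Set.mem_union, Set.mem_insert_iff, Set.mem_singleton_iff] at hx
    rw [deleteEdges_sup_edge_adj]
    grind
  · refine (Set.ncard_le_ncard (t := {s(some u, some s)}) ?_).trans_lt ?_
    · rintro ⟨x, y⟩ hxy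
      rw [Set.mem_sdiff, SimpleGraph.mem_edgeSet, SimpleGraph.mem_edgeSet,
        deleteEdges_sup_edge_adj] at hxy
      exact Sym2.eq_iff.2 (by grind)
    · rw [Set.ncard_singleton, Set.one_lt_ncard_iff_nontrivial]
      refine ⟨s(none, some k), ?_, s(some u, some t), ?_, by simp⟩
      all_goals
        rw [Set.mem_sdiff, SimpleGraph.mem_edgeSet, SimpleGraph.mem_edgeSet,
          deleteEdges_sup_edge_adj]
        grind [SimpleGraph.adj_comm]

end Improvement

section Legs

variable {V : Type*} {G : SimpleGraph V} {thick : Prop} {S K R : Set V} {f g : V → V} {k z : V}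

theorem IsMatchedSpider.image_body (h : IsMatchedSpider G thick S K R f g) : g '' K = S :=
  Set.Subset.antisymm (Set.image_subset_iff.2 h.g_mem) fun s hs => ⟨f s, h.f_mem s hs, h.g_f s hs⟩

theorem IsMatchedSpider.eq_of_not_adj_body_of_thick (h : IsMatchedSpider G True S K R f g)
    (hk : k ∈ K) (hz : z ∈ S ∪ K ∪ R) (hzk : z ≠ k) (hadj : ¬ G.Adj z k) : z = g k := by
  have hzS := h.mem_leg_of_not_adj_body hk hz hzk hadj
  rw [not_not.1 (mt (h.adj_thick hzS hk).2 hadj), h.g_f z hzS]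

end Legs

section Thick

variable {V : Type*} [Finite V] {G : SimpleGraph V} {u : V} {p : List (NodeLabel × Set V)}
  {H : SimpleGraph (Option V)} {S K R : Set (Option V)} {f g : Option V → Option V}

theorem IsTailModule.adj_body_of_thick {s t v k : V}
    (h : IsTailModule G u p H ({none, some s, some t} ∪ {some u, some v, some k} ∪ R))
    (hs : IsMatchedSpider H True {none, some s, some t} {some u, some v, some k} R f g)
    (hfw : f none = some v) (hfs : f (some s) = some u) (hft : f (some t) = some k)
    (huv : u ≠ v) (huk : u ≠ k) (hvk : v ≠ k) : G.Adj u k := by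
  by_contra huk_G
  have hut : G.Adj u t := h.adj_of_thick hs hfw hfs hft huv huk hvk
  have hwk : H.Adj none (some k) :=
    (hs.adj_thick (by simp) (by simp)).2 (by simp [hfw, hvk.symm])
  have huk_H : H.Adj (some u) (some k) := hs.clique _ (by simp) _ (by simp) (by simpa)
  have hcost := h.excess_le_of_adj hut (by simp)
  have hfill : {y ∈ formationFill G u {y | level p t ≤ level p y} |
      some y ∈ {none, some s, some t} ∪ {some u, some v, some k} ∪ R} ⊆ {v} := by
    rintro y ⟨hy, hyN⟩
    have hyt := (h.adj (h.path.adj_of_mem_formationFill h.label_ne_two hut hy)).symm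
    have hyK := hs.mem_body_of_adj_leg (by simp) hyN hyt
    have hyk := (hs.adj_thick (by simp) hyK).1 hyt.symm
    simp only [Set.mem_insert_iff, Set.mem_singleton_iff, Option.some.injEq] at hyK
    grind [formationFill]
  have := (Set.ncard_le_ncard hfill).trans_eq (Set.ncard_singleton v)
  have := (Set.ncard_pos (Set.toFinite _)).2
    (⟨k, ⟨huk.symm, hwk⟩, by simp⟩ : (innerTailNbrs u H
      ({none, some s, some t} ∪ {some u, some v, some k} ∪ R)).Nonempty)
  have := (Set.ncard_pos (Set.toFinite _)).2
    (⟨s(u, k), huk_H, huk_G⟩ : ((H.comap some).edgeSet \ G.edgeSet).Nonempty)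
  omega

theorem IsTailModule.not_adj_of_thick {s t v k : V}
    (h : IsTailModule G u p H ({none, some s, some t} ∪ {some u, some v, some k} ∪ R))
    (hs : IsMatchedSpider H True {none, some s, some t} {some u, some v, some k} R f g)
    (hfw : f none = some v) (hfs : f (some s) = some u) (hft : f (some t) = some k)
    (huv : u ≠ v) (huk : u ≠ k) (hvk : v ≠ k) : ¬ G.Adj s k := by
  intro hsk
  have hut : G.Adj u t := h.adj_of_thick hs hfw hfs hft huv huk hvk
  have huk_G : G.Adj u k := h.adj_body_of_thick hs hfw hfs hft huv huk hvk
  have hus : ¬ G.Adj u s := fun e =>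
    (hs.adj_thick (s := some s) (k := some u) (by simp) (by simp)).1 (h.adj e).symm hfs.symm
  have htk : ¬ G.Adj t k := fun e =>
    (hs.adj_thick (s := some t) (k := some k) (by simp) (by simp)).1 (h.adj e) hft.symm
  have hst : level p s < level p t := by
    by_contra hle
    rcases (not_lt.1 hle).lt_or_eq with hlt | heq
    · have := h.path.adj_of_self_adj h.label_ne_two hut hlt
      exact hs.indep _ (by simp) _ (by simp) (h.adj this)
    · exact hus ((h.path.self_adj_congr h.label_ne_two heq).1 hut)
  have hks : level p k ≤ level p s := not_lt.1 fun hlt =>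
    h.path.not_adj_of_not_self_adj h.label_ne_two hus hlt hsk
  exact htk (h.path.adj_of_self_adj h.label_ne_two huk_G (hks.trans_lt hst)).symm

theorem IsTailModule.exists_otherFill_eq_empty_of_thick (h : IsTailModule G u p H (S ∪ K ∪ R))
    (hs : IsMatchedSpider H True S K R f g) (hu : some u ∈ K) (hw : none ∈ S)
    (hK : 3 ≤ K.ncard) :
    ∃ k x, otherFill G u p H (S ∪ K ∪ R) (level p x) = ∅ ∧ u ≠ k ∧ f none ≠ some k ∧
      K = {some u, f none, some k} := by
  have mem_tailNbrs : ∀ k, some k ∈ K → some k ≠ some u → some k ≠ f none →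
      k ∈ innerTailNbrs u H (S ∪ K ∪ R) := fun k hk hku hkf =>
    ⟨⟨fun e => hku (e ▸ rfl), (hs.adj_thick hw hk).2 hkf⟩, .inl (.inr hk)⟩
  have exists_some : ∀ k ∈ K, ∃ y, k = some y := fun k hk =>
    Option.ne_none_iff_exists'.1 fun e => hs.leg_notMem_body _ hw (e ▸ hk)
  obtain ⟨_, hk, hkuf⟩ := Set.exists_mem_notMem_of_ncard_lt_ncard (s := {some u, f none}) (t := K)
    ((Set.ncard_insert_le _ _).trans_lt (by rwa [Set.ncard_singleton]))
  obtain ⟨k, rfl⟩ := exists_some _ hk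
  simp only [Set.mem_insert_iff, Set.mem_singleton_iff, not_or] at hkuf
  have hkT := mem_tailNbrs k hk hkuf.1 hkuf.2
  obtain ⟨x, hxN, hx, hmin⟩ := h.exists_adj_mem (.inl ⟨k, hkT⟩)
  have hcost := h.otherFill_excess_le hx hxN hmin
  have hlow : {y | some y ∈ S ∪ K ∪ R ∧ y ≠ u ∧ level p x < level p y ∧
      ¬ H.Adj (some u) (some y)}.ncard ≤ 1 :=
    (Set.ncard_le_one (Set.toFinite _)).2 fun y hy z hz => Option.some_injective _ <|
      (hs.eq_of_not_adj_body_of_thick hu hy.1 (by simpa using hy.2.1) (hy.2.2.2 ·.symm)).trans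
        (hs.eq_of_not_adj_body_of_thick hu hz.1 (by simpa using hz.2.1) (hz.2.2.2 ·.symm)).symm
  have hTpos := (Set.ncard_pos (Set.toFinite _)).2 ⟨k, hkT⟩
  refine ⟨k, x, (Set.ncard_eq_zero (Set.toFinite _)).1 (by omega), fun e => hkuf.1 (e ▸ rfl),
    (hkuf.2 ·.symm), Set.Subset.antisymm (fun l hl => ?_) ?_⟩
  · obtain ⟨y, rfl⟩ := exists_some l hl
    have := (Set.ncard_le_one (Set.toFinite _)).1 (by omega) k hkT y
    have := mem_tailNbrs y hl
    simp only [Set.mem_insert_iff, Set.mem_singleton_iff]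
    grind
  · rintro _ (rfl | rfl | rfl)
    exacts [hu, hs.f_mem _ hw, hk]

theorem IsTailModule.not_thick (h : IsTailModule G u p H (S ∪ K ∪ R))
    (hs : IsMatchedSpider H True S K R f g) (hu : some u ∈ K) (hw : none ∈ S)
    (hK : 3 ≤ K.ncard) : False := by
  obtain ⟨v, hv⟩ : ∃ v, f none = some v := Option.ne_none_iff_exists'.1 fun e =>
    hs.leg_notMem_body _ hw (e ▸ hs.f_mem _ hw)
  obtain ⟨k, x, hO, huk, hvk, hK⟩ := h.exists_otherFill_eq_empty_of_thick hs hu hw hK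
  have huv : some u ≠ some v := hv ▸ (hs.adj_thick hw hu).1 h.isMin.1.adj_tail
  rw [hv] at hvk hK
  subst hK
  have hfu := hs.f_g _ hu
  have hfk := hs.f_g (some k) (by simp)
  have hgv := hv ▸ hs.g_f _ hw
  obtain ⟨s, hgu⟩ : ∃ s, g (some u) = some s := Option.ne_none_iff_exists'.1 fun e =>
    huv (by rw [← hv, ← e, hfu])
  obtain ⟨t, hgk⟩ : ∃ t, g (some k) = some t := Option.ne_none_iff_exists'.1 fun e =>
    hvk (by rw [← hv, ← e, hfk])
  have hS := hs.image_body
  rw [Set.image_insert_eq, Set.image_pair, hgu, hgv, hgk, Set.insert_comm] at hS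
  subst hS
  rw [hgu] at hfu
  rw [hgk] at hfk
  have hsu : s ≠ u := fun e => hs.leg_notMem_body (some s) (by simp) (by simp [e])
  refine h.not_adj_of_thick hs hv hfu hfk (by simpa using huv) huk (by simpa using hvk) ?_
  refine adj_of_otherFill_eq_empty hO ?_ huk.symm (.inl hsu)
  exact (hs.adj_thick (by simp) (by simp)).2 (by simpa [hfu] using huk.symm)

end Thick

section Thin

variable {V : Type*} [Finite V] {G : SimpleGraph V} {u : V} {p : List (NodeLabel × Set V)}
  {H : SimpleGraph (Option V)} {N S K R : Set (Option V)} {f g : Option V → Option V}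

theorem IsTailModule.adj_of_leg (h : IsTailModule G u p H (S ∪ K ∪ R))
    (hs : IsMatchedSpider H False S K R f g) {y c : V} (hy : some y ∈ S)
    (hc : f (some y) = some c) : G.Adj c y := by
  by_contra hcy
  have hcK : some c ∈ K := hc ▸ hs.f_mem _ hy
  have hHcy : H.Adj (some c) (some y) := ((hs.adj_thin hy hcK).2 hc.symm).symm
  have hyN : some y ∈ S ∪ K ∪ R := .inl (.inl hy)
  have : some c ∈ S ∪ K ∪ R := .inl (.inr hcK)
  refine h.not_isP4SparseOn (H' := H.deleteEdges {s(some c, some y)})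
    (addTail_le_iff.2 ⟨fun a b hab => ?_, ?_⟩) (fun a b ha => ?_) ?_ ?_
  · simp only [SimpleGraph.comap_adj, SimpleGraph.deleteEdges_adj, Set.mem_singleton_iff]
    refine ⟨h.adj hab, fun e => ?_⟩
    grind [SimpleGraph.adj_comm]
  · simp [h.isMin.1.adj_tail]
  · simp only [SimpleGraph.deleteEdges_adj, Set.mem_singleton_iff]
    grind
  · rw [Set.ncard_eq_zero (Set.toFinite _) |>.2
      (Set.sdiff_eq_empty.2 (SimpleGraph.edgeSet_mono (SimpleGraph.deleteEdges_le _)))]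
    exact (Set.ncard_pos (Set.toFinite _)).2 ⟨s(some c, some y), hHcy, by simp⟩
  · rw [← Set.insert_sdiff_self_of_mem hyN]
    refine ((h.isMin.1.2.isP4SparseOn _).congr fun a ha b hb => ?_).insert_isolated
      fun z hz hyz => ?_
    · have := ha.2
      have := hb.2
      simp only [SimpleGraph.deleteEdges_adj, Set.mem_singleton_iff]
      grind
    · simp only [SimpleGraph.deleteEdges_adj, Set.mem_singleton_iff] at hyz
      have hzK := hs.mem_body_of_adj_leg hy hz.1 hyz.1.symm
      have := (hs.adj_thin hy hzK).1 hyz.1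
      grind

theorem IsTailModule.level_le_of_adj {x c : V} (h : IsTailModule G u p H N) (hx : G.Adj u x)
    (hmin : ∀ y, some y ∈ N → G.Adj u y → level p x ≤ level p y)
    (hO : (otherFill G u p H N (level p x)).ncard ≤ 1) (hc : some c ∈ N)
    (huc : H.Adj (some u) (some c)) (hxc : H.Adj (some x) (some c)) : level p x ≤ level p c := by
  by_contra! hlt
  have hcu : c ≠ u := fun e => huc.ne (e ▸ rfl)
  have huc_G : ¬ G.Adj u c := fun e => hlt.not_ge (hmin c hc e)
  have hxc_G : ¬ G.Adj x c := fun e =>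
    h.path.not_adj_of_not_self_adj h.label_ne_two huc_G hlt e.symm
  have := (Set.ncard_le_one (Set.toFinite _)).1 hO
    _ (mem_otherFill huc huc_G hcu (.inr (.inr hlt.le)))
    _ (mem_otherFill hxc hxc_G hcu (.inl hx.ne'))
  exact hx.ne (Sym2.congr_left.1 this)

end Thin

section WingSpider

variable {V : Type*} {G : SimpleGraph V} {u x y : V} {p : List (NodeLabel × Set V)}
  {H : SimpleGraph (Option V)} {S K R : Set (Option V)} {f g : Option V → Option V}

theorem IsTailModule.eq_of_lower_leg (h : IsTailModule G u p H (S ∪ K ∪ R))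
    (hs : IsMatchedSpider H False S K R f g) (hx : G.Adj u x) (hxN : some x ∈ S ∪ K ∪ R)
    (hy : some y ∈ S) (hxy : level p x < level p y) : f (some y) = some x := by
  have hadj := h.adj (h.path.adj_of_self_adj h.label_ne_two hx hxy)
  exact ((hs.adj_thin hy (hs.mem_body_of_adj_leg hy hxN hadj)).1 hadj.symm).symm

variable [Finite V]

theorem IsTailModule.otherFill_excess_le_one (h : IsTailModule G u p H (S ∪ K ∪ R))
    (hs : IsMatchedSpider H False S K R f g) (hu : some u ∈ K) (hx : G.Adj u x)
    (hxN : some x ∈ S ∪ K ∪ R)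
    (hmin : ∀ y, some y ∈ S ∪ K ∪ R → G.Adj u y → level p x ≤ level p y) :
    (otherFill G u p H (S ∪ K ∪ R) (level p x)).ncard + (outerNbrs u H (S ∪ K ∪ R) \
      formationFill G u {y | level p x ≤ level p y}).ncard ≤ 1 := by
  have hlow : {y | some y ∈ S ∪ K ∪ R ∧ y ≠ u ∧ level p x < level p y ∧
      ¬ H.Adj (some u) (some y)}.ncard ≤ 1 := by
    have leg_eq : ∀ y, some y ∈ S ∪ K ∪ R → y ≠ u → level p x < level p y →
        ¬ H.Adj (some u) (some y) → some y = g (some x) := fun y hyN hyu hxy huy => by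
      have hyS := hs.mem_leg_of_not_adj_body hu hyN (by simpa) (huy ·.symm)
      rw [← h.eq_of_lower_leg hs hx hxN hyS hxy, hs.g_f _ hyS]
    exact (Set.ncard_le_one (Set.toFinite _)).2 fun y hy z hz => Option.some_injective _ <|
      (leg_eq y hy.1 hy.2.1 hy.2.2.1 hy.2.2.2).trans
        (leg_eq z hz.1 hz.2.1 hz.2.2.1 hz.2.2.2).symm
  have := h.otherFill_excess_le hx hxN hmin
  omega

theorem IsTailModule.level_lt_of_leg (h : IsTailModule G u p H (S ∪ K ∪ R))
    (hs : IsMatchedSpider H False S K R f g) (hf : f none = some u) (hw : none ∈ S)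
    (hx : G.Adj u x) (hxN : some x ∈ S ∪ K ∪ R)
    (hmin : ∀ y, some y ∈ S ∪ K ∪ R → G.Adj u y → level p x ≤ level p y)
    (hO : (otherFill G u p H (S ∪ K ∪ R) (level p x)).ncard ≤ 1) (hy : some y ∈ S) :
    level p x < level p y := by
  have hu : some u ∈ K := hf ▸ hs.f_mem _ hw
  have eq_none : ∀ s ∈ S, H.Adj (some u) s → s = none := fun s hsS hus => by
    rw [← hs.g_f s hsS, ← (hs.adj_thin hsS hu).1 hus.symm, ← hf, hs.g_f _ hw]
  have huy : ¬ G.Adj u y := fun e => Option.some_ne_none y (eq_none _ hy (h.adj e))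
  obtain ⟨c, hc⟩ : ∃ c, f (some y) = some c := Option.ne_none_iff_exists'.1 fun e =>
    hs.leg_notMem_body _ hw (e ▸ hs.f_mem _ hy)
  have hcK : some c ∈ K := hc ▸ hs.f_mem _ hy
  have hcy : G.Adj c y := h.adj_of_leg hs hy hc
  have hcu : c ≠ u := fun e => huy (e ▸ hcy)
  by_contra! hyx
  have hyx' : level p y < level p x := hyx.lt_of_ne fun e =>
    huy ((h.path.self_adj_congr h.label_ne_two e).2 hx)
  have hcy_le : level p c ≤ level p y := not_lt.1 fun hlt =>
    h.path.not_adj_of_not_self_adj h.label_ne_two huy hlt hcy.symm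
  have hxc : x ≠ c := fun e => (hcy_le.trans_lt hyx').ne (e ▸ rfl)
  have hx_notMem : some x ∉ S := fun hxS => Option.some_ne_none x (eq_none _ hxS (h.adj hx))
  have hxKR : some x ∈ K ∪ R := (Set.union_assoc S K R ▸ hxN).resolve_left hx_notMem
  exact (hcy_le.trans_lt hyx').not_ge (h.level_le_of_adj hx hmin hO (.inl (.inr hcK))
    (hs.adj_body hcK (.inl hu) (by simpa using hcu.symm)) (hs.adj_body hcK hxKR (by simpa)))

theorem IsTailModule.exists_pair_of_thin (h : IsTailModule G u p H (S ∪ K ∪ R))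
    (hs : IsMatchedSpider H False S K R f g) (hf : f none = some u) (hw : none ∈ S)
    (hx : G.Adj u x) (hxN : some x ∈ S ∪ K ∪ R)
    (hmin : ∀ y, some y ∈ S ∪ K ∪ R → G.Adj u y → level p x ≤ level p y)
    (hO : (otherFill G u p H (S ∪ K ∪ R) (level p x)).ncard ≤ 1) :
    ∃ b, f (some b) = some x ∧ S = {none, some b} ∧ K = {some u, some x} := by
  have f_eq : ∀ y, some y ∈ S → f (some y) = some x := fun y hy =>
    h.eq_of_lower_leg hs hx hxN hy (h.level_lt_of_leg hs hf hw hx hxN hmin hO hy)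
  obtain ⟨k, hk, hku⟩ := hs.exists_body_ne (some u)
  obtain ⟨b, hb⟩ : ∃ b, g k = some b := Option.ne_none_iff_exists'.1 fun e =>
    hku (by rw [← hf, ← e, hs.f_g k hk])
  have hbS : some b ∈ S := hb ▸ hs.g_mem k hk
  refine ⟨b, f_eq b hbS, Set.Subset.antisymm ?_ ?_, Set.Subset.antisymm (fun l hl => ?_) ?_⟩
  · rintro (_ | y) hy
    · exact .inl rfl
    · exact .inr (by rw [← hs.g_f _ hy, f_eq y hy, ← f_eq b hbS, hs.g_f _ hbS]; rfl)
  · rintro _ (rfl | rfl)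
    exacts [hw, hbS]
  · rw [← hs.f_g l hl]
    rcases hgl : g l with _ | y
    · exact .inl hf
    · exact .inr (f_eq y (hgl ▸ hs.g_mem l hl))
  · rintro _ (rfl | rfl)
    exacts [hf ▸ hs.f_mem _ hw, f_eq b hbS ▸ hs.f_mem _ hbS]

/-- The situation of the second claim: a module of the minimum completion `H` that is a thin spider
with the legs `w`, `b` and the body `u`, `a`, where `a` branches off the tree path above all the
other vertices of the module, and `H` is not much cheaper than the formation at the level of `a`. -/
structure IsWingSpider (G : SimpleGraph V) (u : V) (p : List (NodeLabel × Set V))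
    (H : SimpleGraph (Option V)) (a b : V) (R : Set (Option V)) : Prop extends
    IsTailModule G u p H ({none, some b} ∪ {some u, some a} ∪ R) where
  isThinSpider : IsThinSpider H {none, some b} {some u, some a} R
  isP4 : IsP4 H none (some u) (some a) (some b)
  adj_body : G.Adj u a
  level_lt_leg : level p a < level p b
  level_lt_head : ∀ r, some r ∈ R → level p a < level p r
  excess_le_one : (otherFill G u p H ({none, some b} ∪ {some u, some a} ∪ R) (level p a)).ncard +
    (outerNbrs u H ({none, some b} ∪ {some u, some a} ∪ R) \
      formationFill G u {y | level p a ≤ level p y}).ncard ≤ 1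

theorem IsTailModule.exists_isWingSpider (h : IsTailModule G u p H (S ∪ K ∪ R))
    (hs : IsThinSpider H S K R) (hu : some u ∈ K) (hw : none ∈ S) :
    ∃ a b, S = {none, some b} ∧ K = {some u, some a} ∧ IsWingSpider G u p H a b R := by
  have hthin := hs
  obtain ⟨f, g, hs⟩ := hs.exists_isMatchedSpider
  have hf : f none = some u := ((hs.adj_thin hw hu).1 h.isMin.1.adj_tail).symm
  obtain ⟨k, hk, hku⟩ := hs.exists_body_ne (some u)
  obtain ⟨k, rfl⟩ := Option.ne_none_iff_exists'.1 fun e => hs.leg_notMem_body _ hw (e ▸ hk)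
  obtain ⟨a, haN, ha, hmin⟩ := h.exists_adj_mem
    (.inr ⟨k, .inl (.inr hk), hs.clique _ hu _ hk hku.symm⟩)
  have hcost := h.otherFill_excess_le_one hs hu ha haN hmin
  have hO := (Nat.le_add_right _ _).trans hcost
  obtain ⟨b, hb, rfl, rfl⟩ := h.exists_pair_of_thin hs hf hw ha haN hmin hO
  have hab := h.level_lt_of_leg hs hf hw ha haN hmin hO (y := b) (by simp)
  refine ⟨a, b, rfl, rfl, h, hthin, ⟨h.isMin.1.adj_tail, h.adj ha, ?_, ?_, ?_, ?_⟩, ha, hab,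
    fun r hr => ?_, hcost⟩
  · exact ((hs.adj_thin (by simp) (by simp)).2 hb.symm).symm
  · rw [hs.adj_thin (by simp) (by simp), hf]
    simpa using ha.ne'
  · exact hs.indep _ (by simp) _ (by simp)
  · rw [H.adj_comm, hs.adj_thin (by simp) (by simp), hb]
    simpa using ha.ne
  · have har := (hs.adj_head_body _ hr (some a) (by simp)).symm
    have hur := (hs.adj_head_body _ hr (some u) (by simp)).symm
    have hle := h.level_le_of_adj ha hmin hO (.inr hr) hur har
    refine lt_of_not_ge fun hra => ?_
    have hrb := h.path.adj_of_self_adj h.label_ne_two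
      ((h.path.self_adj_congr h.label_ne_two (hle.antisymm hra)).1 ha) (hra.trans_lt hab)
    exact hs.not_adj_head_leg _ hr (some b) (by simp) (h.adj hrb)

end WingSpider

namespace IsWingSpider

variable {V : Type*} {G : SimpleGraph V} {u a b x y z : V} {p : List (NodeLabel × Set V)}
  {H : SimpleGraph (Option V)} {R : Set (Option V)}

theorem eq_or_mem (hy : some y ∈ ({none, some b} ∪ {some u, some a} ∪ R : Set (Option V))) :
    y = u ∨ y = a ∨ y = b ∨ some y ∈ R := by
  simpa [or_assoc] using hy

theorem not_adj_leg (h : IsWingSpider G u p H a b R) : ¬ G.Adj u b :=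
  fun e => h.isP4.2.2.2.2.2 (h.adj e)

theorem leg_ne_self (h : IsWingSpider G u p H a b R) : b ≠ u :=
  fun e => h.isP4.pairwise_ne.2.2.2.2.1 (e ▸ rfl)

theorem not_adj_head_leg (h : IsWingSpider G u p H a b R) (hx : some x ∈ R) : ¬ G.Adj x b := by
  obtain ⟨_, _, hs⟩ := h.isThinSpider.exists_isMatchedSpider
  exact fun e => hs.not_adj_head_leg _ hx (some b) (by simp) (h.adj e)

theorem nbrs_subset_of_forall_adj (h : IsWingSpider G u p H a b R) (huz : ¬ G.Adj u z)
    (hzb : level p z ≤ level p b)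
    (hz : ∀ y, some y ∈ ({none, some b} ∪ {some u, some a} ∪ R : Set (Option V)) → y ≠ u →
      G.Adj z y) :
    {y ∈ G.neighborSet u |
      some y ∈ ({none, some b} ∪ {some u, some a} ∪ R : Set (Option V))} ⊆ {a} := by
  rintro y ⟨huy, hy⟩
  rcases eq_or_mem hy with rfl | rfl | rfl | hyR
  · exact absurd huy (SimpleGraph.irrefl _)
  · rfl
  · exact absurd huy h.not_adj_leg
  · have hzy : level p z ≤ level p y := hzb.trans <| not_lt.1 fun hlt =>
      h.not_adj_head_leg hyR (h.path.adj_of_self_adj h.label_ne_two huy hlt)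
    refine absurd (hz y hy huy.ne') (h.path.not_adj_of_not_self_adj h.label_ne_two huz ?_)
    exact hzy.lt_of_ne fun e => huz ((h.path.self_adj_congr h.label_ne_two e).2 huy)

variable [Finite V]

theorem otherFill_eq_empty (h : IsWingSpider G u p H a b R) (huz : G.Adj u z)
    (hz : some z ∉ ({none, some b} ∪ {some u, some a} ∪ R : Set (Option V)))
    (haz : level p a ≤ level p z) :
    otherFill G u p H ({none, some b} ∪ {some u, some a} ∪ R) (level p a) = ∅ := by
  have hcost := h.excess_le_one
  have hslack : z ∈ outerNbrs u H ({none, some b} ∪ {some u, some a} ∪ R) \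
      formationFill G u {y | level p a ≤ level p y} :=
    ⟨⟨hz, h.adj huz⟩, fun hF => hF.2.1 haz huz⟩
  have := Set.ncard_ne_zero_of_mem hslack
  exact (Set.ncard_eq_zero (Set.toFinite _)).1 (by omega)

theorem mem_of_adj_of_level_lt (h : IsWingSpider G u p H a b R) (huz : G.Adj u z)
    (haz : level p a < level p z) :
    some z ∈ ({none, some b} ∪ {some u, some a} ∪ R : Set (Option V)) := by
  by_contra hz
  have hO := h.otherFill_eq_empty huz hz haz.le
  obtain ⟨y, hyu, hy, hiff⟩ := h.path.exists_level_succ h.label_ne_two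
    ((Nat.succ_le_of_lt haz).trans_lt (h.path.level_lt huz.ne'))
  have huy : ¬ G.Adj u y := fun e => hiff.1 e h.adj_body
  have hyz : level p y < level p z := lt_of_le_of_ne (by omega) fun e =>
    huy ((h.path.self_adj_congr h.label_ne_two e).2 huz)
  by_cases hyN : some y ∈ ({none, some b} ∪ {some u, some a} ∪ R : Set (Option V))
  · have hzy := (h.isModule.adj_iff hz h.self_mem hyN).1 (h.adj huz).symm
    exact h.path.not_adj_of_not_self_adj h.label_ne_two huy hyz
      (adj_of_otherFill_eq_empty hO hzy hyu (.inl huz.ne')).symm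
  · have hay := h.path.adj_of_self_adj h.label_ne_two h.adj_body (y := y) (by omega)
    have hyu_H := (h.isModule.adj_iff (z := some u) hyN (by simp) h.self_mem).1 (h.adj hay).symm
    exact huy (adj_of_otherFill_eq_empty hO hyu_H.symm hyu (.inr (.inl hyN)))

theorem mem_of_not_adj_of_level_lt (h : IsWingSpider G u p H a b R) (hzu : z ≠ u)
    (huz : ¬ G.Adj u z) (haz : level p a < level p z) :
    some z ∈ ({none, some b} ∪ {some u, some a} ∪ R : Set (Option V)) := by
  by_contra hz
  have hza := (h.adj (h.path.adj_of_self_adj h.label_ne_two h.adj_body haz)).symm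
  have hzN : ∀ y ∈ ({none, some b} ∪ {some u, some a} ∪ R : Set (Option V)), H.Adj (some z) y :=
    fun y hy => (h.isModule.adj_iff hz (by simp) hy).1 hza
  have huz_H := (hzN _ h.self_mem).symm
  have hzN_G : ∀ y, some y ∈ ({none, some b} ∪ {some u, some a} ∪ R : Set (Option V)) → y ≠ u →
      G.Adj z y := fun y hy hyu => by
    by_contra hzy
    have := (Set.ncard_le_one (Set.toFinite _)).1 ((Nat.le_add_right _ _).trans h.excess_le_one)
      _ (mem_otherFill (hzN _ hy) hzy hyu (.inl hzu))
      _ (mem_otherFill huz_H huz hzu (.inr (.inl hz)))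
    grind
  have hzb : level p z ≤ level p b := not_lt.1 fun hlt =>
    h.path.not_adj_of_not_self_adj h.label_ne_two h.not_adj_leg hlt
      (hzN_G b (by simp) h.leg_ne_self).symm
  have hcost := h.excess_le_degree
  have := (Set.ncard_le_ncard (h.nbrs_subset_of_forall_adj huz hzb hzN_G)).trans_eq
    (Set.ncard_singleton a)
  have hfill : s(u, z) ∈ (H.comap some).edgeSet \ G.edgeSet := ⟨huz_H, huz⟩
  have hslack : z ∈ outerNbrs u H ({none, some b} ∪ {some u, some a} ∪ R) \ G.neighborSet u :=
    ⟨⟨hz, huz_H⟩, huz⟩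
  have := Set.ncard_ne_zero_of_mem hfill
  have := Set.ncard_ne_zero_of_mem hslack
  omega

theorem mem_of_level_lt (h : IsWingSpider G u p H a b R) (hzu : z ≠ u)
    (haz : level p a < level p z) :
    some z ∈ ({none, some b} ∪ {some u, some a} ∪ R : Set (Option V)) :=
  (em (G.Adj u z)).elim (h.mem_of_adj_of_level_lt · haz) (h.mem_of_not_adj_of_level_lt hzu · haz)

theorem level_leg (h : IsWingSpider G u p H a b R) : level p b = level p a + 1 := by
  by_contra hne
  have hb := h.path.level_lt h.leg_ne_self
  have hab := h.level_lt_leg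
  obtain ⟨y, -, hy, hiff⟩ := h.path.exists_level_succ h.label_ne_two (x := a) (by omega)
  obtain ⟨z, -, hz, hiff'⟩ := h.path.exists_level_succ h.label_ne_two (x := y) (by omega)
  have huz : G.Adj u z := hiff'.2 fun e => hiff.1 e h.adj_body
  have hzb : level p z < level p b := lt_of_le_of_ne (by omega) fun e =>
    h.not_adj_leg ((h.path.self_adj_congr h.label_ne_two e).1 huz)
  rcases eq_or_mem (h.mem_of_adj_of_level_lt huz (by omega)) with rfl | rfl | rfl | hzR
  · exact SimpleGraph.irrefl _ huz
  · omega
  · exact h.not_adj_leg huz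
  · exact h.not_adj_head_leg hzR (h.path.adj_of_self_adj h.label_ne_two huz hzb)

theorem adj_of_level_eq (h : IsWingSpider G u p H a b R) (hx : level p x = level p a)
    (hxa : x ≠ a) : G.Adj a x := by
  have hux := (h.path.self_adj_congr h.label_ne_two hx).2 h.adj_body
  have hxN : some x ∉ ({none, some b} ∪ {some u, some a} ∪ R : Set (Option V)) := fun hxN => by
    rcases eq_or_mem hxN with rfl | rfl | rfl | hxR
    · exact SimpleGraph.irrefl _ hux
    · exact hxa rfl
    · exact h.not_adj_leg hux
    · exact (h.level_lt_head x hxR).ne' hx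
  have hxa_H := (h.isModule.adj_iff (z := some a) hxN h.self_mem (by simp)).1 (h.adj hux).symm
  exact (adj_of_otherFill_eq_empty (h.otherFill_eq_empty hux hxN hx.ge) hxa_H h.adj_body.ne'
    (.inl hux.ne')).symm

theorem not_adj_of_level_eq (h : IsWingSpider G u p H a b R) (hx : level p x = level p b) :
    ¬ G.Adj b x := by
  have hab := h.level_lt_leg
  have hux : ¬ G.Adj u x := fun e => h.not_adj_leg ((h.path.self_adj_congr h.label_ne_two hx).1 e)
  by_cases hxu : x = u
  · exact fun e => h.not_adj_leg (hxu ▸ e.symm)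
  rcases eq_or_mem (h.mem_of_not_adj_of_level_lt hxu hux (hx ▸ hab)) with rfl | rfl | rfl | hxR
  · exact absurd rfl hxu
  · exact absurd h.adj_body hux
  · exact SimpleGraph.irrefl _
  · exact fun e => h.not_adj_head_leg hxR e.symm

theorem head_eq (h : IsWingSpider G u p H a b R) :
    R = some '' (({x | level p x = level p a + 1} \ {b}) ∪ lower p (level p a + 2)) := by
  obtain ⟨-, hSR, hKR, -⟩ := h.isThinSpider.1
  have hab := h.level_leg
  have hb := h.path.level_lt h.leg_ne_self
  rw [h.path.lower_eq]
  ext (_ | x)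
  · simpa using fun hw => Set.disjoint_left.1 hSR (.inl rfl) hw
  · simp only [Set.mem_image, Option.some.injEq, exists_eq_right, Set.mem_union, Set.mem_sdiff,
      Set.mem_ofPred_eq, Set.mem_singleton_iff]
    refine ⟨fun hx => ?_, fun hx => ?_⟩
    · have hxb : x ≠ b := fun e => Set.disjoint_left.1 hSR (.inr rfl) (e ▸ hx)
      have hxu : x ≠ u := fun e => Set.disjoint_left.1 hKR (.inl rfl) (e ▸ hx)
      have := h.level_lt_head x hx
      grind
    · have hxu : x ≠ u := fun e => by
        have := e ▸ h.path.level_self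
        grind
      have hax : level p a < level p x := by rcases hx with ⟨hx, -⟩ | ⟨hx, -⟩ <;> omega
      rcases eq_or_mem (h.mem_of_level_lt hxu hax) with rfl | rfl | rfl | hxR
      · exact absurd rfl hxu
      · exact absurd hax (lt_irrefl _)
      · grind
      · exact hxR

theorem exists_level (h : IsWingSpider G u p H a b R) :
    ∃ (j : ℕ) (A B : Set V) (a b : V),
      p[j]? = some (NodeLabel.one, A) ∧ p[j + 1]? = some (NodeLabel.zero, B) ∧
      a ∈ A ∧ (∀ x ∈ A, x ≠ a → G.Adj a x) ∧
      b ∈ B ∧ (∀ x ∈ B, ¬ G.Adj b x) ∧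
      IsP4 H none (some u) (some a) (some b) ∧
      IsThinSpider H {none, some b} {some u, some a} (some '' ((B \ {b}) ∪ lower p (j + 2))) ∧
      IsModule H ({none, some b} ∪ {some u, some a} ∪
        some '' ((B \ {b}) ∪ lower p (j + 2))) := by
  have hb := h.path.level_lt h.leg_ne_self
  have hab := h.level_leg
  have hla := (h.path.self_adj_iff h.label_ne_two h.adj_body.ne').1 h.adj_body
  have hlb : label p (level p b) = .zero := by
    have hne_one := mt (h.path.self_adj_iff h.label_ne_two h.leg_ne_self).2 h.not_adj_leg
    have hne_two := h.label_ne_two (level p b)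
    cases hl : label p (level p b) <;> simp_all
  refine ⟨level p a, {x | level p x = level p a}, {x | level p x = level p a + 1}, a, b, ?_, ?_,
    rfl, fun x hx => h.adj_of_level_eq hx, hab,
    fun x hx => h.not_adj_of_level_eq (hx.trans hab.symm), h.isP4, ?_, ?_⟩
  · simpa [hla] using h.path.getElem?_eq (level p a) (by omega)
  · simpa [← hab, hlb] using h.path.getElem?_eq (level p b) hb
  · exact h.head_eq ▸ h.isThinSpider
  · exact h.head_eq ▸ h.isModule

end IsWingSpider

section Main

variable {V : Type*} {G : SimpleGraph V} {u : V} {p : List (NodeLabel × Set V)}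
  {H : SimpleGraph (Option V)}

theorem exists_isMinCompletion_lt_iff {P : SimpleGraph (Option V) → Prop}
    (not_wing : ∀ H, P H → ¬ IsWing H (some u) none)
    (dominated : ∀ H, IsCompletion G u H → ¬ IsWing H (some u) none →
      ∃ H', IsCompletion G u H' ∧ P H' ∧ fill G u H' ≤ fill G u H) :
    (∃ H, IsMinCompletion G u H ∧ ∀ H', IsCompletion G u H' → P H' → fill G u H < fill G u H') ↔
      ∀ H, IsMinCompletion G u H → IsWing H (some u) none := by
  constructor
  · rintro ⟨H₀, hmin, hlt⟩ H hH
    by_contra hw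
    obtain ⟨H', hH', hP, hle⟩ := dominated H hH.1 hw
    exact (hlt H' hH' hP).not_ge (hle.trans (hH.2 _ hmin.1))
  · intro hw
    obtain ⟨H, hH⟩ := exists_isMinCompletion G u
    refine ⟨H, hH, fun H' hH' hP => (hH.2 H' hH').lt_of_ne fun heq => ?_⟩
    exact not_wing H' hP (hw H' ⟨hH', fun H'' hH'' => heq ▸ hH.2 H'' hH''⟩)

variable [Finite V]

theorem beatsFormations_iff :
    BeatsFormations G u ↔ ∀ H, IsMinCompletion G u H → IsWing H (some u) none :=
  exists_isMinCompletion_lt_iff (fun _ h => h.not_isWing) fun _ hH hw => hH.exists_usesFormation hw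

theorem beatsDirectFormations_iff (hG : IsP4Sparse G) (D : IsTreePath G Set.univ u p)
    (h2 : ∀ i, label p i ≠ .two) :
    BeatsDirectFormations G u p ↔ ∀ H, IsMinCompletion G u H → IsWing H (some u) none :=
  exists_isMinCompletion_lt_iff (fun _ h => h.not_isWing D) fun _ hH hw =>
    hH.exists_isFormation hG D h2 hw

theorem IsMinCompletion.exists_isWingSpider (hH : IsMinCompletion G u H) (hG : IsP4Sparse G)
    (D : IsTreePath G Set.univ u p) (h2 : ∀ i, label p i ≠ .two) (hw : IsWing H (some u) none) :
    ∃ a b R, IsWingSpider G u p H a b R := by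
  obtain ⟨S, K, R, hs, hM, hor⟩ := hH.1.exists_spider_of_isWing hw
  rcases hor with ⟨hu, hw⟩ | ⟨hu, hw⟩
  · have h : IsTailModule G u p H (S ∪ K ∪ R) :=
      ⟨hG, D, h2, hH, hM, .inl (.inl hu), .inl (.inr hw)⟩
    obtain ⟨_, f, g, hs⟩ := hs.exists_isMatchedSpider
    exact absurd hw (h.tail_notMem_body hs hu)
  · have h : IsTailModule G u p H (S ∪ K ∪ R) :=
      ⟨hG, D, h2, hH, hM, .inl (.inr hu), .inl (.inl hw)⟩
    rcases hs with hs | hs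
    · obtain ⟨a, b, -, -, h⟩ := h.exists_isWingSpider hs hu hw
      exact ⟨a, b, R, h⟩
    · obtain ⟨f, g, hm⟩ := hs.exists_isMatchedSpider
      exact (h.not_thick hm hu hw hs.2.1).elim

end Main

end P4Completion

open P4Completion in
theorem lemma8 {V : Type*} [Finite V] (G : SimpleGraph V) (hG : IsP4Sparse G) (u : V)
    (T : LabTree V) (hT : IsP4SparseTree G T)
    (p : List (NodeLabel × Set V)) (hp : IsPath T u p) :
    (BeatsFormations G u ↔ ∀ H, IsMinCompletion G u H → IsWing H (some u) none) ∧
    (¬ InSpider G u →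
      (BeatsDirectFormations G u p ↔ ∀ H, IsMinCompletion G u H → IsWing H (some u) none)) ∧
    (∀ H, IsMinCompletion G u H → IsWing H (some u) none →
      InSpider G u ∨
      ∃ (j : ℕ) (A B : Set V) (a b : V),
        p[j]? = some (NodeLabel.one, A) ∧ p[j + 1]? = some (NodeLabel.zero, B) ∧
        a ∈ A ∧ (∀ x ∈ A, x ≠ a → G.Adj a x) ∧
        b ∈ B ∧ (∀ x ∈ B, ¬ G.Adj b x) ∧
        IsP4 H none (some u) (some a) (some b) ∧
        IsThinSpider H {none, some b} {some u, some a}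
          (some '' ((B \ {b}) ∪ lower p (j + 2))) ∧
        IsModule H ({none, some b} ∪ {some u, some a} ∪
          some '' ((B \ {b}) ∪ lower p (j + 2)))) := by
  have D := hT.isTreePath hp
  refine ⟨beatsFormations_iff, fun hu => beatsDirectFormations_iff hG D (D.label_ne_two hu),
    fun H hH hw => or_iff_not_imp_left.2 fun hu => ?_⟩
  obtain ⟨a, b, R, h⟩ := hH.exists_isWingSpider hG D (D.label_ne_two hu) hw
  exact h.exists_level
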